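/- Let $k$ be a field and $H$ a Hopf algebra over $k$ with antipode $S$. A \emph{coquasi-comodule algebra} $(P,\phi)$ of $H$ is a unital, not necessarily associative $k$-algebra $P$ with a right $H$-comodule structure $p\mapsto p_{(0)}\otimes p_{(1)}$ that is a unital algebra map $P\to P\otimes H$, together with a convolution invertible linear map $\phi:H\otimes H\otimes H\to P$ that is unital, i.e. $\phi(1,g,h)=\phi(g,1,h)=\phi(g,h,1)=\varepsilon(g)\varepsilon(h)1_P$, and satisfies $$p(qr)=((p_{(0)}q_{(0)})r_{(0)})\,\phi(r_{(1)},q_{(1)},p_{(1)}),$$ $$\phi(c,g,h)_{(0)}\otimes\phi(c,g,h)_{(1)}=\phi(c_{(2)},g_{(2)},h_{(2)})\otimes S(h_{(1)}g_{(1)}c_{(1)})(h_{(3)}g_{(3)}c_{(3)}).$$ Then $B=P^{co H}=\{b\in P: b_{(0)}\otimes b_{(1)}=b\otimes 1\}$ is an associative algebra and $P$ is a $B$-bimodule. Assume that $B\subseteq P$ is coquasi-Hopf–Galois, i.e. $\chi:P\otimes_BP\to P\otimes H$, $q\otimes_B p\mapsto qp_{(0)}\otimes p_{(1)}$, is bijective,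 put $\tau(h)=\chi^{-1}(1\otimes h)$, and assume that $P$ is faithfully flat as a left $B$-module. Suppose that for all $h,g\in H$ $$\phi(Sh_{(2)},h_{(1)},g)=\phi(g,Sh_{(2)},h_{(1)})=\phi(Sg_{(2)},Sh_{(2)},h_{(1)}g_{(1)})=\phi(S(g_{(2)}),S(h_{(2)})g_{(1)},h_{(1)})=\varepsilon(hg)1_P .$$ A \emph{left $B$-coquasi-bialgebroid} is a unital, not necessarily associative algebra $\mathcal L$ with commuting algebra maps $s:B\to\mathcal L$, $t:B^{op}\to\mathcal L$ making $\mathcal L$ a (not necessarily associative) $B^e$-ring, $B^e=B\otimes B^{op}$ (that is, $s(b)$ and $t(b)$ associate with all pairs of elements of $\mathcal L$), and with a $B$-coring structure $(\Delta,\varepsilon)$ for the bimodule structure $b.X.c=s(b)t(c)X$, such that: (i) $\Delta$ corestricts to a unital algebra map into $\mathcal L\times_B\mathcal L=\{\sum X_i\otimes_BY_i:\ \sum X_it(b)\otimes_B Y_i=\sum X_i\otimes_B Y_is(b)\ \forall b\in B\}$ with factorwise product; (ii) $\varepsilon(1)=1$, $\varepsilon(s(b)X)=b\varepsilon(X)$,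 $\varepsilon(Xs(\varepsilon(Y)))=\varepsilon(XY)=\varepsilon(Xt(\varepsilon(Y)))$; (iii) there is a convolution invertible $\Phi\in{}_B\mathrm{Hom}_B(\mathcal L\otimes_{B^e}\mathcal L\otimes_{B^e}\mathcal L,B)$ (the convolution unit being $X\otimes Y\otimes Z\mapsto\varepsilon((XY)Z)=\varepsilon(X(YZ))$) with $\Phi(1,X,Y)=\Phi(X,1,Y)=\varepsilon(XY)$, $\Phi(X,Y,Zs(b))=\Phi(X,Y,Zt(b))$, and $$\Phi(X_{(1)},Y_{(1)},Z_{(1)}W_{(1)})\Phi(X_{(2)}Y_{(2)},Z_{(2)},W_{(2)})=\Phi(X_{(1)},s(\Phi(Y_{(1)},Z_{(1)},W_{(1)}))Y_{(2)}Z_{(2)},W_{(2)})\Phi(X_{(2)},Y_{(3)},Z_{(3)}),$$ $$s(\Phi(X_{(1)},Y_{(1)},Z_{(1)}))\big((X_{(2)}Y_{(2)})Z_{(2)}\big)=t(\Phi(X_{(2)},Y_{(2)},Z_{(2)}))\big(X_{(1)}(Y_{(1)}Z_{(1)})\big).$$ Then $$\mathcal L(P,H)=\{p\otimes q\in P\otimes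 P:\ p_{(0)}\otimes\tau(p_{(1)})q=p\otimes q\otimes_B1\}$$ (sums of tensors understood) is a left $B$-coquasi-bialgebroid with product $(p\otimes q)(r\otimes u)=pr\otimes uq$, unit $1\otimes 1$, source $s(b)=b\otimes1$, target $t(b)=1\otimes b$, coproduct $\Delta(p\otimes q)=p_{(0)}\otimes\tau(p_{(1)})\otimes q$ (the canonical map $\mathcal L(P,H)\otimes_B\mathcal L(P,H)\to P\otimes(P\otimes_BP)\otimes P$ being injective) and counit $\varepsilon(p\otimes q)=pq$. The 3-cocycle and its convolution inverse are $$\Phi(X,Y,Z)=(p(qr))(r'(q'p')),\qquad \Phi^{-1}(X,Y,Z)=((pq)r)((r'q')p')$$ for $X=p\otimes p'$, $Y=q\otimes q'$, $Z=r\otimes r'$ in $\mathcal L(P,H)$. -/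

import Mathlib

open scoped TensorProduct
open MulOpposite (op)

universe u v w x

noncomputable section

/-! ### Finite sums of pure tensors (Sweedler notation) -/

section Tensors

variable {k : Type*} [Field k]

/-- A way of writing `z ∈ M ⊗ N` as a finite sum `∑ fst i ⊗ snd i`. -/
structure TensorRepr {M N : Type*} [AddCommGroup M] [Module k M] [AddCommGroup N] [Module k N]
    (z : M ⊗[k] N) where
  n : ℕ
  fst : Fin n → M
  snd : Fin n → N
  sum_eq : ∑ i, fst i ⊗ₜ[k] snd i = z

/-- A way of writing `z ∈ M ⊗ (N ⊗ Q)` as a finite sum `∑ fst i ⊗ (snd i ⊗ trd i)`. -/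
structure TensorRepr₃ {M N Q : Type*} [AddCommGroup M] [Module k M] [AddCommGroup N] [Module k N]
    [AddCommGroup Q] [Module k Q] (z : M ⊗[k] (N ⊗[k] Q)) where
  n : ℕ
  fst : Fin n → M
  snd : Fin n → N
  trd : Fin n → Q
  sum_eq : ∑ i, fst i ⊗ₜ[k] (snd i ⊗ₜ[k] trd i) = z

theorem TensorRepr.nonempty {M N : Type*} [AddCommGroup M] [Module k M] [AddCommGroup N]
    [Module k N] (z : M ⊗[k] N) : Nonempty (TensorRepr z) := by
  induction z using TensorProduct.induction_on with
  | zero => exact ⟨⟨0, Fin.elim0, Fin.elim0, by simp⟩⟩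
  | tmul a b => exact ⟨⟨1, fun _ => a, fun _ => b, by simp⟩⟩
  | add a b ha hb =>
    obtain ⟨p⟩ := ha
    obtain ⟨q⟩ := hb
    exact ⟨⟨p.n + q.n, Fin.append p.fst q.fst, Fin.append p.snd q.snd, by
      simp [Fin.sum_univ_add, p.sum_eq, q.sum_eq]⟩⟩

/-! ### Balanced tensor products over a noncommutative algebra -/

variable {B : Type*} {M N : Type*} [AddCommGroup M] [Module k M] [AddCommGroup N] [Module k N]

/-- The relations `m·b ⊗ n = m ⊗ b·n` in `M ⊗ N`, where `r b` is the right action of `b` on `M` and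
`l b` is the left action of `b` on `N`. -/
def balRel (r : B → M →ₗ[k] M) (l : B → N →ₗ[k] N) : Submodule k (M ⊗[k] N) :=
  Submodule.span k {z | ∃ b m n, z = r b m ⊗ₜ[k] n - m ⊗ₜ[k] l b n}

/-- The balanced tensor product `M ⊗_B N`. -/
abbrev BalTensor (r : B → M →ₗ[k] M) (l : B → N →ₗ[k] N) : Type _ :=
  (M ⊗[k] N) ⧸ balRel r l

/-- The class of `z` in `M ⊗_B N`. -/
abbrev BalTensor.mk (r : B → M →ₗ[k] M) (l : B → N →ₗ[k] N) : (M ⊗[k] N) →ₗ[k] BalTensor r l :=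
  (balRel r l).mkQ

theorem BalTensor.mk_eq (r : B → M →ₗ[k] M) (l : B → N →ₗ[k] N) (b : B) (m : M) (n : N) :
    BalTensor.mk r l (r b m ⊗ₜ[k] n) = BalTensor.mk r l (m ⊗ₜ[k] l b n) := by
  rw [← sub_eq_zero, ← map_sub, Submodule.mkQ_apply, Submodule.Quotient.mk_eq_zero]
  exact Submodule.subset_span ⟨b, m, n, rfl⟩

/-- A linear map on `M ⊗ N` that respects the relations induces a map on `M ⊗_B N`. -/
def BalTensor.lift {V : Type*} [AddCommGroup V] [Module k V] (r : B → M →ₗ[k] M)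
    (l : B → N →ₗ[k] N) (f : (M ⊗[k] N) →ₗ[k] V)
    (hf : ∀ b m n, f (r b m ⊗ₜ[k] n) = f (m ⊗ₜ[k] l b n)) : BalTensor r l →ₗ[k] V :=
  (balRel r l).liftQ f (by
    rw [balRel, Submodule.span_le]
    rintro _ ⟨b, m, n, rfl⟩
    simp [hf])

/-- `f ⊗_B N : M ⊗_B N → M' ⊗_B N` for a map `f : M → M'` of right `B`-modules. -/
def BalTensor.rTensor {M' : Type*} [AddCommGroup M'] [Module k M'] (r : B → M →ₗ[k] M)
    (r' : B → M' →ₗ[k] M') (l : B → N →ₗ[k] N) (f : M →ₗ[k] M')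
    (hf : ∀ b m, f (r b m) = r' b (f m)) : BalTensor r l →ₗ[k] BalTensor r' l :=
  BalTensor.lift r l (BalTensor.mk r' l ∘ₗ f.rTensor N) (by
    intro b m n
    simp only [LinearMap.comp_apply, LinearMap.rTensor_tmul, hf]
    exact BalTensor.mk_eq r' l b (f m) n)

/-- The relations of `L ⊗_B L ⊗_B L` in `L ⊗ (L ⊗ L)`, where `r`, `l` are the right and the left
action of `B` on `L`. -/
def balRel₃ (r l : B → M →ₗ[k] M) : Submodule k (M ⊗[k] (M ⊗[k] M)) :=
  Submodule.span k
    ({z | ∃ b m n q, z = r b m ⊗ₜ[k] (n ⊗ₜ[k] q) - m ⊗ₜ[k] (l b n ⊗ₜ[k] q)} ∪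
      {z | ∃ b m n q, z = m ⊗ₜ[k] (r b n ⊗ₜ[k] q) - m ⊗ₜ[k] (n ⊗ₜ[k] l b q)})

end Tensors

/-- Faithful flatness of a left `B`-module `N`, the left action being the algebra map `l`: the
functor `- ⊗_B N` on right `B`-modules preserves injectivity and kills no nonzero module.  A right
`B`-module is a `k`-module `M` with an algebra map `Bᵐᵒᵖ → End M`. -/
structure IsFaithfullyFlat {k : Type u} [Field k] {B : Type v} [Ring B] [Algebra k B] {N : Type w}
    [AddCommGroup N] [Module k N] (l : B →ₐ[k] Module.End k N) : Prop where
  flat : ∀ (M M' : Type x) [AddCommGroup M] [Module k M] [AddCommGroup M'] [Module k M']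
    (r : Bᵐᵒᵖ →ₐ[k] Module.End k M) (r' : Bᵐᵒᵖ →ₐ[k] Module.End k M') (f : M →ₗ[k] M')
    (hf : ∀ (b : B) (m : M), f (r (op b) m) = r' (op b) (f m)), Function.Injective f →
    Function.Injective
      (BalTensor.rTensor (fun b => r (op b)) (fun b => r' (op b)) (fun b => l b) f hf)
  faithful : ∀ (M : Type x) [AddCommGroup M] [Module k M] (r : Bᵐᵒᵖ →ₐ[k] Module.End k M),
    Subsingleton (BalTensor (fun b => r (op b)) (fun b : B => l b)) → Subsingleton M

/-! ### Left coquasi-bialgebroids -/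

/-- The data of a left coquasi-bialgebroid over `B`, apart from the 3-cocycle: product and unit,
source and target map, coproduct and counit.  The `B`-bimodule structure of `L` is
`b.X.c = s(b) t(c) X`, so that `L ⊗_B L` has the relations `t(b) X ⊗ Y = X ⊗ s(b) Y`. -/
structure BialgebroidData (k : Type u) (B : Type v) (L : Type w) [Field k] [Ring B] [Algebra k B]
    [AddCommGroup L] [Module k L] where
  mul : L →ₗ[k] L →ₗ[k] L
  one : L
  src : B →ₗ[k] L
  tgt : B →ₗ[k] L
  comul : L →ₗ[k] BalTensor (fun b => mul (tgt b)) (fun b => mul (src b))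
  counit : L →ₗ[k] B

namespace BialgebroidData

variable {k : Type u} {B : Type v} {L : Type w} [Field k] [Ring B] [Algebra k B]
  [AddCommGroup L] [Module k L] (D : BialgebroidData k B L)

/-- The relations of `L ⊗_B L`. -/
abbrev rel : Submodule k (L ⊗[k] L) :=
  balRel (fun b => D.mul (D.tgt b)) (fun b => D.mul (D.src b))

/-- The class in `L ⊗_B L` of an element of `L ⊗ L`. -/
abbrev mk₂ : (L ⊗[k] L) →ₗ[k] BalTensor (fun b => D.mul (D.tgt b)) (fun b => D.mul (D.src b)) :=
  BalTensor.mk _ _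

/-- The class in `L ⊗_B L ⊗_B L` of an element of `L ⊗ (L ⊗ L)`. -/
abbrev mk₃ : (L ⊗[k] (L ⊗[k] L)) →ₗ[k]
    (L ⊗[k] (L ⊗[k] L)) ⧸ balRel₃ (fun b => D.mul (D.tgt b)) (fun b => D.mul (D.src b)) :=
  Submodule.mkQ _

/-- A Sweedler representative of the coproduct: finitely many `fst i, snd i ∈ L` such that
`Δ(X) = ∑ fst i ⊗_B snd i`. -/
structure Sweedler (X : L) where
  n : ℕ
  fst : Fin n → L
  snd : Fin n → L
  eq_comul : D.mk₂ (∑ i, fst i ⊗ₜ[k] snd i) = D.comul X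

/-- Elements of `_B Hom_B (L ⊗_{B^e} L ⊗_{B^e} L, B)`, as trilinear maps; the `B^e`-balancing is
expressed on the generators `s(b)` and `t(b)` of the image of `B^e`. -/
structure IsCochain₃ (Φ : L →ₗ[k] L →ₗ[k] L →ₗ[k] B) : Prop where
  left_linear : ∀ b X Y Z, Φ (D.mul (D.src b) X) Y Z = b * Φ X Y Z
  right_linear : ∀ b X Y Z, Φ (D.mul (D.tgt b) X) Y Z = Φ X Y Z * b
  balanced_src₁ : ∀ b X Y Z, Φ (D.mul X (D.src b)) Y Z = Φ X (D.mul (D.src b) Y) Z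
  balanced_tgt₁ : ∀ b X Y Z, Φ (D.mul X (D.tgt b)) Y Z = Φ X (D.mul (D.tgt b) Y) Z
  balanced_src₂ : ∀ b X Y Z, Φ X (D.mul Y (D.src b)) Z = Φ X Y (D.mul (D.src b) Z)
  balanced_tgt₂ : ∀ b X Y Z, Φ X (D.mul Y (D.tgt b)) Z = Φ X Y (D.mul (D.tgt b) Z)

/-- `Φ ⋆ Ψ` is the convolution unit:
`Φ(X₁, Y₁, Z₁) Ψ(X₂, Y₂, Z₂) = ε((X Y) Z) = ε(X (Y Z))`. -/
def ConvEqUnit (Φ Ψ : L →ₗ[k] L →ₗ[k] L →ₗ[k] B) : Prop :=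
  ∀ (X Y Z : L) (x : D.Sweedler X) (y : D.Sweedler Y) (z : D.Sweedler Z),
    ∑ i, ∑ j, ∑ l, Φ (x.fst i) (y.fst j) (z.fst l) * Ψ (x.snd i) (y.snd j) (z.snd l) =
        D.counit (D.mul (D.mul X Y) Z) ∧
      D.counit (D.mul (D.mul X Y) Z) = D.counit (D.mul X (D.mul Y Z))

/-- `L` with the data `D` is a left `B`-coquasi-bialgebroid with 3-cocycle `Φ` and convolution
inverse `Ψ` of `Φ`.  Identities in Sweedler notation are required for all representatives of the
coproducts that occur. -/
structure IsLeftCoquasiBialgebroid (Φ Ψ : L →ₗ[k] L →ₗ[k] L →ₗ[k] B) : Prop where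
  -- unital, not necessarily associative algebra
  one_mul : ∀ X, D.mul D.one X = X
  mul_one : ∀ X, D.mul X D.one = X
  -- commuting algebra maps `s : B → L` and `t : Bᵒᵖ → L`
  src_one : D.src 1 = D.one
  src_mul : ∀ b c, D.src (b * c) = D.mul (D.src b) (D.src c)
  tgt_one : D.tgt 1 = D.one
  tgt_mul : ∀ b c, D.tgt (b * c) = D.mul (D.tgt c) (D.tgt b)
  src_tgt_comm : ∀ b c, D.mul (D.src b) (D.tgt c) = D.mul (D.tgt c) (D.src b)
  -- `L` is a (not necessarily associative) `B^e`-ring: a `B^e`-bimodule with a `B^e`-bilinear and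
  -- `B^e`-balanced product
  src_assoc_left : ∀ b X Y, D.mul (D.mul (D.src b) X) Y = D.mul (D.src b) (D.mul X Y)
  src_assoc_mid : ∀ b X Y, D.mul (D.mul X (D.src b)) Y = D.mul X (D.mul (D.src b) Y)
  src_assoc_right : ∀ b X Y, D.mul (D.mul X Y) (D.src b) = D.mul X (D.mul Y (D.src b))
  tgt_assoc_left : ∀ b X Y, D.mul (D.mul (D.tgt b) X) Y = D.mul (D.tgt b) (D.mul X Y)
  tgt_assoc_mid : ∀ b X Y, D.mul (D.mul X (D.tgt b)) Y = D.mul X (D.mul (D.tgt b) Y)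
  tgt_assoc_right : ∀ b X Y, D.mul (D.mul X Y) (D.tgt b) = D.mul X (D.mul Y (D.tgt b))
  -- `B`-coring: `Δ` and `ε` are bimodule maps, coassociative and counital
  comul_bilinear : ∀ b c X (x : D.Sweedler X),
    D.comul (D.mul (D.src b) (D.mul (D.tgt c) X)) =
      D.mk₂ (∑ i, D.mul (D.src b) (x.fst i) ⊗ₜ[k] D.mul (D.tgt c) (x.snd i))
  counit_bilinear : ∀ b c X,
    D.counit (D.mul (D.src b) (D.mul (D.tgt c) X)) = b * D.counit X * c
  coassoc : ∀ X (x : D.Sweedler X) (x' : ∀ i, D.Sweedler (x.fst i))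
    (x'' : ∀ i, D.Sweedler (x.snd i)),
    D.mk₃ (∑ i, ∑ j, (x' i).fst j ⊗ₜ[k] ((x' i).snd j ⊗ₜ[k] x.snd i)) =
      D.mk₃ (∑ i, ∑ j, x.fst i ⊗ₜ[k] ((x'' i).fst j ⊗ₜ[k] (x'' i).snd j))
  counit_left : ∀ X (x : D.Sweedler X), ∑ i, D.mul (D.src (D.counit (x.fst i))) (x.snd i) = X
  counit_right : ∀ X (x : D.Sweedler X), ∑ i, D.mul (D.tgt (D.counit (x.snd i))) (x.fst i) = X
  -- `Δ` corestricts to an algebra map into the Takeuchi product `L ×_B L`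
  takeuchi : ∀ b X (x : D.Sweedler X),
    D.mk₂ (∑ i, D.mul (x.fst i) (D.tgt b) ⊗ₜ[k] x.snd i) =
      D.mk₂ (∑ i, x.fst i ⊗ₜ[k] D.mul (x.snd i) (D.src b))
  comul_one : D.comul D.one = D.mk₂ (D.one ⊗ₜ[k] D.one)
  comul_mul : ∀ X Y (x : D.Sweedler X) (y : D.Sweedler Y),
    D.comul (D.mul X Y) =
      D.mk₂ (∑ i, ∑ j, D.mul (x.fst i) (y.fst j) ⊗ₜ[k] D.mul (x.snd i) (y.snd j))
  -- `ε` is a left character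
  counit_one : D.counit D.one = 1
  counit_src_mul : ∀ b X, D.counit (D.mul (D.src b) X) = b * D.counit X
  counit_mul_src : ∀ X Y, D.counit (D.mul X (D.src (D.counit Y))) = D.counit (D.mul X Y)
  counit_mul_tgt : ∀ X Y, D.counit (D.mul X (D.tgt (D.counit Y))) = D.counit (D.mul X Y)
  -- `Φ` is a convolution invertible cochain
  cochain : D.IsCochain₃ Φ
  cochain_inv : D.IsCochain₃ Ψ
  conv_inv : D.ConvEqUnit Φ Ψ
  inv_conv : D.ConvEqUnit Ψ Φ
  -- `Φ` is a normalised 3-cocycle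
  normal₁ : ∀ X Y, Φ D.one X Y = D.counit (D.mul X Y)
  normal₂ : ∀ X Y, Φ X D.one Y = D.counit (D.mul X Y)
  src_eq_tgt : ∀ b X Y Z, Φ X Y (D.mul Z (D.src b)) = Φ X Y (D.mul Z (D.tgt b))
  -- `Φ(X₁, Y₁, Z₁W₁) Φ(X₂Y₂, Z₂, W₂) = Φ(X₁, s(Φ(Y₁, Z₁, W₁)) Y₂Z₂, W₂) Φ(X₂, Y₃, Z₃)`
  cocycle : ∀ (X Y Z W : L) (x : D.Sweedler X) (y : D.Sweedler Y) (z : D.Sweedler Z)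
    (w : D.Sweedler W) (y' : ∀ i, D.Sweedler (y.fst i)) (z' : ∀ i, D.Sweedler (z.fst i)),
    ∑ i, ∑ j, ∑ l, ∑ m,
        Φ (x.fst i) (y.fst j) (D.mul (z.fst l) (w.fst m)) *
          Φ (D.mul (x.snd i) (y.snd j)) (z.snd l) (w.snd m) =
      ∑ i, ∑ j, ∑ j', ∑ l, ∑ l', ∑ m,
        Φ (x.fst i)
            (D.mul (D.src (Φ ((y' j).fst j') ((z' l).fst l') (w.fst m)))
              (D.mul ((y' j).snd j') ((z' l).snd l')))
            (w.snd m) *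
          Φ (x.snd i) (y.snd j) (z.snd l)
  -- `s(Φ(X₁, Y₁, Z₁)) ((X₂Y₂)Z₂) = t(Φ(X₂, Y₂, Z₂)) (X₁(Y₁Z₁))`
  quasi_assoc : ∀ (X Y Z : L) (x : D.Sweedler X) (y : D.Sweedler Y) (z : D.Sweedler Z),
    ∑ i, ∑ j, ∑ l,
        D.mul (D.src (Φ (x.fst i) (y.fst j) (z.fst l)))
          (D.mul (D.mul (x.snd i) (y.snd j)) (z.snd l)) =
      ∑ i, ∑ j, ∑ l,
        D.mul (D.tgt (Φ (x.snd i) (y.snd j) (z.snd l)))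
          (D.mul (x.fst i) (D.mul (y.fst j) (z.fst l)))

end BialgebroidData

/-! ### Coquasi-comodule algebras -/

section Coquasi

open Coalgebra HopfAlgebra

/-- `φ ⋆ ψ` is the unit of the convolution product on linear maps `H ⊗ H ⊗ H → P`. -/
def ConvEqUnit₃ {k : Type u} {H : Type v} {P : Type w} [Field k] [Ring H] [HopfAlgebra k H]
    [NonAssocRing P] [Module k P] (φ ψ : H →ₗ[k] H →ₗ[k] H →ₗ[k] P) : Prop :=
  ∀ (a b c : H) (x : TensorRepr (comul (R := k) a)) (y : TensorRepr (comul (R := k) b))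
    (z : TensorRepr (comul (R := k) c)),
    ∑ i, ∑ j, ∑ l, φ (x.fst i) (y.fst j) (z.fst l) * ψ (x.snd i) (y.snd j) (z.snd l) =
      (counit (R := k) a * counit (R := k) b * counit (R := k) c) • (1 : P)

/-- A coquasi-comodule algebra `(P, φ)` of the Hopf algebra `H`: `P` is a unital, not necessarily
associative algebra with a right `H`-coaction that is an algebra map, and `φ : H ⊗ H ⊗ H → P` is
linear, unital in each argument, convolution invertible, colinear, and controls the associativity
of `P`. -/
structure CoquasiComoduleAlgebra (k : Type u) (H : Type v) (P : Type w) [Field k] [Ring H]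
    [HopfAlgebra k H] [NonAssocRing P] [Module k P] [IsScalarTower k P P] [SMulCommClass k P P]
    where
  coact : P →ₗ[k] P ⊗[k] H
  coact_coassoc : ∀ p,
    TensorProduct.assoc k P H H (coact.rTensor H (coact p)) = (comul (R := k)).lTensor P (coact p)
  coact_counit : ∀ p, TensorProduct.rid k P ((counit (R := k)).lTensor P (coact p)) = p
  coact_one : coact 1 = 1 ⊗ₜ[k] 1
  coact_mul : ∀ p q, coact (p * q) = coact p * coact q
  φ : H →ₗ[k] H →ₗ[k] H →ₗ[k] P
  φ_one₁ : ∀ g h, φ 1 g h = (counit (R := k) g * counit (R := k) h) • (1 : P)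
  φ_one₂ : ∀ g h, φ g 1 h = (counit (R := k) g * counit (R := k) h) • (1 : P)
  φ_one₃ : ∀ g h, φ g h 1 = (counit (R := k) g * counit (R := k) h) • (1 : P)
  φ_invertible : ∃ ψ : H →ₗ[k] H →ₗ[k] H →ₗ[k] P, ConvEqUnit₃ φ ψ ∧ ConvEqUnit₃ ψ φ
  -- `p(qr) = ((p₀q₀)r₀) φ(r₁, q₁, p₁)`
  assoc : ∀ (p q r : P) (x : TensorRepr (coact p)) (y : TensorRepr (coact q))
    (z : TensorRepr (coact r)),
    p * (q * r) = ∑ i, ∑ j, ∑ l,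
      ((x.fst i * y.fst j) * z.fst l) * φ (z.snd l) (y.snd j) (x.snd i)
  -- `φ(c, g, h)₀ ⊗ φ(c, g, h)₁ = φ(c₂, g₂, h₂) ⊗ S(h₁g₁c₁)(h₃g₃c₃)`
  φ_coact : ∀ (c g h : H)
    (x : TensorRepr₃ ((comul (R := k)).lTensor H (comul (R := k) c)))
    (y : TensorRepr₃ ((comul (R := k)).lTensor H (comul (R := k) g)))
    (z : TensorRepr₃ ((comul (R := k)).lTensor H (comul (R := k) h))),
    coact (φ c g h) = ∑ i, ∑ j, ∑ l, φ (x.snd i) (y.snd j) (z.snd l) ⊗ₜ[k]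
      (antipode k (z.fst l * y.fst j * x.fst i) * (z.trd l * y.trd j * x.trd i))

namespace CoquasiComoduleAlgebra

variable {k : Type u} {H : Type v} {P : Type w} [Field k] [Ring H] [HopfAlgebra k H]
  [NonAssocRing P] [Module k P] [IsScalarTower k P P] [SMulCommClass k P P]
  (A : CoquasiComoduleAlgebra k H P)

/-- The coinvariants `B = P^{co H}`. -/
def coinvariants : Submodule k P where
  carrier := {b | A.coact b = b ⊗ₜ[k] 1}
  add_mem' {a b} ha hb := by
    change A.coact _ = _ at ha hb
    change A.coact _ = _
    rw [map_add, ha, hb, TensorProduct.add_tmul]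
  zero_mem' := by simp
  smul_mem' c b hb := by
    change A.coact _ = _ at hb
    change A.coact _ = _
    rw [map_smul, hb, TensorProduct.smul_tmul']

theorem coact_coinv (b : A.coinvariants) : A.coact b = (b : P) ⊗ₜ[k] 1 := b.2

theorem sum_counit {p : P} (x : TensorRepr (A.coact p)) :
    ∑ i, counit (R := k) (x.snd i) • x.fst i = p := by
  have h := A.coact_counit p
  rw [← x.sum_eq] at h
  simpa [map_sum] using h

theorem mul_assoc_right (p q : P) (b : A.coinvariants) : (p * q) * (b : P) = p * (q * b) := by
  obtain ⟨x⟩ := TensorRepr.nonempty (A.coact p)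
  obtain ⟨y⟩ := TensorRepr.nonempty (A.coact q)
  rw [A.assoc p q b x y ⟨1, fun _ => b, fun _ => 1, by simp [A.coact_coinv b]⟩]
  conv_lhs => rw [← A.sum_counit x, ← A.sum_counit y]
  simp only [A.φ_one₁, Finset.sum_mul, Finset.mul_sum, mul_smul_comm, smul_mul_assoc,
    Finset.smul_sum, smul_smul, mul_one, Fin.sum_univ_one]
  rw [Finset.sum_comm]

theorem mul_assoc_mid (p q : P) (b : A.coinvariants) : (p * (b : P)) * q = p * (b * q) := by
  obtain ⟨x⟩ := TensorRepr.nonempty (A.coact p)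
  obtain ⟨y⟩ := TensorRepr.nonempty (A.coact q)
  rw [A.assoc p b q x ⟨1, fun _ => b, fun _ => 1, by simp [A.coact_coinv b]⟩ y]
  conv_lhs => rw [← A.sum_counit x, ← A.sum_counit y]
  simp only [A.φ_one₂, Finset.sum_mul, Finset.mul_sum, mul_smul_comm, smul_mul_assoc,
    Finset.smul_sum, smul_smul, mul_one, Fin.sum_univ_one]
  rw [Finset.sum_comm]

theorem mul_assoc_left (p q : P) (b : A.coinvariants) : ((b : P) * p) * q = b * (p * q) := by
  obtain ⟨x⟩ := TensorRepr.nonempty (A.coact p)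
  obtain ⟨y⟩ := TensorRepr.nonempty (A.coact q)
  rw [A.assoc b p q ⟨1, fun _ => b, fun _ => 1, by simp [A.coact_coinv b]⟩ x y]
  conv_lhs => rw [← A.sum_counit x, ← A.sum_counit y]
  simp only [A.φ_one₃, Finset.sum_mul, Finset.mul_sum, mul_smul_comm, smul_mul_assoc,
    Finset.smul_sum, smul_smul, mul_one, Fin.sum_univ_one]
  rw [Finset.sum_comm]

theorem one_mem : (1 : P) ∈ A.coinvariants := A.coact_one

theorem mul_mem (a b : A.coinvariants) : (a : P) * b ∈ A.coinvariants := by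
  change A.coact _ = _
  rw [A.coact_mul, A.coact_coinv, A.coact_coinv, Algebra.TensorProduct.tmul_mul_tmul, one_mul]

/-- The coinvariants form an associative unital ring under the product of `P`. -/
instance : Ring A.coinvariants where
  __ := (inferInstance : AddCommGroup A.coinvariants)
  mul a b := ⟨(a : P) * b, A.mul_mem a b⟩
  one := ⟨1, A.one_mem⟩
  mul_assoc a b c := Subtype.ext (A.mul_assoc_right a b c)
  one_mul a := Subtype.ext (one_mul (a : P))
  mul_one a := Subtype.ext (mul_one (a : P))
  left_distrib a b c := Subtype.ext (mul_add (a : P) b c)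
  right_distrib a b c := Subtype.ext (add_mul (a : P) b c)
  zero_mul a := Subtype.ext (zero_mul (a : P))
  mul_zero a := Subtype.ext (mul_zero (a : P))

instance : Algebra k A.coinvariants :=
  Algebra.ofModule (fun c a b => Subtype.ext (smul_mul_assoc c (a : P) b))
    (fun c a b => Subtype.ext (mul_smul_comm c (a : P) b))

/-- The left `B`-module structure of `P`. -/
def leftMul : A.coinvariants →ₐ[k] Module.End k P :=
  AlgHom.ofLinearMap (LinearMap.mul k P ∘ₗ A.coinvariants.subtype)
    (LinearMap.ext fun p => one_mul p) (fun a b => LinearMap.ext fun p => A.mul_assoc_left b p a)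

/-- The right action of `B` on `P`. -/
abbrev actR (b : A.coinvariants) : P →ₗ[k] P := (LinearMap.mul k P).flip (b : P)

/-- The left action of `B` on `P`. -/
abbrev actL (b : A.coinvariants) : P →ₗ[k] P := A.leftMul b

/-- `P ⊗_B P`. -/
abbrev PP : Type _ := BalTensor A.actR A.actL

/-- The canonical map `χ : P ⊗_B P → P ⊗ H`, `q ⊗ p ↦ q p₀ ⊗ p₁`. -/
def can : A.PP →ₗ[k] P ⊗[k] H :=
  BalTensor.lift A.actR A.actL
    ((LinearMap.mul' k P).rTensor H ∘ₗ (TensorProduct.assoc k P P H).symm.toLinearMap ∘ₗ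
      A.coact.lTensor P) (by
    intro b q p
    have h : A.coact (A.actL b p) = (A.actL b).rTensor H (A.coact p) := by
      change A.coact ((b : P) * p) = _
      rw [A.coact_mul, A.coact_coinv]
      induction A.coact p using TensorProduct.induction_on with
      | zero => simp
      | tmul a c =>
        rw [Algebra.TensorProduct.tmul_mul_tmul, one_mul]
        rfl
      | add a c ha hc => rw [mul_add, map_add, ha, hc]
    simp only [LinearMap.comp_apply, LinearMap.lTensor_tmul, h]
    induction A.coact p using TensorProduct.induction_on with
    | zero => simp
    | tmul a c =>
      change ((q * (b : P)) * a) ⊗ₜ[k] c = (q * ((b : P) * a)) ⊗ₜ[k] c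
      rw [A.mul_assoc_mid]
    | add a c ha hc => simp only [TensorProduct.tmul_add, map_add, ha, hc])

/-- `B ⊆ P` is coquasi-Hopf–Galois: the canonical map is bijective. -/
def IsHopfGalois : Prop := Function.Bijective A.can

variable {A} in
/-- The translation map `τ : H → P ⊗_B P`, `τ(h) = χ⁻¹(1 ⊗ h)`. -/
def IsHopfGalois.τ (hG : A.IsHopfGalois) : H →ₗ[k] A.PP :=
  (LinearEquiv.ofBijective A.can hG).symm.toLinearMap ∘ₗ TensorProduct.mk k P H 1

/-- Right multiplication `(q ⊗_B p) r = q ⊗_B p r` on the second factor of `P ⊗_B P`. -/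
def mulRightPP : A.PP →ₗ[k] P →ₗ[k] A.PP :=
  BalTensor.lift A.actR A.actL
    (TensorProduct.lift (LinearMap.mk₂ k
      (fun q p => BalTensor.mk A.actR A.actL ∘ₗ TensorProduct.mk k P P q ∘ₗ LinearMap.mul k P p)
      (fun _ _ _ => by ext; simp)
      (fun _ _ _ => by
        ext
        simp only [LinearMap.comp_apply, LinearMap.smul_apply, map_smul])
      (fun _ _ _ => by ext; simp [TensorProduct.tmul_add])
      (fun _ _ _ => by ext; simp)))
    (fun b q p => by
      ext r
      have h : (A.actL b p) * r = A.actL b (p * r) := A.mul_assoc_left p r b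
      simp only [TensorProduct.lift.tmul, LinearMap.mk₂_apply, LinearMap.comp_apply,
        TensorProduct.mk_apply, LinearMap.mul_apply', h]
      exact BalTensor.mk_eq A.actR A.actL b q (p * r))

variable {A}

/-- `P ⊗ P → P ⊗ (P ⊗_B P)`, `p ⊗ q ↦ p₀ ⊗ τ(p₁) q`. -/
def IsHopfGalois.esMap (hG : A.IsHopfGalois) : P ⊗[k] P →ₗ[k] P ⊗[k] A.PP :=
  (TensorProduct.lift (A.mulRightPP ∘ₗ hG.τ)).lTensor P ∘ₗ
    (TensorProduct.assoc k P H P).toLinearMap ∘ₗ A.coact.rTensor P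

/-- `P ⊗ P → P ⊗ (P ⊗_B P)`, `p ⊗ q ↦ p ⊗ (q ⊗_B 1)`. -/
def IsHopfGalois.esTriv (_hG : A.IsHopfGalois) : P ⊗[k] P →ₗ[k] P ⊗[k] A.PP :=
  (BalTensor.mk A.actR A.actL ∘ₗ (TensorProduct.mk k P P).flip 1).lTensor P

/-- The Ehresmann–Schauenburg space
`L(P, H) = {p ⊗ q ∈ P ⊗ P | p₀ ⊗ τ(p₁) q = p ⊗ q ⊗_B 1}`. -/
def IsHopfGalois.ES (hG : A.IsHopfGalois) : Submodule k (P ⊗[k] P) :=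
  LinearMap.eqLocus hG.esMap hG.esTriv

/-- The canonical map `L(P, H) ⊗ L(P, H) → P ⊗ (P ⊗_B P) ⊗ P`,
`(p ⊗ q) ⊗ (r ⊗ u) ↦ p ⊗ (q ⊗_B r) ⊗ u`. -/
def IsHopfGalois.esIncl (hG : A.IsHopfGalois) :
    hG.ES ⊗[k] hG.ES →ₗ[k] P ⊗[k] (A.PP ⊗[k] P) :=
  ((BalTensor.mk A.actR A.actL).rTensor P).lTensor P ∘ₗ
    ((TensorProduct.assoc k P P P).symm.toLinearMap).lTensor P ∘ₗ
    (TensorProduct.assoc k P P (P ⊗[k] P)).toLinearMap ∘ₗ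
    TensorProduct.map hG.ES.subtype hG.ES.subtype

/-- `P ⊗ P → P ⊗ (P ⊗_B P) ⊗ P`, `p ⊗ q ↦ p₀ ⊗ τ(p₁) ⊗ q`. -/
def IsHopfGalois.esComul (hG : A.IsHopfGalois) : P ⊗[k] P →ₗ[k] P ⊗[k] (A.PP ⊗[k] P) :=
  (hG.τ.rTensor P).lTensor P ∘ₗ (TensorProduct.assoc k P H P).toLinearMap ∘ₗ A.coact.rTensor P

end CoquasiComoduleAlgebra

end Coquasi

end

noncomputable section

/-! Let `C` be the space of coinvariants of `P ⊗ P` under the diagonal coaction `p ⊗ q ↦ p₀ ⊗ q₀ ⊗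
p₁q₁` (`diagCoinv`). The coquasi-bialgebroid is built on `C`, and `C` turns out to be `L(P, H)`
(`ES_eq`).

Two facts stand in for associativity of `P`. Elements of `B` associate with everything. Further, for
`p ⊗ p'` in `C` coinvariance gives `p₀ ⊗ p₁ ⊗ p'₀ ⊗ p'₁ = p₀ ⊗ p₁ ⊗ p' ⊗ S(p₂)`, so re-bracketing `a
(p p')` and `p (p' a)` only involves `φ(S h₂, h₁, g)` and `φ(g, S h₂, h₁)`, which are trivial by
hypothesis. Hence `a (p p') = (a p) p'` and `(p p') a = p (p' a)` (`mul_mul'_coinv`,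
`mul'_coinv_mul`). Together with the Galois property and faithful flatness this is all that is
needed afterwards (`IsAdmissible`).

The linear algebra is faithfully flat descent: `p ⊗ q ⊗ s ↦ p ⊗ q s` induces a bijection from `C ⊗_B
P` to `P ⊗ P` (`exists_section`, `mk_eq_of_mulLast_eq`). It is used three times. It embeds `M ⊗_B C`
into `(M ⊗_B P) ⊗ P` (`kappa_injective`), so that `C ⊗_B C` and `C ⊗_B C ⊗_B C` sit inside tensor
products of copies of `P` and `P ⊗_B P`, where equations are checked (`ker_inclC`, `mk₃_eq_zero`).
It shows that `p₀ ⊗ τ(p₁) ⊗ q` comes from `C ⊗ C` when `p ⊗ q` is in `C` (`exists_comul`). And a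
factorisation of `p ⊗ 1` over `C` represents `p₀ ⊗ τ(p₁)` (`mkPP_section`), which leads to the
cancellation rules `(c x) y = ε(h) c = x (y c)` for `τ(h) = x ⊗_B y`. From these follow `C = L(P,
H)`, `b τ(h) = τ(h) b`, and the multiplicativity of `τ` (`sandwich_τ`).

The bialgebroid identities are then uniform. A product of coproducts of elements of `C` has in its
middle the value of `τ` at a product in `H`, whatever the outer legs are combined into
(`Lifts.mul`); cancelling that middle pair leaves an explicit expression in the outer legs
(`Collapses.left`, `Collapses.right`). So both sides of quasi-associativity become `p (q r) ⊗ r' (q'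
p')`, both sides of the cocycle identity become `(p (q (r s))) (s' (r' (q' p')))`, and the
convolutions of `Φ` with its inverse become the counit of `X (Y Z)` and of `(X Y) Z`. -/

theorem TensorProduct.induction_add {k M N : Type*} [Field k] [AddCommGroup M] [Module k M]
    [AddCommGroup N] [Module k N] {motive : M ⊗[k] N → Prop} (z : M ⊗[k] N)
    (tmul : ∀ m n, motive (m ⊗ₜ[k] n)) (add : ∀ x y, motive x → motive y → motive (x + y)) :
    motive z :=
  -- The zero case is the pure tensor `0 ⊗ₜ 0`.
  TensorProduct.induction_on z (by simpa using tmul 0 0) tmul add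

/-! ### Balanced tensor products: functoriality and exactness -/

namespace BalTensor

variable {k : Type*} [Field k] {B : Type*} {M M' M'' N V : Type*}
  [AddCommGroup M] [Module k M] [AddCommGroup M'] [Module k M'] [AddCommGroup M''] [Module k M'']
  [AddCommGroup N] [Module k N] [AddCommGroup V] [Module k V]
  (r : B → M →ₗ[k] M) (r' : B → M' →ₗ[k] M') (r'' : B → M'' →ₗ[k] M'') (l : B → N →ₗ[k] N)

theorem mk_surjective : Function.Surjective (mk r l) := Submodule.mkQ_surjective _

theorem mk_eq_zero {z : M ⊗[k] N} : mk r l z = 0 ↔ z ∈ balRel r l :=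
  Submodule.Quotient.mk_eq_zero _

@[simp]
theorem rTensor_mk (f : M →ₗ[k] M') (hf) (z : M ⊗[k] N) :
    rTensor r r' l f hf (mk r l z) = mk r' l (f.rTensor N z) := rfl

theorem hom_ext {r : B → M →ₗ[k] M} {l : B → N →ₗ[k] N} {f g : BalTensor r l →ₗ[k] V}
    (h : ∀ m n, f (mk r l (m ⊗ₜ n)) = g (mk r l (m ⊗ₜ n))) : f = g := by
  apply Submodule.linearMap_qext
  exact TensorProduct.ext' h

theorem induction_on {r : B → M →ₗ[k] M} {l : B → N →ₗ[k] N} {p : BalTensor r l → Prop}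
    (z : BalTensor r l) (tmul : ∀ m n, p (mk r l (m ⊗ₜ n)))
    (add : ∀ a b, p a → p b → p (a + b)) : p z := by
  obtain ⟨z, rfl⟩ := mk_surjective r l z
  induction z using TensorProduct.induction_on with
  | zero => simpa using tmul 0 0
  | tmul m n => exact tmul m n
  | add a b ha hb => rw [map_add]; exact add _ _ ha hb

/-- `M ⊗_B g` for a map `g` of left `B`-modules. -/
def lTensor {N' : Type*} [AddCommGroup N'] [Module k N'] (l' : B → N' →ₗ[k] N') (g : N →ₗ[k] N')
    (hg : ∀ b n, g (l b n) = l' b (g n)) : BalTensor r l →ₗ[k] BalTensor r l' :=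
  lift r l (mk r l' ∘ₗ g.lTensor M) (fun b m n => by
    simp only [LinearMap.comp_apply, LinearMap.lTensor_tmul, hg]
    exact mk_eq r l' b m (g n))

theorem rTensor_comp_apply (f : M →ₗ[k] M') (hf) (g : M' →ₗ[k] M'') (hg) (h : M →ₗ[k] M'') (hh)
    (e : ∀ m, g (f m) = h m) (z : BalTensor r l) :
    rTensor r' r'' l g hg (rTensor r r' l f hf z) = rTensor r r'' l h hh z := by
  obtain ⟨z, rfl⟩ := mk_surjective r l z
  have : g ∘ₗ f = h := LinearMap.ext e
  rw [rTensor_mk, rTensor_mk, rTensor_mk, ← this, LinearMap.rTensor_comp_apply]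

theorem rTensor_id_apply (f : M →ₗ[k] M) (hf) (e : ∀ m, f m = m) (z : BalTensor r l) :
    rTensor r r l f hf z = z := by
  obtain ⟨z, rfl⟩ := mk_surjective r l z
  obtain rfl : f = LinearMap.id := LinearMap.ext e
  rw [rTensor_mk, LinearMap.rTensor_id, LinearMap.id_apply]

theorem rTensor_leftInverse (f : M →ₗ[k] M') (hf) (g : M' →ₗ[k] M) (hg) (e : ∀ m, g (f m) = m) :
    Function.LeftInverse (rTensor r' r l g hg) (rTensor r r' l f hf) := fun z =>
  (rTensor_comp_apply r r' r l f hf g hg LinearMap.id (fun _ _ => rfl) e z).trans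
    (rTensor_id_apply r l _ _ (fun _ => rfl) z)

/-- If `f` is onto, an element of `M ⊗_B N` that vanishes in `M' ⊗_B N` comes from
`ker f ⊗ N`. -/
theorem exists_of_rTensor_eq_zero_of_surjective (f : M →ₗ[k] M') (hf)
    (hs : Function.Surjective f) (z : M ⊗[k] N) (hz : rTensor r r' l f hf (mk r l z) = 0) :
    ∃ t : LinearMap.ker f ⊗[k] N, mk r l ((LinearMap.ker f).subtype.rTensor N t) = mk r l z := by
  rw [rTensor_mk, mk_eq_zero] at hz
  -- As `f` is onto, every relation over `M'` lifts to one over `M`. Subtracting such a lift from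
  -- `z` leaves an element that dies already in `M' ⊗ N`, where right exactness over `k` applies.
  have hle : balRel r' l ≤ (balRel r l).map (f.rTensor N) := by
    unfold balRel
    rw [Submodule.map_span, Submodule.span_le]
    rintro _ ⟨b, m', n, rfl⟩
    obtain ⟨m, rfl⟩ := hs m'
    refine Submodule.subset_span ⟨_, ⟨b, m, n, rfl⟩, ?_⟩
    simp [hf]
  obtain ⟨y, hy, hyz⟩ := hle hz
  have hex := rTensor_exact N (f := (LinearMap.ker f).subtype) (g := f)
    (by rw [LinearMap.exact_iff]; simp) hs
  obtain ⟨t, ht⟩ := (hex (z - y)).1 (by rw [map_sub, hyz, sub_self])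
  refine ⟨t, ?_⟩
  rw [ht, map_sub, (mk_eq_zero r l).2 hy, sub_zero]

end BalTensor

/-! ### Representations on invariant subspaces and on quotients -/

section Restrict

variable {k : Type*} [Field k] {R M : Type*} [Ring R] [Algebra k R] [AddCommGroup M] [Module k M]

/-- The restriction of a representation to an invariant subspace. -/
def restrictEnd (r : R →ₐ[k] Module.End k M) (K : Submodule k M) (hK : ∀ a, ∀ m ∈ K, r a m ∈ K) :
    R →ₐ[k] Module.End k K :=
  AlgHom.ofLinearMap
    { toFun := fun a => (r a).restrict (hK a)
      map_add' := fun a b => by ext; simp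
      map_smul' := fun c a => by ext; simp }
    (by ext; simp) (fun a b => by ext; simp)

/-- The representation on the quotient by an invariant subspace. -/
def quotientEnd (r : R →ₐ[k] Module.End k M) (K : Submodule k M) (hK : ∀ a, ∀ m ∈ K, r a m ∈ K) :
    R →ₐ[k] Module.End k (M ⧸ K) :=
  AlgHom.ofLinearMap
    { toFun := fun a => K.mapQ K (r a) (hK a)
      map_add' := fun a b => by apply Submodule.linearMap_qext; ext; simp
      map_smul' := fun c a => by apply Submodule.linearMap_qext; ext; simp }
    (by apply Submodule.linearMap_qext; ext; simp)
    (fun a b => by apply Submodule.linearMap_qext; ext; simp)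

@[simp]
theorem quotientEnd_mkQ (r : R →ₐ[k] Module.End k M) (K : Submodule k M) (hK) (a : R) (m : M) :
    quotientEnd r K hK a (K.mkQ m) = K.mkQ (r a m) := rfl

end Restrict

/-! ### Consequences of faithful flatness -/

namespace IsFaithfullyFlat

open BalTensor

/-- Faithful flatness with respect to modules in a universe implies the same in smaller ones. -/
theorem lower {k : Type*} [Field k] {B : Type*} [Ring B] [Algebra k B] {N : Type*}
    [AddCommGroup N] [Module k N] {l : B →ₐ[k] Module.End k N}
    (h : IsFaithfullyFlat.{_, _, _, max v w} l) : IsFaithfullyFlat.{_, _, _, w} l := by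
  -- Small modules are tested through their `ULift` with the transported action; `M ⊗_B N` changes
  -- only by an isomorphism.
  let U : ∀ (M : Type w) [AddCommGroup M] [Module k M] (r : Bᵐᵒᵖ →ₐ[k] Module.End k M),
      Bᵐᵒᵖ →ₐ[k] Module.End k (ULift.{v} M) := fun M _ _ r =>
    ((ULift.moduleEquiv (R := k) (M := M)).symm.conjAlgEquiv k).toAlgHom.comp r
  constructor
  · intro M M' _ _ _ _ r r' f hf hinj
    have h1 := h.flat (ULift.{v} M) (ULift.{v} M') (U M r) (U M' r')
      (ULift.moduleEquiv.symm.toLinearMap ∘ₗ f ∘ₗ ULift.moduleEquiv.toLinearMap)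
      (fun b m => ULift.ext _ _ (hf b m.down))
      (fun a b hab => ULift.ext _ _ (hinj (congrArg ULift.down hab)))
    refine Function.Injective.of_comp (f := rTensor (fun b => r' (op b))
      (fun b => U M' r' (op b)) (fun b => l b) ULift.moduleEquiv.symm.toLinearMap
      (fun b m => rfl)) ?_
    have h2 : Function.Injective (rTensor (fun b => r (op b))
        (fun b => U M r (op b)) (fun b => l b) ULift.moduleEquiv.symm.toLinearMap
        (fun b m => rfl)) := by
      refine Function.LeftInverse.injective (g := rTensor (fun b => U M r (op b))
        (fun b => r (op b)) (fun b => l b) ULift.moduleEquiv.toLinearMap (fun b m => rfl)) ?_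
      exact rTensor_leftInverse _ _ _ _ _ _ _ (fun _ => rfl)
    have h3 := h1.comp h2
    convert h3 using 1
    funext z
    exact LinearMap.congr_fun (f := rTensor (fun b => r' (op b)) (fun b => U M' r' (op b))
      (fun b => l b) ULift.moduleEquiv.symm.toLinearMap (fun b m => rfl) ∘ₗ
        rTensor (fun b => r (op b)) (fun b => r' (op b)) (fun b => l b) f hf)
      (g := rTensor (fun b => U M r (op b)) (fun b => U M' r' (op b)) (fun b => l b)
        (ULift.moduleEquiv.symm.toLinearMap ∘ₗ f ∘ₗ ULift.moduleEquiv.toLinearMap)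
        (fun b m => ULift.ext _ _ (hf b m.down)) ∘ₗ
        rTensor (fun b => r (op b)) (fun b => U M r (op b)) (fun b => l b)
        ULift.moduleEquiv.symm.toLinearMap (fun b m => rfl)) (hom_ext fun m n => rfl) z
  · intro M _ _ r hs
    have : Function.Surjective (rTensor (fun b => r (op b))
        (fun b => U M r (op b)) (fun b => l b) ULift.moduleEquiv.symm.toLinearMap
        (fun b m => rfl)) := by
      refine Function.RightInverse.surjective (g := rTensor (fun b => U M r (op b))
        (fun b => r (op b)) (fun b => l b) ULift.moduleEquiv.toLinearMap (fun b m => rfl)) ?_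
      exact rTensor_leftInverse _ _ _ _ _ _ _ (fun _ => rfl)
    have h1 := h.faithful (ULift.{v} M) (U M r) this.subsingleton
    exact (ULift.moduleEquiv (R := k) (M := M)).symm.toEquiv.subsingleton

variable {k : Type*} [Field k] {B : Type*} [Ring B] [Algebra k B] {N : Type*}
  [AddCommGroup N] [Module k N] {l : B →ₐ[k] Module.End k N}

/-- If `N` is faithfully flat and every element of `N` is the image of `e` under some
`B`-linear map, then `m ↦ m ⊗_B e` is injective. -/
theorem eq_zero_of_mk_tmul (h : IsFaithfullyFlat.{_, _, _, x} l) (e : N)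
    (he : ∀ n, ∃ g : N →ₗ[k] N, (∀ b n', g (l b n') = l b (g n')) ∧ g e = n)
    {M : Type x} [AddCommGroup M] [Module k M] (r : Bᵐᵒᵖ →ₐ[k] Module.End k M) (m : M)
    (hm : BalTensor.mk (fun b => r (op b)) (fun b => l b) (m ⊗ₜ e) = 0) : m = 0 := by
  -- A `B`-linear map sending `e` to `n` carries `m' ⊗ e = 0` to `m' ⊗ n = 0`.
  have key : ∀ m', BalTensor.mk (fun b => r (op b)) (fun b => l b) (m' ⊗ₜ[k] e) = 0 → ∀ n,
      BalTensor.mk (fun b => r (op b)) (fun b => l b) (m' ⊗ₜ n) = 0 := by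
    intro m' hm' n
    obtain ⟨g, hg, rfl⟩ := he n
    exact (congrArg (BalTensor.lTensor (fun b => r (op b)) _ (fun b => l b) g hg) hm').trans
      (map_zero _)
  let K : Submodule k M :=
    LinearMap.ker (BalTensor.mk (fun b => r (op b)) (fun b => l b) ∘ₗ (TensorProduct.mk k M N).flip e)
  have hK : ∀ a, ∀ m ∈ K, r a m ∈ K := by
    intro a m' hm'
    change BalTensor.mk _ _ (m' ⊗ₜ e) = 0 at hm'
    change BalTensor.mk _ _ (r a m' ⊗ₜ e) = 0
    exact (mk_eq (fun b => r (op b)) (fun b => l b) a.unop m' e).trans (key m' hm' _)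
  have hflat := h.flat K M (restrictEnd r K hK) r K.subtype (fun b m => rfl)
    K.injective_subtype
  -- `K ⊗_B N → M ⊗_B N` is injective by flatness and zero by `key`; hence `K ⊗_B N = 0`, and
  -- faithfulness gives `K = 0`.
  have hsub : Subsingleton (BalTensor (fun b => restrictEnd r K hK (op b)) (fun b : B => l b)) := by
    refine ⟨fun a b => hflat ?_⟩
    have : rTensor (fun b => restrictEnd r K hK (op b)) (fun b => r (op b)) (fun b : B => l b)
        K.subtype (fun b m => rfl) = 0 :=
      hom_ext fun m n => key m m.2 n
    rw [this]; rfl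
  have := h.faithful K (restrictEnd r K hK) hsub
  exact congrArg Subtype.val (Subsingleton.elim (⟨m, hm⟩ : K) 0)

/-- If `N` is flat, an element of `M ⊗_B N` that vanishes in `M' ⊗_B N` comes from
`ker f ⊗ N`. -/
theorem exists_of_rTensor_eq_zero (h : IsFaithfullyFlat.{_, _, _, x} l) {M : Type*}
    [AddCommGroup M] [Module k M] {M' : Type x} [AddCommGroup M'] [Module k M']
    (r : Bᵐᵒᵖ →ₐ[k] Module.End k M) (r' : Bᵐᵒᵖ →ₐ[k] Module.End k M') (f : M →ₗ[k] M')
    (hf : ∀ (b : B) (m : M), f (r (op b) m) = r' (op b) (f m)) (z : M ⊗[k] N)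
    (hz : rTensor (fun b => r (op b)) (fun b => r' (op b)) (fun b => l b) f hf (BalTensor.mk _ _ z) = 0) :
    ∃ t : LinearMap.ker f ⊗[k] N, BalTensor.mk (fun b => r (op b)) (fun b => l b)
      ((LinearMap.ker f).subtype.rTensor N t) = BalTensor.mk _ _ z := by
  -- Factor `f` through its range: flatness makes `range f ⊗_B N → M' ⊗_B N` injective, which leaves
  -- the surjective case.
  have hK : ∀ a, ∀ m ∈ LinearMap.range f, r' a m ∈ LinearMap.range f := by
    rintro a _ ⟨m, rfl⟩
    exact ⟨r a m, hf a.unop m⟩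
  have hflat := h.flat (LinearMap.range f) M' (restrictEnd r' _ hK) r' (LinearMap.range f).subtype
    (fun b m => rfl) (Submodule.injective_subtype _)
  have hf' : ∀ (b : B) (m : M), f.rangeRestrict (r (op b) m) =
      restrictEnd r' _ hK (op b) (f.rangeRestrict m) := fun b m => Subtype.ext (hf b m)
  have hz' : rTensor (fun b => r (op b)) (fun b => restrictEnd r' _ hK (op b)) (fun b => l b)
      f.rangeRestrict hf' (BalTensor.mk _ _ z) = 0 := by
    apply hflat
    exact (rTensor_comp_apply _ _ _ _ _ _ _ _ f hf (fun _ => rfl) _).trans (hz.trans (map_zero _).symm)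
  have hker : LinearMap.ker f.rangeRestrict = LinearMap.ker f := LinearMap.ker_rangeRestrict f
  have := exists_of_rTensor_eq_zero_of_surjective _ _ _ f.rangeRestrict hf'
    f.surjective_rangeRestrict z hz'
  rwa [hker] at this

end IsFaithfullyFlat

end

noncomputable section

namespace CoquasiComoduleAlgebra

open CoalgebraStruct (comul counit)
open HopfAlgebra (antipode)
open TensorProduct

variable {k : Type u} {H : Type v} {P : Type w} [Field k] [Ring H] [HopfAlgebra k H]
  [NonAssocRing P] [Module k P] [IsScalarTower k P P] [SMulCommClass k P P]
  (A : CoquasiComoduleAlgebra k H P)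

/-! ### Module structures -/

/-- The right `B`-module structure of `P`. -/
def rightMul : A.coinvariantsᵐᵒᵖ →ₐ[k] Module.End k P :=
  AlgHom.ofLinearMap
    ((LinearMap.mul k P).flip ∘ₗ A.coinvariants.subtype ∘ₗ
      (MulOpposite.opLinearEquiv k).symm.toLinearMap)
    (LinearMap.ext fun p => mul_one p)
    (fun a b => LinearMap.ext fun p => (A.mul_assoc_right p b.unop a.unop).symm)

@[simp]
theorem leftMul_apply (b : A.coinvariants) (p : P) : A.leftMul b p = b * p := rfl

/-- The right `B`-module `V ⊗ P`. -/
def rightTensor (V : Type*) [AddCommGroup V] [Module k V] :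
    A.coinvariantsᵐᵒᵖ →ₐ[k] Module.End k (V ⊗[k] P) :=
  (Module.End.lTensorAlgHom k P V).comp A.rightMul

@[simp]
theorem rightTensor_tmul (V : Type*) [AddCommGroup V] [Module k V] (b : A.coinvariants) (v : V)
    (p : P) : A.rightTensor V (op b) (v ⊗ₜ p) = v ⊗ₜ (p * b) := rfl

theorem rightTensor_apply (V : Type*) [AddCommGroup V] [Module k V] (b : A.coinvariants)
    (z : V ⊗[k] P) : A.rightTensor V (op b) z = (A.actR b).lTensor V z := rfl

/-- The class `p ⊗_B q`. -/
abbrev mkPP : P ⊗[k] P →ₗ[k] A.PP := BalTensor.mk A.actR A.actL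

theorem mkPP_mul (p q : P) (b : A.coinvariants) :
    A.mkPP ((p * b) ⊗ₜ q) = A.mkPP (p ⊗ₜ (b * q)) :=
  BalTensor.mk_eq A.actR A.actL b p q

variable (V : Type*) [AddCommGroup V] [Module k V]

/-- `(V ⊗ P) ⊗_B P`. -/
abbrev VPP : Type _ := BalTensor (fun b => A.rightTensor V (op b)) (fun b => A.leftMul b)

/-- The identification `(V ⊗ P) ⊗_B P → V ⊗ (P ⊗_B P)`. -/
def assocPP : A.VPP V →ₗ[k] V ⊗[k] A.PP :=
  BalTensor.lift _ _ (A.mkPP.lTensor V ∘ₗ (TensorProduct.assoc k V P P).toLinearMap) (by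
    intro b z q
    induction z using TensorProduct.induction_add with
    | tmul v p =>
      simp only [rightTensor_tmul, LinearMap.comp_apply, LinearEquiv.coe_coe, TensorProduct.assoc_tmul,
        LinearMap.lTensor_tmul, mkPP_mul, leftMul_apply]
    | add a c ha hc => simp only [map_add, add_tmul, ha, hc])

/-- The identification `V ⊗ (P ⊗_B P) → (V ⊗ P) ⊗_B P`. -/
def assocPPInv : V ⊗[k] A.PP →ₗ[k] A.VPP V :=
  TensorProduct.lift (BalTensor.lift A.actR A.actL
    (TensorProduct.curry (BalTensor.mk (fun b => A.rightTensor V (op b)) (fun b => A.leftMul b) ∘ₗ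
      (TensorProduct.assoc k V P P).symm.toLinearMap)).flip (fun b p q => by
      ext v
      exact BalTensor.mk_eq (fun b => A.rightTensor V (op b)) (fun b => A.leftMul b)
        b (v ⊗ₜ p) q)).flip

theorem assocPPInv_assocPP (z : A.VPP V) : A.assocPPInv V (A.assocPP V z) = z := by
  refine LinearMap.congr_fun (f := A.assocPPInv V ∘ₗ A.assocPP V) (g := LinearMap.id)
    (BalTensor.hom_ext fun m q => ?_) z
  induction m using TensorProduct.induction_add with
  | tmul v p => rfl
  | add a c ha hc => rw [add_tmul, map_add, map_add, map_add, ha, hc]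

theorem assocPP_assocPPInv (z : V ⊗[k] A.PP) : A.assocPP V (A.assocPPInv V z) = z := by
  refine LinearMap.congr_fun (f := A.assocPP V ∘ₗ A.assocPPInv V) (g := LinearMap.id)
    (TensorProduct.ext' fun v m => ?_) z
  induction m using BalTensor.induction_on with
  | tmul p q => rfl
  | add a c ha hc => rw [tmul_add, map_add, map_add, ha, hc]

/-! ### The canonical map -/

theorem can_mkPP (q p : P) :
    A.can (A.mkPP (q ⊗ₜ p)) = (LinearMap.mul k P q).rTensor H (A.coact p) := by
  change (LinearMap.mul' k P).rTensor H ((TensorProduct.assoc k P P H).symm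
    (A.coact.lTensor P (q ⊗ₜ p))) = _
  rw [LinearMap.lTensor_tmul]
  induction A.coact p using TensorProduct.induction_add with
  | tmul a c => simp
  | add a c ha hc => simp only [tmul_add, map_add, ha, hc]

/-- `(V ⊗ P) ⊗_B P → V ⊗ (P ⊗ H)`, `v ⊗ q ⊗ p ↦ v ⊗ q p₀ ⊗ p₁`. -/
def canTensor : A.VPP V →ₗ[k] V ⊗[k] (P ⊗[k] H) := A.can.lTensor V ∘ₗ A.assocPP V

variable {A} in
theorem IsHopfGalois.canTensor_injective (hG : A.IsHopfGalois) :
    Function.Injective (A.canTensor V) := by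
  have h : Function.Injective (A.assocPP V) :=
    Function.LeftInverse.injective (g := A.assocPPInv V) (A.assocPPInv_assocPP V)
  exact (Module.Flat.lTensor_preserves_injective_linearMap A.can hG.1 :
    Function.Injective (A.can.lTensor V)).comp h

variable {V}

theorem canTensor_mk (v : V) (p q : P) :
    A.canTensor V (BalTensor.mk _ _ ((v ⊗ₜ p) ⊗ₜ q)) =
      v ⊗ₜ (LinearMap.mul k P p).rTensor H (A.coact q) := by
  rw [← A.can_mkPP]; rfl

/-! ### The diagonal coaction -/

variable {V' : Type*} [AddCommGroup V'] [Module k V']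

/-- `(v ⊗ h, w ⊗ g) ↦ v ⊗ (w ⊗ h g)`. -/
def collect : V ⊗[k] H →ₗ[k] V' ⊗[k] H →ₗ[k] V ⊗[k] (V' ⊗[k] H) :=
  (TensorProduct.map₂ (TensorProduct.mk k V V') (LinearMap.mul k H)).compr₂
    (TensorProduct.assoc k V V' H).toLinearMap

@[simp]
theorem collect_tmul (a : V) (h : H) (c : V') (g : H) :
    collect (k := k) (a ⊗ₜ h) (c ⊗ₜ g) = a ⊗ₜ (c ⊗ₜ (h * g)) := by
  simp [collect]

/-- The diagonal coaction `p ⊗ q ↦ p₀ ⊗ (q₀ ⊗ p₁ q₁)`. -/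
def diagCoact : P ⊗[k] P →ₗ[k] P ⊗[k] (P ⊗[k] H) :=
  TensorProduct.lift (collect.compl₁₂ A.coact A.coact)

@[simp]
theorem diagCoact_tmul (p q : P) : A.diagCoact (p ⊗ₜ q) = collect (A.coact p) (A.coact q) := by
  simp [diagCoact]

/-- `p ⊗ q ↦ p ⊗ (q ⊗ 1)`. -/
def diagTriv (_A : CoquasiComoduleAlgebra k H P) : P ⊗[k] P →ₗ[k] P ⊗[k] (P ⊗[k] H) :=
  ((TensorProduct.mk k P H).flip 1).lTensor P

@[simp]
theorem diagTriv_tmul (p q : P) : A.diagTriv (p ⊗ₜ q) = p ⊗ₜ (q ⊗ₜ 1) := rfl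

/-- The coinvariants of `P ⊗ P` under the diagonal coaction. -/
def diagCoinv : Submodule k (P ⊗[k] P) := LinearMap.eqLocus A.diagCoact A.diagTriv

theorem mem_diagCoinv {z : P ⊗[k] P} : z ∈ A.diagCoinv ↔ A.diagCoact z = A.diagTriv z := Iff.rfl

theorem coact_mul_coinv (p : P) (b : A.coinvariants) :
    A.coact (p * b) = ((LinearMap.mul k P).flip (b : P)).rTensor H (A.coact p) := by
  rw [A.coact_mul, A.coact_coinv]
  induction A.coact p using TensorProduct.induction_add with
  | tmul a c => simp
  | add a c ha hc => simp only [add_mul, map_add, ha, hc]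

theorem coact_coinv_mul (p : P) (b : A.coinvariants) :
    A.coact (b * p) = (LinearMap.mul k P (b : P)).rTensor H (A.coact p) := by
  rw [A.coact_mul, A.coact_coinv]
  induction A.coact p using TensorProduct.induction_add with
  | tmul a c => simp
  | add a c ha hc => simp only [mul_add, map_add, ha, hc]

theorem collect_map (f : V →ₗ[k] V) (g : V' →ₗ[k] V') (a : V ⊗[k] H) (c : V' ⊗[k] H) :
    collect (f.rTensor H a) (g.rTensor H c) =
      TensorProduct.map f (g.rTensor H) (collect a c) := by
  induction a using TensorProduct.induction_add with
  | add a a' ha hc => simp only [map_add, LinearMap.add_apply, ha, hc]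
  | tmul a h =>
    induction c using TensorProduct.induction_add with
    | add a a' ha hc => simp only [map_add, ha, hc]
    | tmul c g => simp

/-- Elements of `B` have `H`-component `1`, so multiplying an outer side of the tensor by `b`
commutes with the coaction. This is what makes the diagonal coinvariants stable under both actions
of `B`. -/
theorem diagCoact_right (b : A.coinvariants) (z : P ⊗[k] P) :
    A.diagCoact ((A.actR b).lTensor P z) =
      (((A.actR b).rTensor H).lTensor P) (A.diagCoact z) := by
  induction z using TensorProduct.induction_add with
  | add a a' ha hc => simp only [map_add, ha, hc]
  | tmul p q =>
    rw [LinearMap.lTensor_tmul, diagCoact_tmul, diagCoact_tmul]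
    have := collect_map LinearMap.id (A.actR b) (A.coact p) (A.coact q)
    rw [LinearMap.rTensor_id, LinearMap.id_apply] at this
    refine Eq.trans ?_ this
    rw [← A.coact_mul_coinv]
    rfl

theorem diagCoact_left (b : A.coinvariants) (z : P ⊗[k] P) :
    A.diagCoact ((A.actL b).rTensor P z) = (A.actL b).rTensor (P ⊗[k] H) (A.diagCoact z) := by
  induction z using TensorProduct.induction_add with
  | add a a' ha hc => simp only [map_add, ha, hc]
  | tmul p q =>
    rw [LinearMap.rTensor_tmul, diagCoact_tmul, diagCoact_tmul]
    have := collect_map (A.actL b) LinearMap.id (A.coact p) (A.coact q)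
    rw [LinearMap.rTensor_id, LinearMap.id_apply] at this
    refine Eq.trans ?_ this
    rw [leftMul_apply, A.coact_coinv_mul]
    rfl

theorem diagTriv_right (b : A.coinvariants) (z : P ⊗[k] P) :
    A.diagTriv ((A.actR b).lTensor P z) =
      (((A.actR b).rTensor H).lTensor P) (A.diagTriv z) := by
  induction z using TensorProduct.induction_add with
  | add a a' ha hc => simp only [map_add, ha, hc]
  | tmul p q => rfl

theorem diagTriv_left (b : A.coinvariants) (z : P ⊗[k] P) :
    A.diagTriv ((A.actL b).rTensor P z) = (A.actL b).rTensor (P ⊗[k] H) (A.diagTriv z) := by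
  induction z using TensorProduct.induction_add with
  | add a a' ha hc => simp only [map_add, ha, hc]
  | tmul p q => rfl

theorem right_mem_diagCoinv (b : A.coinvariants) {z : P ⊗[k] P} (hz : z ∈ A.diagCoinv) :
    (A.actR b).lTensor P z ∈ A.diagCoinv := by
  rw [mem_diagCoinv] at hz ⊢
  rw [diagCoact_right, hz, diagTriv_right]

theorem left_mem_diagCoinv (b : A.coinvariants) {z : P ⊗[k] P} (hz : z ∈ A.diagCoinv) :
    (A.actL b).rTensor P z ∈ A.diagCoinv := by
  rw [mem_diagCoinv] at hz ⊢
  rw [diagCoact_left, hz, diagTriv_left]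

/-- The right `B`-module structure of the diagonal coinvariants. -/
def coinvRight : A.coinvariantsᵐᵒᵖ →ₐ[k] Module.End k A.diagCoinv :=
  restrictEnd (A.rightTensor P) A.diagCoinv (fun a _ hm => A.right_mem_diagCoinv a.unop hm)

/-- The left action of `B` on the diagonal coinvariants. -/
def coinvLeft (b : A.coinvariants) : A.diagCoinv →ₗ[k] A.diagCoinv :=
  ((A.actL b).rTensor P).restrict (fun _ hm => A.left_mem_diagCoinv b hm)

@[simp]
theorem coinvLeft_coe (b : A.coinvariants) (X : A.diagCoinv) :
    (A.coinvLeft b X : P ⊗[k] P) = (A.actL b).rTensor P X := rfl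

@[simp]
theorem coinvRight_coe (b : A.coinvariants) (X : A.diagCoinv) :
    (A.coinvRight (op b) X : P ⊗[k] P) = (A.actR b).lTensor P X := rfl

end CoquasiComoduleAlgebra

end

noncomputable section

namespace CoquasiComoduleAlgebra

open CoalgebraStruct (comul counit)
open HopfAlgebra (antipode)
open TensorProduct

variable {k : Type u} {H : Type v} {P : Type w} [Field k] [Ring H] [HopfAlgebra k H]
  [NonAssocRing P] [Module k P] [IsScalarTower k P P] [SMulCommClass k P P]
  (A : CoquasiComoduleAlgebra k H P)

/-! ### Descent for the diagonal coinvariants -/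

/-- `g ⊗ h ↦ g f(h)₁ ⊗ f(h)₂`. -/
def shift (f : H →ₗ[k] H ⊗[k] H) : H ⊗[k] H →ₗ[k] H ⊗[k] H :=
  (LinearMap.mul' k H).rTensor H ∘ₗ (TensorProduct.assoc k H H H).symm.toLinearMap ∘ₗ f.lTensor H

theorem shift_tmul (f : H →ₗ[k] H ⊗[k] H) (g h : H) :
    shift f (g ⊗ₜ h) = (LinearMap.mul k H g).rTensor H (f h) := by
  simp only [shift, LinearMap.comp_apply, LinearMap.lTensor_tmul]
  induction f h using TensorProduct.induction_add with
  | tmul a c => simp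
  | add a c ha hc => simp only [tmul_add, map_add, ha, hc]

/-- The map `g ⊗ h ↦ g h₁ ⊗ h₂` is undone by `g ⊗ h ↦ g S(h₁) ⊗ h₂`, since `h₁ S(h₂) ⊗ h₃ = 1 ⊗ h`.
-/
theorem shift_comul_injective : Function.Injective (shift (k := k) (H := H) comul) := by
  refine Function.LeftInverse.injective
    (g := shift ((antipode k).rTensor H ∘ₗ comul)) fun z => ?_
  have key : ∀ h : H, shift ((antipode k).rTensor H ∘ₗ comul) (comul (R := k) h) = 1 ⊗ₜ h := by
    intro h
    have h1 : shift ((antipode k).rTensor H ∘ₗ comul) (comul (R := k) h) =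
        (LinearMap.mul' k H ∘ₗ (antipode k).lTensor H).rTensor H
          ((TensorProduct.assoc k H H H).symm ((comul (R := k)).lTensor H (comul h))) := by
      induction comul (R := k) h using TensorProduct.induction_add with
      | add a c ha hc => simp only [map_add, ha, hc]
      | tmul a c =>
        rw [shift_tmul, LinearMap.comp_apply, LinearMap.lTensor_tmul]
        induction comul (R := k) c using TensorProduct.induction_add with
        | add a c ha hc => simp only [tmul_add, map_add, ha, hc]
        | tmul b c => simp
    rw [h1, Coalgebra.coassoc_symm_apply, ← LinearMap.rTensor_comp_apply, LinearMap.comp_assoc,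
      HopfAlgebra.mul_antipode_lTensor_comul, LinearMap.rTensor_comp_apply,
      Coalgebra.rTensor_counit_comul]
    simp
  induction z using TensorProduct.induction_add with
  | add a c ha hc => simp only [map_add, ha, hc]
  | tmul g h =>
    have h2 : ∀ (z : H ⊗[k] H), shift ((antipode k).rTensor H ∘ₗ comul)
        ((LinearMap.mul k H g).rTensor H z) = (LinearMap.mul k H g).rTensor H
          (shift ((antipode k).rTensor H ∘ₗ comul) z) := by
      intro z
      induction z using TensorProduct.induction_add with
      | add a c ha hc => simp only [map_add, ha, hc]
      | tmul a c =>
        rw [LinearMap.rTensor_tmul, shift_tmul, shift_tmul, ← LinearMap.rTensor_comp_apply]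
        congr 2
        ext; simp [mul_assoc]
    rw [shift_tmul, h2, key]
    simp

/-- The diagonal coaction with values in `(P ⊗ P) ⊗ H`. -/
def diagCoact' : P ⊗[k] P →ₗ[k] (P ⊗[k] P) ⊗[k] H :=
  (TensorProduct.assoc k P P H).symm.toLinearMap ∘ₗ A.diagCoact

/-- `(v ⊗ h, w ⊗ g) ↦ (v ⊗ w) ⊗ h g`. -/
abbrev collect' : P ⊗[k] H →ₗ[k] P ⊗[k] H →ₗ[k] (P ⊗[k] P) ⊗[k] H :=
  TensorProduct.map₂ (TensorProduct.mk k P P) (LinearMap.mul k H)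

theorem diagCoact'_tmul (p q : P) :
    A.diagCoact' (p ⊗ₜ q) = collect' (A.coact p) (A.coact q) := by
  simp [diagCoact', collect]

/-- Comes from coassociativity on each leg and multiplicativity of `comul` on `H`. It is the
equation that drives the descent argument in `IsHopfGalois.exists_gal_eq`. -/
theorem diagCoact'_coassoc (y : P ⊗[k] P) :
    TensorProduct.assoc k (P ⊗[k] P) H H (A.diagCoact'.rTensor H (A.diagCoact' y)) =
      (comul (R := k)).lTensor (P ⊗[k] P) (A.diagCoact' y) := by
  induction y using TensorProduct.induction_add with
  | add a c ha hc => simp only [map_add, ha, hc]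
  | tmul p q =>
    have h1 : ∀ a b : P ⊗[k] H, A.diagCoact'.rTensor H (collect' a b) =
        TensorProduct.map₂ collect' (LinearMap.mul k H) (A.coact.rTensor H a)
          (A.coact.rTensor H b) := by
      intro a b
      induction a using TensorProduct.induction_add with
      | add a c ha hc => simp only [map_add, LinearMap.add_apply, ha, hc]
      | tmul p h =>
        induction b using TensorProduct.induction_add with
        | add a c ha hc => simp only [map_add, ha, hc]
        | tmul q g =>
          simp only [map₂_apply_tmul, map_tmul, LinearMap.rTensor_tmul, mk_apply, diagCoact'_tmul]
    have h2 : ∀ a b : P ⊗[k] H, TensorProduct.assoc k (P ⊗[k] P) H H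
        (TensorProduct.map₂ collect' (LinearMap.mul k H)
          ((TensorProduct.assoc k P H H).symm ((comul (R := k)).lTensor P a))
          ((TensorProduct.assoc k P H H).symm ((comul (R := k)).lTensor P b))) =
        (comul (R := k)).lTensor (P ⊗[k] P) (collect' a b) := by
      intro a b
      induction a using TensorProduct.induction_add with
      | add a c ha hc => simp only [map_add, LinearMap.add_apply, ha, hc]
      | tmul p h =>
        induction b using TensorProduct.induction_add with
        | add a c ha hc => simp only [map_add, ha, hc]
        | tmul q g =>
          simp only [map₂_apply_tmul, map_tmul, LinearMap.lTensor_tmul, mk_apply, LinearMap.mul_apply',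
            Bialgebra.comul_mul]
          generalize comul (R := k) h = s
          generalize comul (R := k) g = t
          induction s using TensorProduct.induction_add with
          | add a c ha hc => simp only [map_add, tmul_add, add_mul, LinearMap.add_apply, ha, hc]
          | tmul h h' =>
            induction t using TensorProduct.induction_add with
            | add a c ha hc => simp only [map_add, tmul_add, mul_add, ha, hc]
            | tmul g g' => simp
    rw [diagCoact'_tmul, h1, ← h2, ← A.coact_coassoc, ← A.coact_coassoc,
      LinearEquiv.symm_apply_apply, LinearEquiv.symm_apply_apply]

/-- `p ⊗ (q ⊗ h) ↦ (p ⊗ h) ⊗ q`. -/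
def swapLast : P ⊗[k] (P ⊗[k] H) ≃ₗ[k] (P ⊗[k] H) ⊗[k] P :=
  (TensorProduct.comm k P H).lTensor P ≪≫ₗ (TensorProduct.assoc k P H P).symm

@[simp]
theorem swapLast_tmul (p q : P) (h : H) :
    swapLast (k := k) (p ⊗ₜ (q ⊗ₜ h)) = (p ⊗ₜ h) ⊗ₜ q := by
  simp [swapLast]

theorem swapLast_right (b : A.coinvariants) (z : P ⊗[k] (P ⊗[k] H)) :
    swapLast (((A.actR b).rTensor H).lTensor P z) = A.rightTensor (P ⊗[k] H) (op b) (swapLast z) := by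
  induction z using TensorProduct.induction_add with
  | add a c ha hc => simp only [map_add, ha, hc]
  | tmul p z =>
    induction z using TensorProduct.induction_add with
    | add a c ha hc => simp only [map_add, tmul_add, ha, hc]
    | tmul p z => simp

/-- `(P ⊗ P) ⊗ P → P ⊗ (P ⊗ H)`, `(p ⊗ q) ⊗ s ↦ p ⊗ (q s₀ ⊗ s₁)`. -/
def gal : (P ⊗[k] P) ⊗[k] P →ₗ[k] P ⊗[k] (P ⊗[k] H) :=
  A.canTensor P ∘ₗ BalTensor.mk _ _

/-- `(P ⊗ P) ⊗ P → P ⊗ P`, `(p ⊗ q) ⊗ s ↦ p ⊗ q s`. -/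
def mulLast (_A : CoquasiComoduleAlgebra k H P) : (P ⊗[k] P) ⊗[k] P →ₗ[k] P ⊗[k] P :=
  (LinearMap.mul' k P).lTensor P ∘ₗ (TensorProduct.assoc k P P P).toLinearMap

@[simp]
theorem mulLast_tmul (p q s : P) : A.mulLast ((p ⊗ₜ q) ⊗ₜ s) = p ⊗ₜ (q * s) := by
  simp [mulLast]

theorem gal_tmul (p q s : P) :
    A.gal ((p ⊗ₜ q) ⊗ₜ s) = p ⊗ₜ (LinearMap.mul k P q).rTensor H (A.coact s) :=
  A.canTensor_mk p q s

/-- `p ⊗ (q ⊗ h) ↦ p ⊗ ε(h) q`. -/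
def counitLast (_A : CoquasiComoduleAlgebra k H P) : P ⊗[k] (P ⊗[k] H) →ₗ[k] P ⊗[k] P :=
  ((TensorProduct.rid k P).toLinearMap ∘ₗ (counit (R := k)).lTensor P).lTensor P

/-- Together with `counitLast_diagCoact` this shows that `gal z = diagCoact y` forces the product of
`z` to be `y`. -/
theorem counitLast_gal (z : (P ⊗[k] P) ⊗[k] P) : A.counitLast (A.gal z) = A.mulLast z := by
  induction z using TensorProduct.induction_add with
  | add a c ha hc => simp only [map_add, ha, hc]
  | tmul z s =>
    induction z using TensorProduct.induction_add with
    | add a c ha hc => simp only [map_add, add_tmul, ha, hc]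
    | tmul p q =>
      rw [gal_tmul, mulLast_tmul]
      conv_rhs => rw [← A.coact_counit s]
      simp only [counitLast, LinearMap.lTensor_tmul, LinearMap.comp_apply]
      congr 1
      induction A.coact s using TensorProduct.induction_add with
      | add a c ha hc => simp only [map_add, mul_add, ha, hc]
      | tmul p q => simp [mul_smul_comm]

theorem counitLast_diagCoact (z : P ⊗[k] P) : A.counitLast (A.diagCoact z) = z := by
  induction z using TensorProduct.induction_add with
  | add a c ha hc => simp only [map_add, ha, hc]
  | tmul p q =>
    conv_rhs => rw [← A.coact_counit p, ← A.coact_counit q]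
    rw [diagCoact_tmul]
    induction A.coact p using TensorProduct.induction_add with
    | add a c ha hc => simp only [map_add, LinearMap.add_apply, add_tmul, ha, hc]
    | tmul p h =>
      induction A.coact q using TensorProduct.induction_add with
      | add a c ha hc => simp only [map_add, tmul_add, ha, hc]
      | tmul q g => simp [counitLast, smul_smul, mul_comm, ← smul_tmul']

theorem diagCoact_mulLast (z : P ⊗[k] P) (s : P) :
    A.diagCoact (A.mulLast (z ⊗ₜ s)) =
      ((LinearMap.mul k (P ⊗[k] H)).flip (A.coact s)).lTensor P (A.diagCoact z) := by
  induction z using TensorProduct.induction_add with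
  | add a c ha hc => simp only [map_add, add_tmul, ha, hc]
  | tmul p q =>
    rw [mulLast_tmul, diagCoact_tmul, diagCoact_tmul, A.coact_mul]
    generalize A.coact p = a
    generalize A.coact q = b
    generalize A.coact s = c
    induction a using TensorProduct.induction_add with
    | add a c ha hc => simp only [map_add, LinearMap.add_apply, ha, hc]
    | tmul p h =>
      induction b using TensorProduct.induction_add with
      | add a c ha hc => simp only [map_add, add_mul, ha, hc]
      | tmul q g =>
        induction c using TensorProduct.induction_add with
        | add a c ha hc =>
          simp only [LinearMap.lTensor_tmul, collect_tmul, LinearMap.flip_apply,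
            LinearMap.mul_apply'] at ha hc ⊢
          rw [mul_add, map_add, ha, hc, mul_add, tmul_add]
        | tmul s f => simp [mul_assoc]

/-- On `C ⊗ P`, where `C` are the diagonal coinvariants, the map `gal` is the diagonal coaction
of the product. -/
theorem gal_eq_diagCoact (t : A.diagCoinv ⊗[k] P) :
    A.gal (A.diagCoinv.subtype.rTensor P t) =
      A.diagCoact (A.mulLast (A.diagCoinv.subtype.rTensor P t)) := by
  induction t using TensorProduct.induction_add with
  | add a c ha hc => simp only [map_add, ha, hc]
  | tmul X s =>
    rw [LinearMap.rTensor_tmul, diagCoact_mulLast]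
    -- The `H`-component of `X` becomes `1`, so only the coaction of `s` remains, as it does in
    -- `gal`.
    rw [show A.diagCoact (A.diagCoinv.subtype X) = A.diagTriv X from X.2]
    rw [Submodule.subtype_apply]
    generalize (X : P ⊗[k] P) = z
    induction z using TensorProduct.induction_add with
    | add a c ha hc => simp only [map_add, add_tmul, ha, hc]
    | tmul p q =>
      rw [gal_tmul, diagTriv_tmul, LinearMap.lTensor_tmul]
      congr 1
      induction A.coact s using TensorProduct.induction_add with
      | add a c ha hc => simp only [map_add, LinearMap.add_apply, ha, hc]
      | tmul p q => simp

/-- The coordinates used to compare the two ways of making `(P ⊗ H) ⊗ P ⊗_B P`. -/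
def galShift : A.VPP (P ⊗[k] H) →ₗ[k] (P ⊗[k] P) ⊗[k] (H ⊗[k] H) :=
  (shift comul).lTensor (P ⊗[k] P) ∘ₗ
    (TensorProduct.tensorTensorTensorComm k P H P H).toLinearMap ∘ₗ A.canTensor (P ⊗[k] H)

variable {A} in
theorem IsHopfGalois.galShift_injective (hG : A.IsHopfGalois) :
    Function.Injective A.galShift :=
  (Module.Flat.lTensor_preserves_injective_linearMap (M := P ⊗[k] P) _
    (shift_comul_injective (k := k) (H := H))).comp
    ((TensorProduct.tensorTensorTensorComm k P H P H).injective.comp (hG.canTensor_injective _))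

/-- In the coordinates `galShift`, the diagonal coaction on the first factor turns into the diagonal
coaction applied to `gal`, and the trivial coaction (next lemma) turns into `comul` applied to the
`H`-leg of `gal`. Their agreement on a diagonal coaction is coassociativity. -/
theorem galShift_diagCoact (z : P ⊗[k] P) (s : P) :
    A.galShift (BalTensor.mk _ _ (swapLast (A.diagCoact z) ⊗ₜ s)) =
      TensorProduct.assoc k (P ⊗[k] P) H H (A.diagCoact'.rTensor H
        ((TensorProduct.assoc k P P H).symm (A.gal (z ⊗ₜ s)))) := by
  have h1 : ∀ (a b : P ⊗[k] H), A.galShift (BalTensor.mk _ _ (swapLast (collect a b) ⊗ₜ s)) =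
      TensorProduct.assoc k (P ⊗[k] P) H H ((collect' a ∘ₗ LinearMap.mul k _ b).rTensor H
        ((TensorProduct.assoc k P H H).symm ((comul (R := k)).lTensor P (A.coact s)))) := by
    intro a b
    induction a using TensorProduct.induction_add with
    | add a c ha hc =>
      simp only [map_add, LinearMap.add_apply, add_tmul, ha, hc, LinearMap.add_comp,
        LinearMap.rTensor_add]
    | tmul p h =>
      induction b using TensorProduct.induction_add with
      | add a c ha hc =>
        simp only [map_add, LinearMap.add_apply, add_tmul, ha, hc, LinearMap.comp_add,
          LinearMap.rTensor_add]
      | tmul x g =>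
        rw [collect_tmul, swapLast_tmul, galShift, LinearMap.comp_apply, LinearMap.comp_apply,
          canTensor_mk]
        induction A.coact s using TensorProduct.induction_add with
        | add a c ha hc => simp only [map_add, tmul_add, ha, hc]
        | tmul y c =>
          simp only [LinearMap.rTensor_tmul, LinearMap.mul_apply', LinearEquiv.coe_coe,
            tensorTensorTensorComm_tmul, LinearMap.lTensor_tmul, shift_tmul]
          induction comul (R := k) c using TensorProduct.induction_add with
          | add a c ha hc => simp only [map_add, tmul_add, ha, hc]
          | tmul c c' => simp [mul_assoc]
  induction z using TensorProduct.induction_add with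
  | add a c ha hc => simp only [map_add, add_tmul, ha, hc]
  | tmul p x =>
    rw [diagCoact_tmul, h1, gal_tmul, ← A.coact_coassoc, LinearEquiv.symm_apply_apply]
    congr 1
    induction A.coact s using TensorProduct.induction_add with
    | add a c ha hc => simp only [map_add, tmul_add, ha, hc]
    | tmul y c => simp [diagCoact'_tmul, A.coact_mul]

theorem galShift_diagTriv (z : P ⊗[k] P) (s : P) :
    A.galShift (BalTensor.mk _ _ (swapLast (A.diagTriv z) ⊗ₜ s)) =
      (comul (R := k)).lTensor (P ⊗[k] P)
        ((TensorProduct.assoc k P P H).symm (A.gal (z ⊗ₜ s))) := by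
  induction z using TensorProduct.induction_add with
  | add a c ha hc => simp only [map_add, add_tmul, ha, hc]
  | tmul p x =>
    rw [diagTriv_tmul, swapLast_tmul, galShift, LinearMap.comp_apply, LinearMap.comp_apply,
      canTensor_mk, gal_tmul]
    induction A.coact s using TensorProduct.induction_add with
    | add a c ha hc => simp only [map_add, tmul_add, ha, hc]
    | tmul y c =>
      simp only [LinearMap.rTensor_tmul, LinearMap.mul_apply', LinearEquiv.coe_coe,
        tensorTensorTensorComm_tmul, LinearMap.lTensor_tmul, shift_tmul,
        TensorProduct.assoc_symm_tmul]
      rw [show LinearMap.mul k H 1 = LinearMap.id from by ext; simp]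
      simp

/-- The difference of the diagonal and the trivial coaction, as a map of right `B`-modules. -/
def diagDiff : P ⊗[k] P →ₗ[k] (P ⊗[k] H) ⊗[k] P :=
  swapLast.toLinearMap ∘ₗ (A.diagCoact - A.diagTriv)

theorem diagDiff_right (b : A.coinvariants) (z : P ⊗[k] P) :
    A.diagDiff (A.rightTensor P (op b) z) = A.rightTensor (P ⊗[k] H) (op b) (A.diagDiff z) := by
  rw [rightTensor_apply]
  simp only [diagDiff, LinearMap.comp_apply, LinearMap.sub_apply, LinearEquiv.coe_coe,
    ← swapLast_right, map_sub, diagCoact_right, diagTriv_right]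

theorem ker_diagDiff : LinearMap.ker A.diagDiff = A.diagCoinv := by
  ext z
  simp [diagDiff, mem_diagCoinv, sub_eq_zero]

variable {A}

/-- The Galois property gives some `z` in `(P ⊗ P) ⊗ P` over `diagCoact y`. Coassociativity of the
diagonal coaction says that `z` is killed by `diagDiff ⊗_B P`, and flatness then moves `z` into `ker
diagDiff ⊗ P`, that is, over the diagonal coinvariants. -/
theorem IsHopfGalois.exists_gal_eq (hG : A.IsHopfGalois)
    (hff : IsFaithfullyFlat.{u, w, w, max v w} A.leftMul) (y : P ⊗[k] P) :
    ∃ t : A.diagCoinv ⊗[k] P, A.gal (A.diagCoinv.subtype.rTensor P t) = A.diagCoact y := by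
  obtain ⟨z, hz⟩ : ∃ z, A.gal z = A.diagCoact y := by
    obtain ⟨w, hw⟩ := LinearMap.lTensor_surjective P hG.2 (A.diagCoact y)
    obtain ⟨z, hz⟩ := BalTensor.mk_surjective _ _ (A.assocPPInv P w)
    refine ⟨z, ?_⟩
    rw [gal, LinearMap.comp_apply, hz, canTensor, LinearMap.comp_apply, assocPP_assocPPInv, hw]
  have h0 := hff.exists_of_rTensor_eq_zero (A.rightTensor P) (A.rightTensor (P ⊗[k] H))
    A.diagDiff A.diagDiff_right z ?_
  · rw [ker_diagDiff] at h0
    obtain ⟨t, ht⟩ := h0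
    refine ⟨t, ?_⟩
    rw [← hz, gal, LinearMap.comp_apply, LinearMap.comp_apply, ht]
  -- Here the vanishing of `z` under `diagDiff ⊗_B P` is verified in the injective coordinates
  -- `galShift`.
  · apply hG.galShift_injective
    rw [map_zero]
    have h1 : ∀ z : (P ⊗[k] P) ⊗[k] P, A.galShift (BalTensor.rTensor _ _ _
        A.diagDiff A.diagDiff_right (BalTensor.mk _ _ z)) =
        TensorProduct.assoc k (P ⊗[k] P) H H (A.diagCoact'.rTensor H
          ((TensorProduct.assoc k P P H).symm (A.gal z))) -
        (comul (R := k)).lTensor (P ⊗[k] P) ((TensorProduct.assoc k P P H).symm (A.gal z)) := by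
      intro z
      rw [BalTensor.rTensor_mk]
      induction z using TensorProduct.induction_add with
      | add a c ha hc => simp only [map_add, ha, hc]; abel
      | tmul z s =>
        rw [← galShift_diagCoact, ← galShift_diagTriv, ← map_sub, ← map_sub, ← sub_tmul,
          ← map_sub]
        rfl
    rw [h1, hz, sub_eq_zero]
    exact A.diagCoact'_coassoc y

/-- Surjectivity comes from `exists_gal_eq` by applying the counit; over a field it yields a
`k`-linear section. The section need not respect `B`; only its class in the balanced tensor product
is canonical. -/
theorem IsHopfGalois.exists_section (hG : A.IsHopfGalois)
    (hff : IsFaithfullyFlat.{u, w, w, max v w} A.leftMul) :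
    ∃ σ : P ⊗[k] P →ₗ[k] A.diagCoinv ⊗[k] P,
    ∀ y, A.mulLast (A.diagCoinv.subtype.rTensor P (σ y)) = y := by
  have hs : Function.Surjective (A.mulLast ∘ₗ A.diagCoinv.subtype.rTensor P) := by
    intro y
    obtain ⟨t, ht⟩ := hG.exists_gal_eq hff y
    refine ⟨t, ?_⟩
    rw [LinearMap.comp_apply, ← counitLast_gal, ht, counitLast_diagCoact]
  obtain ⟨σ, hσ⟩ := (A.mulLast ∘ₗ A.diagCoinv.subtype.rTensor P).exists_rightInverse_of_surjective
    (LinearMap.range_eq_top.2 hs)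
  exact ⟨σ, fun y => LinearMap.congr_fun hσ y⟩

/-- Flatness embeds `C ⊗_B P` into `(P ⊗ P) ⊗_B P`, where the Galois map is injective; on `C ⊗ P`
that map is the diagonal coaction of the product, so the product determines the class. -/
theorem IsHopfGalois.mk_eq_of_mulLast_eq (hG : A.IsHopfGalois)
    (hff : IsFaithfullyFlat.{u, w, w, max v w} A.leftMul) (t t' : A.diagCoinv ⊗[k] P)
    (h : A.mulLast (A.diagCoinv.subtype.rTensor P t) =
      A.mulLast (A.diagCoinv.subtype.rTensor P t')) :
    BalTensor.mk (fun b => A.coinvRight (op b)) (fun b => A.leftMul b) t =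
      BalTensor.mk (fun b => A.coinvRight (op b)) (fun b => A.leftMul b) t' := by
  have hff' := IsFaithfullyFlat.lower.{v, w} hff
  apply hff'.flat A.diagCoinv (P ⊗[k] P) A.coinvRight (A.rightTensor P) A.diagCoinv.subtype
    (fun _ _ => rfl) (Submodule.injective_subtype _)
  apply hG.canTensor_injective P
  have := congrArg A.diagCoact h
  rwa [← gal_eq_diagCoact, ← gal_eq_diagCoact] at this

end CoquasiComoduleAlgebra

end

noncomputable section

/-! ### Right module structures on balanced tensor products -/

/-- The right module structure of `M ⊗_B N` that comes from one of `N`. -/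
def BalTensor.endRight {k : Type*} [Field k] {B : Type*} {R M N : Type*} [Ring R] [Algebra k R]
    [AddCommGroup M] [Module k M] [AddCommGroup N] [Module k N] (r : B → M →ₗ[k] M)
    (l : B → N →ₗ[k] N) (s : R →ₐ[k] Module.End k N) (hs : ∀ a b n, s a (l b n) = l b (s a n)) :
    R →ₐ[k] Module.End k (BalTensor r l) :=
  AlgHom.ofLinearMap
    { toFun := fun a => BalTensor.lTensor r l l (s a) (hs a)
      map_add' := fun a b => BalTensor.hom_ext fun m n => by
        change BalTensor.mk r l (m ⊗ₜ s (a + b) n) =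
          BalTensor.mk r l (m ⊗ₜ s a n) + BalTensor.mk r l (m ⊗ₜ s b n)
        rw [map_add, LinearMap.add_apply, TensorProduct.tmul_add, map_add]
      map_smul' := fun c a => BalTensor.hom_ext fun m n => by
        change BalTensor.mk r l (m ⊗ₜ s (c • a) n) = c • BalTensor.mk r l (m ⊗ₜ s a n)
        rw [map_smul, LinearMap.smul_apply, TensorProduct.tmul_smul, map_smul] }
    (BalTensor.hom_ext fun m n => by
      change BalTensor.mk r l (m ⊗ₜ s 1 n) = BalTensor.mk r l (m ⊗ₜ n)
      rw [map_one]; rfl)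
    (fun a b => BalTensor.hom_ext fun m n => by
      change BalTensor.mk r l (m ⊗ₜ s (a * b) n) = BalTensor.mk r l (m ⊗ₜ s a (s b n))
      rw [map_mul]; rfl)

namespace CoquasiComoduleAlgebra

open CoalgebraStruct (comul counit)
open HopfAlgebra (antipode)
open TensorProduct

variable {k : Type u} {H : Type v} {P : Type w} [Field k] [Ring H] [HopfAlgebra k H]
  [NonAssocRing P] [Module k P] [IsScalarTower k P P] [SMulCommClass k P P]
  {A : CoquasiComoduleAlgebra k H P}

/-- Every `n` is the image of `1` under right multiplication by `n`, which is left `B`-linear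
because `B` associates with `P`. -/
theorem unit_injective (hff : IsFaithfullyFlat.{u, w, w, w} A.leftMul)
    {M : Type w} [AddCommGroup M] [Module k M] (r : A.coinvariantsᵐᵒᵖ →ₐ[k] Module.End k M) (m : M)
    (hm : BalTensor.mk (fun b => r (op b)) (fun b => A.leftMul b) (m ⊗ₜ 1) = 0) : m = 0 :=
  hff.eq_zero_of_mk_tmul (1 : P)
    (fun n => ⟨(LinearMap.mul k P).flip n, fun b n' => A.mul_assoc_left n' n b, one_mul n⟩) r m hm

variable (A) in
/-- `(v ⊗ p) ⊗ (q ⊗ v') ↦ v ⊗ ((p ⊗_B q) ⊗ v')`. -/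
def incl (V V' : Type*) [AddCommGroup V] [Module k V] [AddCommGroup V'] [Module k V'] :
    (V ⊗[k] P) ⊗[k] (P ⊗[k] V') →ₗ[k] V ⊗[k] (A.PP ⊗[k] V') :=
  (A.mkPP.rTensor V').lTensor V ∘ₗ
    ((TensorProduct.assoc k P P V').symm.toLinearMap).lTensor V ∘ₗ
    (TensorProduct.assoc k V P (P ⊗[k] V')).toLinearMap

@[simp]
theorem incl_tmul {V V' : Type*} [AddCommGroup V] [Module k V] [AddCommGroup V'] [Module k V']
    (v : V) (p q : P) (v' : V') :
    A.incl V V' ((v ⊗ₜ p) ⊗ₜ (q ⊗ₜ v')) = v ⊗ₜ (A.mkPP (p ⊗ₜ q) ⊗ₜ v') := rfl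

theorem incl_balanced {V V' : Type*} [AddCommGroup V] [Module k V] [AddCommGroup V'] [Module k V']
    (b : A.coinvariants) (x : V ⊗[k] P) (y : P ⊗[k] V') :
    A.incl V V' ((A.actR b).lTensor V x ⊗ₜ y) = A.incl V V' (x ⊗ₜ (A.actL b).rTensor V' y) := by
  induction x using TensorProduct.induction_add with
  | add a c ha hc => simp only [map_add, add_tmul, ha, hc]
  | tmul v p =>
    induction y using TensorProduct.induction_add with
    | add a c ha hc => simp only [map_add, tmul_add, ha, hc]
    | tmul q v' =>
      simp only [LinearMap.lTensor_tmul, LinearMap.rTensor_tmul, incl_tmul]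
      exact congrArg (fun t => v ⊗ₜ[k] (t ⊗ₜ[k] v')) (A.mkPP_mul p q b)

/-! ### Embedding `M ⊗_B C` into `(M ⊗_B P) ⊗ P` -/

section Kappa

variable {M : Type w} [AddCommGroup M] [Module k M] (r : A.coinvariantsᵐᵒᵖ →ₐ[k] Module.End k M)

/-- `M ⊗_B C`, where `C` are the diagonal coinvariants. -/
abbrev MC : Type _ := BalTensor (fun b => r (op b)) A.coinvLeft

/-- `M ⊗_B P`. -/
abbrev MP : Type _ := BalTensor (fun b => r (op b)) (fun b => A.leftMul b)

theorem coinvRight_coinvLeft (a : A.coinvariantsᵐᵒᵖ) (b : A.coinvariants) (X : A.diagCoinv) :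
    A.coinvRight a (A.coinvLeft b X) = A.coinvLeft b (A.coinvRight a X) := by
  apply Subtype.ext
  change (A.actR a.unop).lTensor P ((A.actL b).rTensor P X) =
    (A.actL b).rTensor P ((A.actR a.unop).lTensor P X)
  rw [← LinearMap.comp_apply, ← LinearMap.comp_apply, LinearMap.lTensor_comp_rTensor,
    LinearMap.rTensor_comp_lTensor]

/-- The right `B`-module structure of `M ⊗_B C`. -/
def rightMC : A.coinvariantsᵐᵒᵖ →ₐ[k] Module.End k (MC r) :=
  BalTensor.endRight _ _ A.coinvRight coinvRight_coinvLeft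

/-- `M ⊗_B C → (M ⊗_B P) ⊗ P`. -/
def kappa : MC r →ₗ[k] MP r ⊗[k] P :=
  BalTensor.lift _ _
    ((BalTensor.mk (fun b => r (op b)) (fun b => A.leftMul b)).rTensor P ∘ₗ
      (TensorProduct.assoc k M P P).symm.toLinearMap ∘ₗ A.diagCoinv.subtype.lTensor M) (by
    intro b m X
    simp only [LinearMap.comp_apply, LinearMap.lTensor_tmul, Submodule.subtype_apply,
      coinvLeft_coe]
    generalize (X : P ⊗[k] P) = z
    induction z using TensorProduct.induction_add with
    | add a c ha hc => simp only [map_add, tmul_add, ha, hc]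
    | tmul p q =>
      simp only [LinearMap.rTensor_tmul, LinearEquiv.coe_coe, TensorProduct.assoc_symm_tmul]
      rw [BalTensor.mk_eq (fun b => r (op b)) (fun b => A.leftMul b)])

/-- `m ⊗ (X ⊗ s) ↦ (m ⊗_B X) ⊗_B s`. -/
def assocMCP : M ⊗[k] (A.diagCoinv ⊗[k] P) →ₗ[k] MP (rightMC r) :=
  BalTensor.mk _ _ ∘ₗ (BalTensor.mk (fun b => r (op b)) A.coinvLeft).rTensor P ∘ₗ
    (TensorProduct.assoc k M A.diagCoinv P).symm.toLinearMap

theorem assocMCP_congr (m : M) (t t' : A.diagCoinv ⊗[k] P)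
    (h : BalTensor.mk (fun b => A.coinvRight (op b)) (fun b => A.leftMul b) t =
      BalTensor.mk (fun b => A.coinvRight (op b)) (fun b => A.leftMul b) t') :
    assocMCP r (m ⊗ₜ t) = assocMCP r (m ⊗ₜ t') := by
  let f := BalTensor.lift (fun b => A.coinvRight (op b)) (fun b => A.leftMul b)
    (assocMCP r ∘ₗ TensorProduct.mk k M _ m) (fun b X s =>
      BalTensor.mk_eq (fun b => rightMC r (op b)) (fun b => A.leftMul b) b
        (BalTensor.mk (fun b => r (op b)) A.coinvLeft (m ⊗ₜ X)) s)
  exact congrArg f h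

theorem assocMCP_left (m : M) (b : A.coinvariants) (t : A.diagCoinv ⊗[k] P) :
    assocMCP r (r (op b) m ⊗ₜ t) = assocMCP r (m ⊗ₜ (A.coinvLeft b).rTensor P t) := by
  induction t using TensorProduct.induction_add with
  | add a c ha hc => simp only [map_add, tmul_add, ha, hc]
  | tmul X s =>
    simp only [assocMCP, LinearMap.comp_apply, LinearEquiv.coe_coe, TensorProduct.assoc_symm_tmul,
      LinearMap.rTensor_tmul]
    rw [BalTensor.mk_eq (fun b => r (op b)) A.coinvLeft]

theorem mulLast_left (b : A.coinvariants) (t : A.diagCoinv ⊗[k] P) :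
    A.mulLast (A.diagCoinv.subtype.rTensor P ((A.coinvLeft b).rTensor P t)) =
      (A.actL b).rTensor P (A.mulLast (A.diagCoinv.subtype.rTensor P t)) := by
  induction t using TensorProduct.induction_add with
  | add a c ha hc => simp only [map_add, ha, hc]
  | tmul X s =>
    simp only [LinearMap.rTensor_tmul, Submodule.subtype_apply, coinvLeft_coe]
    generalize (X : P ⊗[k] P) = z
    induction z using TensorProduct.induction_add with
    | add a c ha hc => simp only [map_add, add_tmul, ha, hc]
    | tmul p q => simp

/-- The section `σ` gives a map `m ⊗ p ⊗ q ↦ m ⊗ σ(p ⊗ q)` from `(M ⊗_B P) ⊗ P` to `(M ⊗_B C) ⊗_B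
P`. Its composite with `kappa` is `z ↦ z ⊗_B 1`, which is injective by faithful flatness. -/
theorem kappa_injective (hG : A.IsHopfGalois)
    (hff : IsFaithfullyFlat.{u, w, w, max v w} A.leftMul) : Function.Injective (kappa r) := by
  obtain ⟨σ, hσ⟩ := hG.exists_section hff
  let ρ : MP r ⊗[k] P →ₗ[k] MP (rightMC r) :=
    TensorProduct.lift (BalTensor.lift (fun b => r (op b)) (fun b => A.leftMul b)
      (TensorProduct.curry (assocMCP r ∘ₗ σ.lTensor M ∘ₗ
        (TensorProduct.assoc k M P P).toLinearMap)) (fun b m p => by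
        ext q
        change assocMCP r (r (op b) m ⊗ₜ σ (p ⊗ₜ q)) = assocMCP r (m ⊗ₜ σ ((b * p) ⊗ₜ q))
        rw [assocMCP_left]
        -- The section is only `k`-linear, but its class in `C ⊗_B P` depends on the product alone,
        -- and the product is left `B`-linear.
        apply assocMCP_congr
        apply hG.mk_eq_of_mulLast_eq hff
        rw [mulLast_left, hσ, hσ]
        rfl))
  have hρ : ∀ z, ρ (kappa r z) = BalTensor.mk _ _ (z ⊗ₜ 1) := by
    intro z
    refine LinearMap.congr_fun (f := ρ ∘ₗ kappa r)
      (g := BalTensor.mk _ _ ∘ₗ (TensorProduct.mk k _ P).flip 1)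
      (BalTensor.hom_ext fun m X => ?_) z
    have h1 : ∀ z : P ⊗[k] P, ρ ((BalTensor.mk (fun b => r (op b))
        (fun b => A.leftMul b)).rTensor P ((TensorProduct.assoc k M P P).symm (m ⊗ₜ z))) =
        assocMCP r (m ⊗ₜ σ z) := by
      intro z
      induction z using TensorProduct.induction_add with
      | add a c ha hc => simp only [map_add, tmul_add, ha, hc]
      | tmul p q => rfl
    refine (h1 X).trans ?_
    -- On a coinvariant `X` the section may be replaced by `X ⊗ 1`, since both have product `X`.
    refine assocMCP_congr r m (σ X) (X ⊗ₜ 1) (hG.mk_eq_of_mulLast_eq hff _ _ ?_)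
    rw [hσ, LinearMap.rTensor_tmul, Submodule.subtype_apply]
    generalize (X : P ⊗[k] P) = z
    induction z using TensorProduct.induction_add with
    | add a c ha hc => rw [add_tmul, map_add, ← ha, ← hc]
    | tmul p q => simp
  rw [← LinearMap.ker_eq_bot, LinearMap.ker_eq_bot']
  intro z hz
  apply unit_injective (IsFaithfullyFlat.lower.{v, w} hff) (rightMC r) z
  rw [← hρ, hz, map_zero]

/-- If `M` embeds into `V ⊗ P`, then `M ⊗_B C` embeds into `V ⊗ (P ⊗_B P) ⊗ P`. -/
theorem mk_eq_zero_of_incl (hG : A.IsHopfGalois)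
    (hff : IsFaithfullyFlat.{u, w, w, max v w} A.leftMul) {V : Type w} [AddCommGroup V]
    [Module k V] (ι : M →ₗ[k] V ⊗[k] P) (hι : ∀ (b : A.coinvariants) m, ι (r (op b) m) =
      A.rightTensor V (op b) (ι m)) (hinj : Function.Injective ι) (z : M ⊗[k] A.diagCoinv)
    (hz : A.incl V P (TensorProduct.map ι A.diagCoinv.subtype z) = 0) :
    BalTensor.mk (fun b => r (op b)) A.coinvLeft z = 0 := by
  apply kappa_injective r hG hff
  rw [map_zero]
  -- Flatness of `P` over `B` makes `j` injective; the additional leg `P` produced by `kappa` is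
  -- carried along by flatness over the field.
  let j : MP r →ₗ[k] V ⊗[k] A.PP := A.assocPP V ∘ₗ BalTensor.rTensor _ _ _ ι hι
  have hj : Function.Injective j :=
    (Function.LeftInverse.injective (g := A.assocPPInv V) (A.assocPPInv_assocPP V)).comp
      ((IsFaithfullyFlat.lower.{v, w} hff).flat M (V ⊗[k] P) r (A.rightTensor V) ι hι hinj)
  apply Module.Flat.rTensor_preserves_injective_linearMap (M := P) j hj
  rw [map_zero]
  apply (TensorProduct.assoc k V A.PP P).injective
  have h1 : ∀ z : M ⊗[k] A.diagCoinv, TensorProduct.assoc k V A.PP P (j.rTensor P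
      (kappa r (BalTensor.mk (fun b => r (op b)) A.coinvLeft z))) =
      A.incl V P (TensorProduct.map ι A.diagCoinv.subtype z) := by
    intro z
    induction z using TensorProduct.induction_add with
    | add a c ha hc => simp only [map_add, ha, hc]
    | tmul m X =>
      rw [TensorProduct.map_tmul, Submodule.subtype_apply]
      change TensorProduct.assoc k V A.PP P (j.rTensor P ((BalTensor.mk (fun b => r (op b))
        (fun b => A.leftMul b)).rTensor P ((TensorProduct.assoc k M P P).symm (m ⊗ₜ X)))) = _
      generalize (X : P ⊗[k] P) = z
      induction z using TensorProduct.induction_add with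
      | add a c ha hc => simp only [map_add, tmul_add, ha, hc]
      | tmul p q =>
        change TensorProduct.assoc k V A.PP P
          (A.assocPP V (BalTensor.mk _ _ (ι m ⊗ₜ p)) ⊗ₜ q) = _
        generalize ι m = y
        induction y using TensorProduct.induction_add with
        | add a c ha hc => simp only [map_add, add_tmul, ha, hc]
        | tmul v p' => rfl
  rw [h1, hz, map_zero]

end Kappa

end CoquasiComoduleAlgebra

end

noncomputable section

/-! ### Iterated and threefold balanced tensor products -/

/-- An element of `M ⊗ (M ⊗ M)` whose class in `(M ⊗_B M) ⊗_B M` is zero is a combination of the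
relations of `M ⊗_B M ⊗_B M`. -/
theorem BalTensor.mem_balRel₃ {k : Type*} [Field k] {R M : Type*} [Ring R] [Algebra k R]
    [AddCommGroup M] [Module k M] (r : Rᵐᵒᵖ →ₐ[k] Module.End k M) (l : R → M →ₗ[k] M)
    (hs : ∀ a b n, r a (l b n) = l b (r a n)) (z : M ⊗[k] (M ⊗[k] M))
    (hz : BalTensor.mk (fun b => BalTensor.endRight (fun b => r (op b)) l r hs (op b)) l
      ((BalTensor.mk (fun b => r (op b)) l).rTensor M ((TensorProduct.assoc k M M M).symm z)) = 0) :
    z ∈ balRel₃ (fun b => r (op b)) l := by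
  let e : BalTensor (fun b => r (op b)) l →ₗ[k] M →ₗ[k]
      (M ⊗[k] (M ⊗[k] M)) ⧸ balRel₃ (fun b => r (op b)) l :=
    BalTensor.lift (fun b => r (op b)) l
      (TensorProduct.curry ((balRel₃ (fun b => r (op b)) l).mkQ ∘ₗ
        (TensorProduct.assoc k M M M).toLinearMap)) (by
      intro b X Y
      ext Z
      change (balRel₃ (fun b => r (op b)) l).mkQ (r (op b) X ⊗ₜ[k] (Y ⊗ₜ[k] Z)) =
        (balRel₃ (fun b => r (op b)) l).mkQ (X ⊗ₜ[k] (l b Y ⊗ₜ[k] Z))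
      rw [← sub_eq_zero, ← map_sub, Submodule.mkQ_apply, Submodule.Quotient.mk_eq_zero]
      exact Submodule.subset_span (Or.inl ⟨b, X, Y, Z, rfl⟩))
  let e' : BalTensor (fun b => BalTensor.endRight (fun b => r (op b)) l r hs (op b)) l →ₗ[k]
      (M ⊗[k] (M ⊗[k] M)) ⧸ balRel₃ (fun b => r (op b)) l :=
    BalTensor.lift _ _ (TensorProduct.lift e) (by
      intro b m Z
      refine LinearMap.congr_fun
        (f := e.flip Z ∘ₗ BalTensor.endRight (fun b => r (op b)) l r hs (op b))
        (g := e.flip (l b Z)) (BalTensor.hom_ext fun X Y => ?_) m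
      change (balRel₃ (fun b => r (op b)) l).mkQ (X ⊗ₜ[k] (r (op b) Y ⊗ₜ[k] Z)) =
        (balRel₃ (fun b => r (op b)) l).mkQ (X ⊗ₜ[k] (Y ⊗ₜ[k] l b Z))
      rw [← sub_eq_zero, ← map_sub, Submodule.mkQ_apply, Submodule.Quotient.mk_eq_zero]
      exact Submodule.subset_span (Or.inr ⟨b, X, Y, Z, rfl⟩))
  have he : e' ∘ₗ BalTensor.mk _ _ ∘ₗ (BalTensor.mk (fun b => r (op b)) l).rTensor M ∘ₗ
      (TensorProduct.assoc k M M M).symm.toLinearMap = (balRel₃ (fun b => r (op b)) l).mkQ :=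
    TensorProduct.ext_threefold' fun X Y Z => rfl
  rw [← Submodule.Quotient.mk_eq_zero, ← Submodule.mkQ_apply, ← he]
  exact (congrArg e' hz).trans (map_zero _)

namespace CoquasiComoduleAlgebra

open CoalgebraStruct (comul counit)
open HopfAlgebra (antipode)
open TensorProduct

variable {k : Type u} {H : Type v} {P : Type w} [Field k] [Ring H] [HopfAlgebra k H]
  [NonAssocRing P] [Module k P] [IsScalarTower k P P] [SMulCommClass k P P]
  {A : CoquasiComoduleAlgebra k H P}

/-! ### Embedding the balanced tensor powers of the diagonal coinvariants -/

variable (A) in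
/-- `C ⊗ C → P ⊗ (P ⊗_B P) ⊗ P`. -/
abbrev inclC : A.diagCoinv ⊗[k] A.diagCoinv →ₗ[k] P ⊗[k] (A.PP ⊗[k] P) :=
  A.incl P P ∘ₗ TensorProduct.map A.diagCoinv.subtype A.diagCoinv.subtype

/-- The class in `C ⊗_B C`. -/
abbrev mkCC : A.diagCoinv ⊗[k] A.diagCoinv →ₗ[k] MC A.coinvRight :=
  BalTensor.mk (fun b => A.coinvRight (op b)) A.coinvLeft

theorem inclC_balanced (b : A.coinvariants) (X Y : A.diagCoinv) :
    A.inclC (A.coinvRight (op b) X ⊗ₜ Y) = A.inclC (X ⊗ₜ A.coinvLeft b Y) :=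
  incl_balanced b (X : P ⊗[k] P) (Y : P ⊗[k] P)

/-- The nontrivial direction is `mk_eq_zero_of_incl` for `M = C` with its inclusion into `P ⊗ P`. -/
theorem mkCC_eq_zero_iff (hG : A.IsHopfGalois)
    (hff : IsFaithfullyFlat.{u, w, w, max v w} A.leftMul) (z : A.diagCoinv ⊗[k] A.diagCoinv) :
    mkCC z = 0 ↔ A.inclC z = 0 := by
  constructor
  · intro h
    exact (congrArg (BalTensor.lift (fun b => A.coinvRight (op b)) A.coinvLeft A.inclC
      inclC_balanced) h).trans (map_zero _)
  · exact mk_eq_zero_of_incl A.coinvRight hG hff A.diagCoinv.subtype (fun _ _ => rfl)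
      (Submodule.injective_subtype _) z

theorem ker_inclC (hG : A.IsHopfGalois)
    (hff : IsFaithfullyFlat.{u, w, w, max v w} A.leftMul) :
    LinearMap.ker A.inclC = balRel (fun b => A.coinvRight (op b)) A.coinvLeft := by
  ext z
  rw [LinearMap.mem_ker, ← mkCC_eq_zero_iff hG hff, BalTensor.mk_eq_zero]

variable (A) in
/-- `(p ⊗ p') ⊗ ((q ⊗ q') ⊗ (r ⊗ r')) ↦ (p ⊗ (p' ⊗_B q)) ⊗ ((q' ⊗_B r) ⊗ r')`. -/
def incl₃ : (P ⊗[k] P) ⊗[k] ((P ⊗[k] P) ⊗[k] (P ⊗[k] P)) →ₗ[k]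
    (P ⊗[k] A.PP) ⊗[k] (A.PP ⊗[k] P) :=
  A.incl (P ⊗[k] A.PP) P ∘ₗ
    ((TensorProduct.assoc k P A.PP P).symm.toLinearMap ∘ₗ A.incl P P).rTensor (P ⊗[k] P) ∘ₗ
    (TensorProduct.assoc k (P ⊗[k] P) (P ⊗[k] P) (P ⊗[k] P)).symm.toLinearMap

/-- The same embedding principle once more, now with `M = C ⊗_B C`, which by `mkCC_eq_zero_iff` sits
in `(P ⊗ (P ⊗_B P)) ⊗ P`. This is where coassociativity will be tested. -/
theorem mk₃_eq_zero (hG : A.IsHopfGalois)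
    (hff : IsFaithfullyFlat.{u, w, w, max v w} A.leftMul)
    (z : A.diagCoinv ⊗[k] (A.diagCoinv ⊗[k] A.diagCoinv))
    (hz : A.incl₃ (TensorProduct.map A.diagCoinv.subtype
      (TensorProduct.map A.diagCoinv.subtype A.diagCoinv.subtype) z) = 0) :
    z ∈ balRel₃ (fun b => A.coinvRight (op b)) A.coinvLeft := by
  let ι : MC A.coinvRight →ₗ[k] (P ⊗[k] A.PP) ⊗[k] P :=
    (TensorProduct.assoc k P A.PP P).symm.toLinearMap ∘ₗ
      BalTensor.lift (fun b => A.coinvRight (op b)) A.coinvLeft A.inclC inclC_balanced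
  have hinj : Function.Injective ι := by
    refine (TensorProduct.assoc k P A.PP P).symm.injective.comp ?_
    rw [← LinearMap.ker_eq_bot, LinearMap.ker_eq_bot']
    intro y hy
    obtain ⟨y, rfl⟩ := BalTensor.mk_surjective _ _ y
    exact (mkCC_eq_zero_iff hG hff y).2 hy
  have hι : ∀ (b : A.coinvariants) m, ι (rightMC A.coinvRight (op b) m) =
      A.rightTensor (P ⊗[k] A.PP) (op b) (ι m) := by
    intro b m
    refine LinearMap.congr_fun (f := ι ∘ₗ rightMC A.coinvRight (op b))
      (g := A.rightTensor (P ⊗[k] A.PP) (op b) ∘ₗ ι) (BalTensor.hom_ext fun X Y => ?_) m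
    change (TensorProduct.assoc k P A.PP P).symm
      (A.incl P P ((X : P ⊗[k] P) ⊗ₜ (A.actR b).lTensor P (Y : P ⊗[k] P))) =
      A.rightTensor (P ⊗[k] A.PP) (op b) ((TensorProduct.assoc k P A.PP P).symm
      (A.incl P P ((X : P ⊗[k] P) ⊗ₜ (Y : P ⊗[k] P))))
    generalize (X : P ⊗[k] P) = x
    generalize (Y : P ⊗[k] P) = y
    induction x using TensorProduct.induction_add with
    | add a c ha hc => simp only [map_add, add_tmul, ha, hc]
    | tmul p p' =>
      induction y using TensorProduct.induction_add with
      | add a c ha hc => simp only [map_add, tmul_add, ha, hc]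
      | tmul q q' => rfl
  let f : A.diagCoinv ⊗[k] (A.diagCoinv ⊗[k] A.diagCoinv) →ₗ[k]
      MC A.coinvRight ⊗[k] A.diagCoinv :=
    mkCC.rTensor A.diagCoinv ∘ₗ
      (TensorProduct.assoc k A.diagCoinv A.diagCoinv A.diagCoinv).symm.toLinearMap
  have hf : ∀ z, A.incl (P ⊗[k] A.PP) P (TensorProduct.map ι A.diagCoinv.subtype (f z)) =
      A.incl₃ (TensorProduct.map A.diagCoinv.subtype
      (TensorProduct.map A.diagCoinv.subtype A.diagCoinv.subtype) z) := fun z =>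
    LinearMap.congr_fun (f := A.incl (P ⊗[k] A.PP) P ∘ₗ
      TensorProduct.map ι A.diagCoinv.subtype ∘ₗ f) (g := A.incl₃ ∘ₗ TensorProduct.map
      A.diagCoinv.subtype (TensorProduct.map A.diagCoinv.subtype A.diagCoinv.subtype))
      (TensorProduct.ext_threefold' fun X Y Z => rfl) z
  exact BalTensor.mem_balRel₃ A.coinvRight A.coinvLeft coinvRight_coinvLeft z
    (mk_eq_zero_of_incl (rightMC A.coinvRight) hG hff ι hι hinj (f z) ((hf z).trans hz))

/-! ### The translation map -/

variable (A) in
/-- The coaction on the right factor of `P ⊗_B P`. -/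
def coactPP : A.PP →ₗ[k] A.PP ⊗[k] H :=
  BalTensor.lift A.actR A.actL
    (A.mkPP.rTensor H ∘ₗ (TensorProduct.assoc k P P H).symm.toLinearMap ∘ₗ A.coact.lTensor P) (by
    intro b p q
    simp only [LinearMap.comp_apply, LinearMap.lTensor_tmul]
    change _ = A.mkPP.rTensor H ((TensorProduct.assoc k P P H).symm (p ⊗ₜ A.coact (b * q)))
    rw [coact_coinv_mul]
    induction A.coact q using TensorProduct.induction_add with
    | add a c ha hc => simp only [map_add, tmul_add, ha, hc]
    | tmul a h => exact congrArg (fun t => t ⊗ₜ[k] h) (A.mkPP_mul p a b))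

theorem coactPP_mkPP (p q : P) :
    A.coactPP (A.mkPP (p ⊗ₜ q)) = (A.mkPP ∘ₗ TensorProduct.mk k P P p).rTensor H (A.coact q) := by
  change A.mkPP.rTensor H ((TensorProduct.assoc k P P H).symm (p ⊗ₜ A.coact q)) = _
  induction A.coact q using TensorProduct.induction_add with
  | add a c ha hc => simp only [map_add, tmul_add, ha, hc]
  | tmul a h => simp

/-- A form of coassociativity of `coact`. It allows statements about `coactPP`, in particular its
value on `τ`, to be tested after the injective map `can`. -/
theorem can_rTensor_coactPP (m : A.PP) :
    A.can.rTensor H (A.coactPP m) =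
      (TensorProduct.assoc k P H H).symm ((comul (R := k)).lTensor P (A.can m)) := by
  induction m using BalTensor.induction_on with
  | add a c ha hc => simp only [map_add, ha, hc]
  | tmul p q =>
    rw [coactPP_mkPP, can_mkPP]
    have h1 : ∀ z : P ⊗[k] H, A.can.rTensor H ((A.mkPP ∘ₗ TensorProduct.mk k P P p).rTensor H z) =
        ((LinearMap.mul k P p).rTensor H).rTensor H (A.coact.rTensor H z) := by
      intro z
      induction z using TensorProduct.induction_add with
      | add a c ha hc => simp only [map_add, ha, hc]
      | tmul a h =>
        simp only [LinearMap.rTensor_tmul, LinearMap.comp_apply, mk_apply, can_mkPP]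
    have h2 : A.coact.rTensor H (A.coact q) =
        (TensorProduct.assoc k P H H).symm ((comul (R := k)).lTensor P (A.coact q)) := by
      rw [← A.coact_coassoc, LinearEquiv.symm_apply_apply]
    rw [h1, h2]
    induction A.coact q using TensorProduct.induction_add with
    | add a c ha hc => simp only [map_add, ha, hc]
    | tmul a h =>
      simp only [LinearMap.lTensor_tmul, LinearMap.rTensor_tmul]
      induction comul (R := k) h using TensorProduct.induction_add with
      | add a c ha hc => simp only [map_add, tmul_add, ha, hc]
      | tmul g h => simp

theorem IsHopfGalois.can_τ (hG : A.IsHopfGalois) (h : H) : A.can (hG.τ h) = 1 ⊗ₜ h :=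
  (LinearEquiv.ofBijective A.can hG).apply_symm_apply (1 ⊗ₜ h)

theorem IsHopfGalois.eq_τ (hG : A.IsHopfGalois) (m : A.PP) (h : H) (hm : A.can m = 1 ⊗ₜ h) :
    m = hG.τ h := hG.1 (by rw [hm, hG.can_τ])

theorem IsHopfGalois.coactPP_τ (hG : A.IsHopfGalois) (h : H) :
    A.coactPP (hG.τ h) = hG.τ.rTensor H (comul (R := k) h) := by
  apply Module.Flat.rTensor_preserves_injective_linearMap (M := H) A.can hG.1
  rw [can_rTensor_coactPP, hG.can_τ, LinearMap.lTensor_tmul]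
  induction comul (R := k) h using TensorProduct.induction_add with
  | add a c ha hc => simp only [map_add, tmul_add, ha, hc]
  | tmul g h => simp [hG.can_τ]

theorem IsHopfGalois.τ_one (hG : A.IsHopfGalois) : hG.τ 1 = A.mkPP (1 ⊗ₜ 1) := by
  symm
  apply hG.eq_τ
  rw [can_mkPP, A.coact_one]
  simp

/-- `p ↦ p₀ ⊗ τ(p₁)`. -/
def IsHopfGalois.coactτ (hG : A.IsHopfGalois) : P →ₗ[k] P ⊗[k] A.PP := hG.τ.lTensor P ∘ₗ A.coact

theorem IsHopfGalois.esComul_tmul (hG : A.IsHopfGalois) (p q : P) :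
    hG.esComul (p ⊗ₜ q) = TensorProduct.assoc k P A.PP P (hG.coactτ p ⊗ₜ q) := by
  simp only [esComul, coactτ, LinearMap.comp_apply, LinearMap.rTensor_tmul]
  induction A.coact p using TensorProduct.induction_add with
  | add a c ha hc => simp only [map_add, add_tmul, ha, hc]
  | tmul g h => simp

/-- `p₀ ⊗ τ(p₁)₀ ⊗ τ(p₁)₁ = p₀ ⊗ τ(p₁) ⊗ p₂`. -/
theorem IsHopfGalois.coactPP_coactτ (hG : A.IsHopfGalois) (p : P) :
    (TensorProduct.assoc k P A.PP H).symm (A.coactPP.lTensor P (hG.coactτ p)) =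
      hG.coactτ.rTensor H (A.coact p) := by
  have h1 : ∀ z : P ⊗[k] H, hG.coactτ.rTensor H z =
      (hG.τ.lTensor P).rTensor H (A.coact.rTensor H z) := by
    intro z
    rw [coactτ, LinearMap.rTensor_comp_apply]
  have h2 : A.coact.rTensor H (A.coact p) =
      (TensorProduct.assoc k P H H).symm ((comul (R := k)).lTensor P (A.coact p)) := by
    rw [← A.coact_coassoc, LinearEquiv.symm_apply_apply]
  rw [h1, h2, coactτ, LinearMap.comp_apply]
  induction A.coact p using TensorProduct.induction_add with
  | add a c ha hc => simp only [map_add, ha, hc]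
  | tmul a h =>
    simp only [LinearMap.lTensor_tmul, hG.coactPP_τ]
    induction comul (R := k) h using TensorProduct.induction_add with
    | add a c ha hc => simp only [map_add, tmul_add, ha, hc]
    | tmul g h => simp

/-! ### Existence of the coproduct -/

/-- Descent of membership in a submodule along `m ↦ m ⊗_B 1`. -/
theorem mem_range_of_mk_eq (hff : IsFaithfullyFlat.{u, w, w, w} A.leftMul)
    {M M₁ : Type w} [AddCommGroup M] [Module k M] [AddCommGroup M₁] [Module k M₁]
    (r : A.coinvariantsᵐᵒᵖ →ₐ[k] Module.End k M) (j : M₁ →ₗ[k] M)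
    (hj : ∀ a y, r a (j y) ∈ LinearMap.range j) (n : M₁ ⊗[k] P) (m : M)
    (hmn : BalTensor.mk (fun b => r (op b)) (fun b => A.leftMul b) (j.rTensor P n) =
      BalTensor.mk (fun b => r (op b)) (fun b => A.leftMul b) (m ⊗ₜ 1)) :
    m ∈ LinearMap.range j := by
  have hN : ∀ a, ∀ y ∈ LinearMap.range j, r a y ∈ LinearMap.range j := by
    rintro a _ ⟨y, rfl⟩
    exact hj a y
  -- Pass to the quotient of `M` by the range of `j`: there `m ⊗_B 1` becomes zero, hence so does
  -- `m`.
  rw [← Submodule.Quotient.mk_eq_zero, ← Submodule.mkQ_apply]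
  apply unit_injective hff (quotientEnd r _ hN)
  have h1 := congrArg (BalTensor.rTensor (fun b => r (op b))
    (fun b => quotientEnd r _ hN (op b)) (fun b => A.leftMul b)
    (LinearMap.range j).mkQ (fun b m => (quotientEnd_mkQ r _ hN (op b) m).symm)) hmn
  refine h1.symm.trans ?_
  rw [BalTensor.rTensor_mk, ← LinearMap.rTensor_comp_apply, LinearMap.range_mkQ_comp,
    LinearMap.rTensor_zero, LinearMap.zero_apply, map_zero]

/-- Apply `can` to the last two legs. By `gal_eq_diagCoact` the left side becomes the diagonal
coaction of `p ⊗ 1`, namely `p₀ ⊗ 1 ⊗ p₁`, which is also the image of `p₀ ⊗ τ(p₁)`. Thus a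
factorisation of `p ⊗ 1` over `C` is a concrete representative of `p₀ ⊗ τ(p₁)`. -/
theorem IsHopfGalois.mkPP_section (hG : A.IsHopfGalois) (p : P) (t : A.diagCoinv ⊗[k] P)
    (ht : A.mulLast (A.diagCoinv.subtype.rTensor P t) = p ⊗ₜ 1) :
    A.mkPP.lTensor P (TensorProduct.assoc k P P P (A.diagCoinv.subtype.rTensor P t)) =
      hG.coactτ p := by
  apply Module.Flat.lTensor_preserves_injective_linearMap (M := P) A.can hG.1
  refine (A.gal_eq_diagCoact t).trans ?_
  rw [ht, diagCoact_tmul, A.coact_one, coactτ, LinearMap.comp_apply]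
  induction A.coact p using TensorProduct.induction_add with
  | add a c ha hc => simp only [map_add, LinearMap.add_apply, ha, hc]
  | tmul a h => simp [hG.can_τ]

theorem canTensor_pair (x : P ⊗[k] P) (t : (P ⊗[k] P) ⊗[k] P) :
    A.canTensor (P ⊗[k] A.PP) (BalTensor.mk _ _
      (((TensorProduct.assoc k P A.PP P).symm.toLinearMap ∘ₗ A.incl P P).rTensor P
        ((TensorProduct.assoc k (P ⊗[k] P) (P ⊗[k] P) P).symm (x ⊗ₜ t)))) =
      (A.mkPP.lTensor P ∘ₗ (TensorProduct.assoc k P P P).toLinearMap ∘ₗ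
        TensorProduct.mk k _ P x).rTensor (P ⊗[k] H) (A.gal t) := by
  induction t using TensorProduct.induction_add with
  | add a c ha hc => simp only [map_add, tmul_add, ha, hc]
  | tmul y s =>
    induction y using TensorProduct.induction_add with
    | add a c ha hc => simp only [map_add, tmul_add, add_tmul, ha, hc]
    | tmul c c' =>
      rw [gal_tmul, LinearMap.rTensor_tmul]
      induction x using TensorProduct.induction_add with
      | add a c ha hc =>
        simp only [map_add, add_tmul, ha, hc, LinearMap.comp_add, LinearMap.add_apply]
      | tmul a a' => exact A.canTensor_mk (a ⊗ₜ A.mkPP (a' ⊗ₜ c)) c' s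

theorem collect_rTensor {V V' W : Type*} [AddCommGroup V] [Module k V] [AddCommGroup V']
    [Module k V'] [AddCommGroup W] [Module k W] (f : V →ₗ[k] W) (a : V ⊗[k] H) (c : V' ⊗[k] H) :
    collect (f.rTensor H a) c = f.rTensor (V' ⊗[k] H) (collect a c) := by
  induction a using TensorProduct.induction_add with
  | add a a' ha hc => simp only [map_add, LinearMap.add_apply, ha, hc]
  | tmul a h =>
    induction c using TensorProduct.induction_add with
    | add a a' ha hc => simp only [map_add, ha, hc]
    | tmul c g => simp

theorem mkPP_coact (x : P ⊗[k] P) (s : P) :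
    (A.mkPP.lTensor P ∘ₗ (TensorProduct.assoc k P P P).toLinearMap ∘ₗ
        TensorProduct.mk k _ P x).rTensor H (A.coact s) =
      (TensorProduct.assoc k P A.PP H).symm (A.coactPP.lTensor P
        (A.mkPP.lTensor P (TensorProduct.assoc k P P P (x ⊗ₜ s)))) := by
  induction x using TensorProduct.induction_add with
  | add a c ha hc =>
    simp only [map_add, add_tmul, LinearMap.comp_add, LinearMap.rTensor_add,
      LinearMap.add_apply, ha, hc]
  | tmul a a' =>
    simp only [TensorProduct.assoc_tmul, LinearMap.lTensor_tmul]
    erw [coactPP_mkPP]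
    induction A.coact s using TensorProduct.induction_add with
    | add a c ha hc => simp only [map_add, tmul_add, ha, hc]
    | tmul p h => simp

variable (A) in
/-- The embedding of `C ⊗_B C` with values in `(P ⊗ (P ⊗_B P)) ⊗ P`. -/
def inclC' : A.diagCoinv ⊗[k] A.diagCoinv →ₗ[k] (P ⊗[k] A.PP) ⊗[k] P :=
  ((TensorProduct.assoc k P A.PP P).symm.toLinearMap ∘ₗ A.incl P P) ∘ₗ
    TensorProduct.map A.diagCoinv.subtype A.diagCoinv.subtype

theorem inclC'_right (a : A.coinvariantsᵐᵒᵖ) (y : A.diagCoinv ⊗[k] A.diagCoinv) :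
    A.rightTensor (P ⊗[k] A.PP) a (A.inclC' y) = A.inclC' ((A.coinvRight a).lTensor _ y) := by
  induction y using TensorProduct.induction_add with
  | add a c ha hc => simp only [map_add, ha, hc]
  | tmul Y Z =>
    change A.rightTensor (P ⊗[k] A.PP) a ((TensorProduct.assoc k P A.PP P).symm
      (A.incl P P ((Y : P ⊗[k] P) ⊗ₜ (Z : P ⊗[k] P)))) = (TensorProduct.assoc k P A.PP P).symm
      (A.incl P P ((Y : P ⊗[k] P) ⊗ₜ (A.actR a.unop).lTensor P (Z : P ⊗[k] P)))
    generalize (Y : P ⊗[k] P) = x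
    generalize (Z : P ⊗[k] P) = y
    induction x using TensorProduct.induction_add with
    | add a c ha hc => simp only [map_add, add_tmul, ha, hc]
    | tmul p p' =>
      induction y using TensorProduct.induction_add with
      | add a c ha hc => simp only [map_add, tmul_add, ha, hc]
      | tmul q q' => rfl

theorem canTensor_inclC' (X : A.diagCoinv) (t : A.diagCoinv ⊗[k] P) :
    A.canTensor (P ⊗[k] A.PP) (BalTensor.mk _ _ (A.inclC'.rTensor P
      ((TensorProduct.assoc k A.diagCoinv A.diagCoinv P).symm (X ⊗ₜ t)))) =
      (A.mkPP.lTensor P ∘ₗ (TensorProduct.assoc k P P P).toLinearMap ∘ₗ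
        TensorProduct.mk k _ P (X : P ⊗[k] P)).rTensor (P ⊗[k] H)
          (A.gal (A.diagCoinv.subtype.rTensor P t)) := by
  rw [← canTensor_pair]
  congr 2
  induction t using TensorProduct.induction_add with
  | add a c ha hc => simp only [map_add, tmul_add, ha, hc]
  | tmul Z s => rfl

theorem IsHopfGalois.canTensor_esComul (hG : A.IsHopfGalois) (z : P ⊗[k] P) :
    A.canTensor (P ⊗[k] A.PP) (BalTensor.mk _ _
      ((TensorProduct.assoc k P A.PP P).symm (hG.esComul z) ⊗ₜ 1)) =
      hG.coactτ.rTensor (P ⊗[k] H) (A.diagTriv z) := by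
  induction z using TensorProduct.induction_add with
  | add a c ha hc => simp only [map_add, add_tmul, ha, hc]
  | tmul p q =>
    rw [hG.esComul_tmul, LinearEquiv.symm_apply_apply, diagTriv_tmul, canTensor_mk,
      A.coact_one]
    simp

/-- `p ⊗ q ↦ X ⊗ (Y ⊗ t)`, where `p ⊗ 1 = x ⊗ x' s` and `s ⊗ q = y ⊗ y' t`. -/
def comulLift (σ : P ⊗[k] P →ₗ[k] A.diagCoinv ⊗[k] P) :
    P ⊗[k] P →ₗ[k] (A.diagCoinv ⊗[k] A.diagCoinv) ⊗[k] P :=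
  (TensorProduct.assoc k A.diagCoinv A.diagCoinv P).symm.toLinearMap ∘ₗ
    σ.lTensor A.diagCoinv ∘ₗ (TensorProduct.assoc k A.diagCoinv P P).toLinearMap ∘ₗ
    (σ ∘ₗ (TensorProduct.mk k P P).flip 1).rTensor P

/-- The inner factorisation turns `s ⊗ q` into its diagonal coaction, and by `coactPP_coactτ` the
coaction of `s` is a further coaction of `p`. The candidate therefore becomes `p₀ ⊗ τ(p₁) ⊗ q₀ ⊗
p₂q₁`. -/
theorem canTensor_comulLift (hG : A.IsHopfGalois) (σ : P ⊗[k] P →ₗ[k] A.diagCoinv ⊗[k] P)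
    (hσ : ∀ y, A.mulLast (A.diagCoinv.subtype.rTensor P (σ y)) = y) (z : P ⊗[k] P) :
    A.canTensor (P ⊗[k] A.PP) (BalTensor.mk _ _ (A.inclC'.rTensor P (comulLift σ z))) =
      hG.coactτ.rTensor (P ⊗[k] H) (A.diagCoact z) := by
  induction z using TensorProduct.induction_add with
  | add a c ha hc => simp only [map_add, ha, hc]
  | tmul p q =>
    have h1 : ∀ t : A.diagCoinv ⊗[k] P, A.canTensor (P ⊗[k] A.PP) (BalTensor.mk _ _
        (A.inclC'.rTensor P ((TensorProduct.assoc k A.diagCoinv A.diagCoinv P).symm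
          (σ.lTensor A.diagCoinv (TensorProduct.assoc k A.diagCoinv P P (t ⊗ₜ q)))))) =
        collect ((TensorProduct.assoc k P A.PP H).symm (A.coactPP.lTensor P
          (A.mkPP.lTensor P (TensorProduct.assoc k P P P (A.diagCoinv.subtype.rTensor P t)))))
          (A.coact q) := by
      intro t
      induction t using TensorProduct.induction_add with
      | add a c ha hc => simp only [map_add, LinearMap.add_apply, add_tmul, ha, hc]
      | tmul Y s =>
        rw [TensorProduct.assoc_tmul, LinearMap.lTensor_tmul, canTensor_inclC',
          gal_eq_diagCoact, hσ, diagCoact_tmul, ← collect_rTensor, mkPP_coact]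
        rfl
    have h3 := h1 (σ (p ⊗ₜ 1))
    rw [hG.mkPP_section p _ (hσ _), hG.coactPP_coactτ, collect_rTensor, ← diagCoact_tmul] at h3
    exact h3

/-- For a coinvariant `X` the element `p₀ ⊗ τ(p₁) ⊗ q₀ ⊗ p₂q₁` is `p₀ ⊗ τ(p₁) ⊗ q ⊗ 1`, so
`comulLift` represents `esComul X ⊗_B 1`; faithful flatness removes the factor `1`. -/
theorem IsHopfGalois.exists_comul (hG : A.IsHopfGalois)
    (hff : IsFaithfullyFlat.{u, w, w, max v w} A.leftMul) (X : A.diagCoinv) :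
    ∃ z : A.diagCoinv ⊗[k] A.diagCoinv, A.inclC z = hG.esComul X := by
  obtain ⟨σ, hσ⟩ := hG.exists_section hff
  obtain ⟨z, hz⟩ := mem_range_of_mk_eq (IsFaithfullyFlat.lower.{v, w} hff)
    (A.rightTensor (P ⊗[k] A.PP)) A.inclC' (fun a y => ⟨_, (inclC'_right a y).symm⟩)
    (comulLift σ X) ((TensorProduct.assoc k P A.PP P).symm (hG.esComul X)) (by
      apply hG.canTensor_injective (P ⊗[k] A.PP)
      rw [hG.canTensor_esComul, canTensor_comulLift hG σ hσ,
        show A.diagCoact X = A.diagTriv X from X.2])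
  exact ⟨z, (TensorProduct.assoc k P A.PP P).symm.injective hz⟩

/-! ### The associativity constraint on diagonal coinvariants -/

variable (A) in
/-- `h ⊗ g ↦ f ↦ φ(f, g, h)`. -/
def φrev : H ⊗[k] H →ₗ[k] H →ₗ[k] P :=
  TensorProduct.lift (LinearMap.lflip.toLinearMap ∘ₗ (LinearMap.lflip.toLinearMap ∘ₗ A.φ).flip)

@[simp]
theorem φrev_tmul (h g f : H) : A.φrev (h ⊗ₜ g) f = A.φ f g h := rfl

variable (A) in
/-- `(p ⊗ h, q ⊗ g, r ⊗ f) ↦ ((p q) r) φ(f, g, h)`. -/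
def reassoc : P ⊗[k] H →ₗ[k] P ⊗[k] H →ₗ[k] P ⊗[k] H →ₗ[k] P :=
  (TensorProduct.map₂ (LinearMap.mul k P) (TensorProduct.mk k H H)).compr₂
    ((TensorProduct.map₂ (LinearMap.mul k P) A.φrev).compr₂ (LinearMap.mul' k P))

@[simp]
theorem reassoc_tmul (p q r : P) (h g f : H) :
    A.reassoc (p ⊗ₜ h) (q ⊗ₜ g) (r ⊗ₜ f) = ((p * q) * r) * A.φ f g h := by
  simp [reassoc]

theorem mul_mul_eq_reassoc (p q r : P) :
    p * (q * r) = A.reassoc (A.coact p) (A.coact q) (A.coact r) := by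
  obtain ⟨x⟩ := TensorRepr.nonempty (A.coact p)
  obtain ⟨y⟩ := TensorRepr.nonempty (A.coact q)
  obtain ⟨z⟩ := TensorRepr.nonempty (A.coact r)
  rw [A.assoc p q r x y z]
  conv_rhs => rw [← x.sum_eq, ← y.sum_eq, ← z.sum_eq]
  rw [map_sum A.reassoc, LinearMap.sum_apply, LinearMap.sum_apply]
  refine Finset.sum_congr rfl fun i _ => ?_
  rw [map_sum (A.reassoc _), LinearMap.sum_apply]
  refine Finset.sum_congr rfl fun j _ => ?_
  rw [map_sum]
  exact Finset.sum_congr rfl fun l _ => (reassoc_tmul _ _ _ _ _ _).symm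

theorem coact_mul' (z : P ⊗[k] P) :
    A.coact (LinearMap.mul' k P z) = (LinearMap.mul' k P).rTensor H (A.diagCoact' z) := by
  induction z using TensorProduct.induction_add with
  | add a c ha hc => simp only [map_add, ha, hc]
  | tmul p q =>
    rw [diagCoact'_tmul, LinearMap.mul'_apply, A.coact_mul]
    generalize A.coact p = a
    generalize A.coact q = b
    induction a using TensorProduct.induction_add with
    | add a c ha hc => simp only [map_add, LinearMap.add_apply, add_mul, ha, hc]
    | tmul p h =>
      induction b using TensorProduct.induction_add with
      | add a c ha hc => simp only [map_add, mul_add, ha, hc]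
      | tmul q g => simp

theorem mul'_mem (X : A.diagCoinv) : LinearMap.mul' k P (X : P ⊗[k] P) ∈ A.coinvariants := by
  change A.coact _ = _
  rw [coact_mul', diagCoact', LinearMap.comp_apply, show A.diagCoact X = A.diagTriv X from X.2]
  generalize (X : P ⊗[k] P) = z
  induction z using TensorProduct.induction_add with
  | add a c ha hc => simp only [map_add, add_tmul, ha, hc]
  | tmul p q => simp

section MulH

variable {V V' : Type*} [AddCommGroup V] [Module k V] [AddCommGroup V'] [Module k V']

/-- `h ↦ (q ⊗ g ↦ q ⊗ h g)`. -/
def mulH : H →ₗ[k] V ⊗[k] H →ₗ[k] V ⊗[k] H := LinearMap.lTensorHom V ∘ₗ LinearMap.mul k H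

@[simp]
theorem mulH_tmul (h g : H) (q : V) : mulH (k := k) h (q ⊗ₜ g) = q ⊗ₜ (h * g) := rfl

theorem mulH_mul (h g : H) (z : V ⊗[k] H) : mulH (k := k) (h * g) z = mulH h (mulH g z) := by
  induction z using TensorProduct.induction_add with
  | add a c ha hc => simp only [map_add, ha, hc]
  | tmul p q => simp [mul_assoc]

theorem mulH_one (z : V ⊗[k] H) : mulH (k := k) (1 : H) z = z := by
  induction z using TensorProduct.induction_add with
  | add a c ha hc => rw [map_add, ha, hc]
  | tmul q g => simp

theorem collect_tmul_left (a : V) (h : H) (z : V' ⊗[k] H) :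
    collect (a ⊗ₜ h) z = a ⊗ₜ mulH (k := k) h z := by
  induction z using TensorProduct.induction_add with
  | add a c ha hc => simp only [map_add, tmul_add, ha, hc]
  | tmul q g => simp

end MulH

variable (A) in
/-- `p ⊗ (q ⊗ g) ↦ (p₀ ⊗ p₁) ⊗ (q ⊗ S(p₂) g)`. -/
def antipodeTwist : P ⊗[k] (P ⊗[k] H) →ₗ[k] (P ⊗[k] H) ⊗[k] (P ⊗[k] H) :=
  (TensorProduct.lift (mulH ∘ₗ antipode k)).lTensor (P ⊗[k] H) ∘ₗ
    (TensorProduct.assoc k (P ⊗[k] H) H (P ⊗[k] H)).toLinearMap ∘ₗ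
    (A.coact.rTensor H ∘ₗ A.coact).rTensor (P ⊗[k] H)

theorem coact_coassoc_symm (p : P) : A.coact.rTensor H (A.coact p) =
    (TensorProduct.assoc k P H H).symm ((comul (R := k)).lTensor P (A.coact p)) := by
  rw [← A.coact_coassoc, LinearEquiv.symm_apply_apply]

/-- The factor `S(p₂) p₃` cancels, so the twist recovers the two separate coactions from the
diagonal one. -/
theorem antipodeTwist_diagCoact (z : P ⊗[k] P) :
    A.antipodeTwist (A.diagCoact z) = TensorProduct.map A.coact A.coact z := by
  induction z using TensorProduct.induction_add with
  | add a c ha hc => simp only [map_add, ha, hc]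
  | tmul p q =>
    rw [diagCoact_tmul, TensorProduct.map_tmul]
    generalize A.coact q = z
    let G : P ⊗[k] (H ⊗[k] H) →ₗ[k] (P ⊗[k] H) ⊗[k] (P ⊗[k] H) :=
      TensorProduct.map A.coact (mulH.flip z ∘ₗ LinearMap.mul' k H ∘ₗ (antipode k).rTensor H)
    have h1 : ∀ w : P ⊗[k] H, A.antipodeTwist (collect w z) =
        G (TensorProduct.assoc k P H H (A.coact.rTensor H w)) := by
      intro w
      induction w using TensorProduct.induction_add with
      | add a c ha hc => simp only [map_add, LinearMap.add_apply, ha, hc]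
      | tmul a h =>
        rw [collect_tmul_left]
        simp only [antipodeTwist, LinearMap.comp_apply, LinearMap.rTensor_tmul]
        induction A.coact a using TensorProduct.induction_add with
        | add a c ha hc => simp only [map_add, add_tmul, ha, hc]
        | tmul b g => simp [G, mulH_mul]
    rw [h1, A.coact_coassoc]
    conv_rhs => rw [← A.coact_counit p]
    induction A.coact p using TensorProduct.induction_add with
    | add a c ha hc => simp only [map_add, add_tmul, ha, hc]
    | tmul a h =>
      have h3 := LinearMap.congr_fun (HopfAlgebra.mul_antipode_rTensor_comul (R := k) (A := H)) h
      simp only [LinearMap.comp_apply] at h3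
      simp only [G, LinearMap.lTensor_tmul, TensorProduct.map_tmul, LinearMap.comp_apply, h3]
      simp [Algebra.algebraMap_eq_smul_one, mulH_one, ← smul_tmul']

/-- For a coinvariant the twist may be evaluated on the trivial coaction, which gives `p₀ ⊗ p₁ ⊗ q₀
⊗ q₁ = p₀ ⊗ p₁ ⊗ q ⊗ S(p₂)`. This is how the antipode enters the arguments of `φ`. -/
theorem map_coact_eq (X : A.diagCoinv) : TensorProduct.map A.coact A.coact X =
    A.antipodeTwist (A.diagTriv X) := by
  rw [← antipodeTwist_diagCoact, show A.diagCoact X = A.diagTriv X from X.2]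

theorem antipodeTwist_diagTriv (p q : P) : A.antipodeTwist (A.diagTriv (p ⊗ₜ q)) =
    TensorProduct.map (LinearMap.id) (TensorProduct.mk k P H q ∘ₗ antipode k)
      ((TensorProduct.assoc k P H H).symm ((comul (R := k)).lTensor P (A.coact p))) := by
  rw [← coact_coassoc_symm, diagTriv_tmul]
  simp only [antipodeTwist, LinearMap.comp_apply, LinearMap.rTensor_tmul]
  generalize A.coact.rTensor H (A.coact p) = t
  induction t using TensorProduct.induction_add with
  | add a c ha hc => simp only [map_add, add_tmul, ha, hc]
  | tmul b g => simp

/-- Re-bracketing gives `a (p p') = ((a₀ p₀) p') φ(S(p₂), p₁, a₁)` by `map_coact_eq`, and `hφ₁`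
collapses the `φ`-factor. -/
theorem mul_mul'_coinv (hφ₁ : ∀ (h g : H) (x : TensorRepr (comul (R := k) h)),
      ∑ i, A.φ (antipode k (x.snd i)) (x.fst i) g = counit (R := k) (h * g) • (1 : P))
    (a : P) (X : A.diagCoinv) :
    a * LinearMap.mul' k P X = LinearMap.mul' k P ((LinearMap.mul k P a).rTensor P X) := by
  have h1 : ∀ z : P ⊗[k] P, a * LinearMap.mul' k P z =
      TensorProduct.lift (A.reassoc (A.coact a)) (TensorProduct.map A.coact A.coact z) := by
    intro z
    induction z using TensorProduct.induction_add with
    | add a c ha hc => simp only [map_add, mul_add, ha, hc]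
    | tmul p q =>
      change a * (p * q) = _
      rw [mul_mul_eq_reassoc (A := A), TensorProduct.map_tmul, lift.tmul]
  rw [h1, map_coact_eq]
  generalize (X : P ⊗[k] P) = z
  induction z using TensorProduct.induction_add with
  | add a c ha hc => simp only [map_add, ha, hc]
  | tmul p q =>
    rw [antipodeTwist_diagTriv]
    simp only [LinearMap.rTensor_tmul, LinearMap.mul'_apply, LinearMap.mul_apply']
    conv_rhs => rw [← A.coact_counit a, ← A.coact_counit p]
    generalize A.coact p = t
    induction t using TensorProduct.induction_add with
    | add a c ha hc => simp only [map_add, add_mul, mul_add, ha, hc]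
    | tmul p h =>
      obtain ⟨x⟩ := TensorRepr.nonempty (comul (R := k) h)
      simp only [LinearMap.lTensor_tmul]
      conv_lhs => rw [← x.sum_eq]
      simp only [tmul_sum, map_sum, TensorProduct.assoc_symm_tmul, TensorProduct.map_tmul,
        lift.tmul, LinearMap.id_apply, LinearMap.comp_apply, mk_apply]
      generalize A.coact a = s
      induction s using TensorProduct.induction_add with
      | add a c ha hc =>
        simp only [map_add, add_mul, LinearMap.add_apply, Finset.sum_add_distrib, ha, hc]
      | tmul a g =>
        simp only [reassoc_tmul, ← Finset.mul_sum, hφ₁, Bialgebra.counit_mul,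
          LinearMap.lTensor_tmul, rid_tmul, mul_smul_comm, smul_mul_assoc, mul_one, smul_smul]

/-- Re-bracketing gives `p (p' a) = ((p₀ p') a₀) φ(a₁, S(p₂), p₁)` by `map_coact_eq`, and `hφ₂`
collapses the `φ`-factor. -/
theorem mul'_coinv_mul (hφ₂ : ∀ (h g : H) (x : TensorRepr (comul (R := k) h)),
      ∑ i, A.φ g (antipode k (x.snd i)) (x.fst i) = counit (R := k) (h * g) • (1 : P))
    (a : P) (X : A.diagCoinv) :
    LinearMap.mul' k P X * a =
      LinearMap.mul' k P (((LinearMap.mul k P).flip a).lTensor P X) := by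
  have h1 : ∀ z : P ⊗[k] P, LinearMap.mul' k P (((LinearMap.mul k P).flip a).lTensor P z) =
      TensorProduct.lift (A.reassoc.compr₂ (LinearMap.applyₗ (A.coact a)))
        (TensorProduct.map A.coact A.coact z) := by
    intro z
    induction z using TensorProduct.induction_add with
    | add a c ha hc => simp only [map_add, ha, hc]
    | tmul p q =>
      change p * (q * a) = _
      rw [mul_mul_eq_reassoc (A := A), TensorProduct.map_tmul, lift.tmul]
      rfl
  rw [h1, map_coact_eq]
  generalize (X : P ⊗[k] P) = z
  induction z using TensorProduct.induction_add with
  | add a c ha hc => simp only [map_add, add_mul, ha, hc]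
  | tmul p q =>
    rw [antipodeTwist_diagTriv]
    simp only [LinearMap.mul'_apply]
    conv_lhs => rw [← A.coact_counit a, ← A.coact_counit p]
    generalize A.coact p = t
    induction t using TensorProduct.induction_add with
    | add a c ha hc => simp only [map_add, add_mul, ha, hc]
    | tmul p h =>
      obtain ⟨x⟩ := TensorRepr.nonempty (comul (R := k) h)
      simp only [LinearMap.lTensor_tmul]
      conv_rhs => rw [← x.sum_eq]
      simp only [tmul_sum, map_sum, TensorProduct.assoc_symm_tmul, TensorProduct.map_tmul,
        lift.tmul, LinearMap.id_apply, LinearMap.comp_apply, mk_apply, LinearMap.compr₂_apply,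
        LinearMap.applyₗ_apply_apply]
      generalize A.coact a = s
      induction s using TensorProduct.induction_add with
      | add a c ha hc => simp only [map_add, mul_add, Finset.sum_add_distrib, ha, hc]
      | tmul a g =>
        simp only [reassoc_tmul, ← Finset.mul_sum, hφ₂, Bialgebra.counit_mul,
          LinearMap.lTensor_tmul, rid_tmul, mul_smul_comm, smul_mul_assoc, mul_one, smul_smul]
        rw [mul_comm]

/-! ### The standing assumptions -/

variable (A) in
/-- `B ⊆ P` is a faithfully flat coquasi-Hopf–Galois extension, and diagonal coinvariants `p ⊗ p'`
satisfy `a (p p') = (a p) p'` and `(p p') a = p (p' a)`. -/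
structure IsAdmissible : Prop where
  galois : A.IsHopfGalois
  flat : IsFaithfullyFlat.{u, w, w, max v w} A.leftMul
  left : ∀ (a : P) (X : A.diagCoinv),
    a * LinearMap.mul' k P X = LinearMap.mul' k P ((LinearMap.mul k P a).rTensor P X)
  right : ∀ (a : P) (X : A.diagCoinv),
    LinearMap.mul' k P X * a = LinearMap.mul' k P (((LinearMap.mul k P).flip a).lTensor P X)

/-! ### Products with the two factors of `P ⊗_B P` -/

variable (A) in
/-- The product `p ⊗_B q ↦ p q`. -/
def mulPP : A.PP →ₗ[k] P :=
  BalTensor.lift A.actR A.actL (LinearMap.mul' k P) (fun b p q => A.mul_assoc_mid p q b)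

variable (A) in
/-- `c·(p ⊗_B q) = c p ⊗_B q`. -/
def mulLeftPP : P →ₗ[k] A.PP →ₗ[k] A.PP where
  toFun c := BalTensor.rTensor A.actR A.actR A.actL (LinearMap.mul k P c)
    (fun b p => (A.mul_assoc_right c p b).symm)
  map_add' a c := BalTensor.hom_ext fun p q => by
    change A.mkPP (((a + c) * p) ⊗ₜ q) = A.mkPP ((a * p) ⊗ₜ q) + A.mkPP ((c * p) ⊗ₜ q)
    rw [add_mul, add_tmul, map_add]
  map_smul' a c := BalTensor.hom_ext fun p q => by
    change A.mkPP (((a • c) * p) ⊗ₜ q) = a • A.mkPP ((c * p) ⊗ₜ q)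
    rw [smul_mul_assoc, ← smul_tmul', map_smul]

@[simp]
theorem mulLeftPP_mkPP (c p q : P) :
    A.mulLeftPP c (A.mkPP (p ⊗ₜ q)) = A.mkPP ((c * p) ⊗ₜ q) := rfl

@[simp]
theorem mulRightPP_mkPP (p q r : P) :
    A.mulRightPP (A.mkPP (p ⊗ₜ q)) r = A.mkPP (p ⊗ₜ (q * r)) := rfl

theorem can_mulLeftPP (c : P) (m : A.PP) :
    A.can (A.mulLeftPP c m) = (A.mulPP ∘ₗ A.mulLeftPP c).rTensor H (A.coactPP m) := by
  induction m using BalTensor.induction_on with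
  | add a c ha hc => simp only [map_add, ha, hc]
  | tmul p q =>
    rw [mulLeftPP_mkPP, can_mkPP, coactPP_mkPP, ← LinearMap.rTensor_comp_apply]
    rfl

theorem can_mulRightPP (m : A.PP) (q : P) :
    A.can (A.mulRightPP m q) = TensorProduct.map₂ (A.mulRightPP.compr₂ A.mulPP)
      (LinearMap.mul k H) (A.coactPP m) (A.coact q) := by
  induction m using BalTensor.induction_on with
  | add a c ha hc => simp only [map_add, LinearMap.add_apply, ha, hc]
  | tmul x y =>
    rw [mulRightPP_mkPP, can_mkPP, coactPP_mkPP, A.coact_mul]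
    generalize A.coact y = s
    generalize A.coact q = t
    induction s using TensorProduct.induction_add with
    | add a c ha hc => simp only [map_add, add_mul, LinearMap.add_apply, ha, hc]
    | tmul y h =>
      induction t using TensorProduct.induction_add with
      | add a c ha hc => simp only [map_add, mul_add, ha, hc]
      | tmul q g =>
        simp only [LinearMap.rTensor_tmul, map₂_apply_tmul, TensorProduct.map_tmul,
          Algebra.TensorProduct.tmul_mul_tmul]
        rfl

theorem rTensor_comul_of_counit {V : Type*} [AddCommGroup V] [Module k V] (f : H →ₗ[k] V) (c : V)
    (hf : ∀ h, f h = counit (R := k) h • c) (h : H) : f.rTensor H (comul (R := k) h) = c ⊗ₜ h := by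
  have : f = LinearMap.toSpanSingleton k V c ∘ₗ counit := LinearMap.ext hf
  rw [this, LinearMap.rTensor_comp_apply, Coalgebra.rTensor_counit_comul]
  simp

/-! ### Cancellation rules and multiplicativity of the translation map -/

namespace IsAdmissible

variable (hA : A.IsAdmissible)

/-- The translation map. -/
abbrev τ : H →ₗ[k] A.PP := hA.galois.τ

/-- Two linear maps on `P ⊗ H` agree if they agree on the elements `a p₀ ⊗ p₁`. -/
theorem ext_can (hA : A.IsAdmissible) {V : Type*} [AddCommGroup V] [Module k V] {f g : P ⊗[k] H →ₗ[k] V}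
    (h : ∀ a p, f ((LinearMap.mul k P a).rTensor H (A.coact p)) =
      g ((LinearMap.mul k P a).rTensor H (A.coact p))) : f = g := by
  ext1
  have h1 : f ∘ₗ A.can = g ∘ₗ A.can := BalTensor.hom_ext fun a p => by
    rw [LinearMap.comp_apply, LinearMap.comp_apply, can_mkPP, h]
  refine LinearMap.ext fun c => LinearMap.ext fun x => ?_
  obtain ⟨m, hm⟩ := hA.galois.2 (c ⊗ₜ x)
  simpa [hm] using LinearMap.congr_fun h1 m

/-- `((a x) x') s = a (x (x' s))` for diagonal coinvariants `x ⊗ x'`. -/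
theorem mulPP_section (hA : A.IsAdmissible) (a : P) (t : A.diagCoinv ⊗[k] P) :
    TensorProduct.lift (A.mulLeftPP.compr₂ A.mulPP ∘ₗ LinearMap.mul k P a)
      (A.mkPP.lTensor P (TensorProduct.assoc k P P P (A.diagCoinv.subtype.rTensor P t))) =
      a * LinearMap.mul' k P (A.mulLast (A.diagCoinv.subtype.rTensor P t)) := by
  induction t using TensorProduct.induction_add with
  | add a c ha hc => simp only [map_add, mul_add, ha, hc]
  | tmul X s =>
    have h1 : ∀ z : P ⊗[k] P,
        TensorProduct.lift (A.mulLeftPP.compr₂ A.mulPP ∘ₗ LinearMap.mul k P a)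
          (A.mkPP.lTensor P (TensorProduct.assoc k P P P (z ⊗ₜ s))) =
        LinearMap.mul' k P ((LinearMap.mul k P a).rTensor P z) * s := by
      intro z
      induction z using TensorProduct.induction_add with
      | add a c ha hc => simp only [map_add, add_tmul, add_mul, ha, hc]
      | tmul p q => rfl
    have h2 : ∀ z : P ⊗[k] P, LinearMap.mul' k P (A.mulLast (z ⊗ₜ s)) =
        LinearMap.mul' k P (((LinearMap.mul k P).flip s).lTensor P z) := by
      intro z
      induction z using TensorProduct.induction_add with
      | add a c ha hc => simp only [map_add, add_tmul, ha, hc]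
      | tmul p q => simp
    -- Now `(a x) x' = a (x x')` and `x (x' s) = (x x') s`; what remains is associativity around `x
    -- x'`, which lies in `B`.
    rw [LinearMap.rTensor_tmul, Submodule.subtype_apply, h1, h2, ← hA.left, ← hA.right]
    exact A.mul_assoc_mid a s ⟨_, mul'_mem X⟩

/-- `(c x) y = ε(h) c` for `τ(h) = x ⊗_B y`. -/
theorem mulPP_mulLeftPP_τ (c : P) (h : H) :
    A.mulPP (A.mulLeftPP c (hA.τ h)) = counit (R := k) h • c := by
  obtain ⟨σ, hσ⟩ := hA.galois.exists_section hA.flat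
  have key : TensorProduct.lift (A.mulLeftPP.compr₂ A.mulPP) ∘ₗ hA.τ.lTensor P =
      (TensorProduct.rid k P).toLinearMap ∘ₗ (counit (R := k)).lTensor P := by
    refine hA.ext_can fun a p => ?_
    -- Since the factorisation of `p ⊗ 1` represents `p₀ ⊗ τ(p₁)`, this reads `((a p₀) x) y = a p`
    -- with `τ(p₁) = x ⊗_B y`. By the Galois property the elements `a p₀ ⊗ p₁` span `P ⊗ H`.
    have h1 := hA.mulPP_section a (σ (p ⊗ₜ 1))
    rw [hA.galois.mkPP_section p _ (hσ _), hσ, LinearMap.mul'_apply, mul_one] at h1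
    have h2 : a * p = (TensorProduct.rid k P) ((counit (R := k)).lTensor P
        ((LinearMap.mul k P a).rTensor H (A.coact p))) := by
      conv_lhs => rw [← A.coact_counit p]
      induction A.coact p using TensorProduct.induction_add with
      | add a c ha hc => simp only [map_add, mul_add, ha, hc]
      | tmul p h => simp [mul_smul_comm]
    refine Eq.trans ?_ (h1.trans h2)
    simp only [IsHopfGalois.coactτ, LinearMap.comp_apply]
    induction A.coact p using TensorProduct.induction_add with
    | add a c ha hc => simp only [map_add, ha, hc]
    | tmul p h => rfl
  exact LinearMap.congr_fun key (c ⊗ₜ h)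

theorem mulPP_τ (h : H) : A.mulPP (hA.τ h) = counit (R := k) h • (1 : P) := by
  rw [← hA.mulPP_mulLeftPP_τ]
  congr 1
  induction hA.τ h using BalTensor.induction_on with
  | add a c ha hc => rw [map_add, ← ha, ← hc]
  | tmul p q => rw [mulLeftPP_mkPP, one_mul]

/-- Without associativity of `P`, left `P`-linearity of `can` is not automatic; on the values of `τ`
it follows from the cancellation rule and `coactPP_τ`. -/
theorem can_mulLeftPP_τ (c : P) (h : H) : A.can (A.mulLeftPP c (hA.τ h)) = c ⊗ₜ h := by
  rw [can_mulLeftPP, hA.galois.coactPP_τ]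
  rw [← LinearMap.rTensor_comp_apply]
  exact rTensor_comul_of_counit _ c (hA.mulPP_mulLeftPP_τ c) h

/-- `a ⊗ (m ⊗ c) ↦ a ⊗ m c s`, evaluated on the coproduct. -/
theorem mulRight_inclC (hA : A.IsAdmissible) (s : P) (z : A.diagCoinv ⊗[k] A.diagCoinv) :
    (TensorProduct.lift ((A.mulRightPP.compr₂ A.mulPP).compl₂ ((LinearMap.mul k P).flip s))).lTensor
        P (A.inclC z) =
      ((LinearMap.mul k P).flip s).lTensor P
        ((TensorProduct.lift (LinearMap.mul k P ∘ₗ A.mulPP)).lTensor P (A.inclC z)) := by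
  induction z using TensorProduct.induction_add with
  | add a c ha hc => simp only [map_add, ha, hc]
  | tmul X Y =>
    simp only [LinearMap.comp_apply, TensorProduct.map_tmul, Submodule.subtype_apply]
    generalize (X : P ⊗[k] P) = x
    induction x using TensorProduct.induction_add with
    | add a c ha hc => simp only [map_add, add_tmul, ha, hc]
    | tmul a a' =>
      have h1 : ∀ y : P ⊗[k] P, (TensorProduct.lift ((A.mulRightPP.compr₂ A.mulPP).compl₂
          ((LinearMap.mul k P).flip s))).lTensor P (A.incl P P ((a ⊗ₜ a') ⊗ₜ y)) =
          a ⊗ₜ (a' * LinearMap.mul' k P (((LinearMap.mul k P).flip s).lTensor P y)) := by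
        intro y
        induction y using TensorProduct.induction_add with
        | add a c ha hc => simp only [map_add, tmul_add, mul_add, ha, hc]
        | tmul c c' => rfl
      have h2 : ∀ y : P ⊗[k] P, (TensorProduct.lift (LinearMap.mul k P ∘ₗ A.mulPP)).lTensor P
          (A.incl P P ((a ⊗ₜ a') ⊗ₜ y)) =
          a ⊗ₜ LinearMap.mul' k P ((LinearMap.mul k P a').rTensor P y) := by
        intro y
        induction y using TensorProduct.induction_add with
        | add a c ha hc => simp only [map_add, tmul_add, ha, hc]
        | tmul c c' => rfl
      -- The chain is `a' (c (c' s)) = a' ((c c') s) = (a' (c c')) s = ((a' c) c') s`, with `c c'`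
      -- in `B` for the middle step.
      rw [h1, h2, ← hA.right, ← hA.left, LinearMap.lTensor_tmul]
      congr 1
      exact (A.mul_assoc_mid a' s ⟨_, mul'_mem Y⟩).symm

/-- `p₀ ⊗ ε(p₁) q = p ⊗ q`, with the counit computed by `τ`. -/
theorem mulPP_esComul (z : P ⊗[k] P) :
    (TensorProduct.lift (LinearMap.mul k P ∘ₗ A.mulPP)).lTensor P (hA.galois.esComul z) = z := by
  induction z using TensorProduct.induction_add with
  | add a c ha hc => rw [map_add, map_add, ha, hc]
  | tmul p q =>
    conv_rhs => rw [← A.coact_counit p]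
    simp only [IsHopfGalois.esComul, LinearMap.comp_apply, LinearMap.rTensor_tmul]
    induction A.coact p using TensorProduct.induction_add with
    | add a c ha hc => simp only [map_add, add_tmul, ha, hc]
    | tmul p h => simp [hA.mulPP_τ, ← smul_tmul']

/-- `p₀ ⊗ x (y q) = p ⊗ q` for `τ(p₁) = x ⊗_B y`. -/
theorem mulRight_coact (y : P ⊗[k] P) :
    (TensorProduct.lift (A.mulRightPP.compr₂ A.mulPP ∘ₗ hA.τ)).lTensor P
      (TensorProduct.assoc k P H P (A.coact.rTensor P y)) = y := by
  obtain ⟨σ, hσ⟩ := hA.galois.exists_section hA.flat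
  -- By the section, `P ⊗ P` is spanned by products of a coinvariant with some `s`. The coinvariant
  -- has a coproduct in `C ⊗ C`, along which `mulRight_inclC` pulls `s` out.
  rw [← hσ y]
  generalize σ y = t
  induction t using TensorProduct.induction_add with
  | add a c ha hc => simp only [map_add, ha, hc]
  | tmul X s =>
    have h1 : ∀ z : P ⊗[k] P, A.mulLast (z ⊗ₜ s) = ((LinearMap.mul k P).flip s).lTensor P z := by
      intro z
      induction z using TensorProduct.induction_add with
      | add a c ha hc => simp only [map_add, add_tmul, ha, hc]
      | tmul p q => simp
    have h2 : ∀ z : P ⊗[k] P,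
        (TensorProduct.lift (A.mulRightPP.compr₂ A.mulPP ∘ₗ hA.τ)).lTensor P
          (TensorProduct.assoc k P H P (A.coact.rTensor P
            (((LinearMap.mul k P).flip s).lTensor P z))) =
        (TensorProduct.lift ((A.mulRightPP.compr₂ A.mulPP).compl₂
          ((LinearMap.mul k P).flip s))).lTensor P (hA.galois.esComul z) := by
      intro z
      induction z using TensorProduct.induction_add with
      | add a c ha hc => simp only [map_add, ha, hc]
      | tmul p q =>
        simp only [IsHopfGalois.esComul, LinearMap.comp_apply, LinearMap.rTensor_tmul,
          LinearMap.lTensor_tmul]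
        induction A.coact p using TensorProduct.induction_add with
        | add a c ha hc => simp only [map_add, add_tmul, ha, hc]
        | tmul p h => rfl
    obtain ⟨z, hz⟩ := hA.galois.exists_comul hA.flat X
    rw [LinearMap.rTensor_tmul, Submodule.subtype_apply, h1, h2, ← hz, hA.mulRight_inclC, hz,
      hA.mulPP_esComul]

/-- `x (y q) = ε(h) q` for `τ(h) = x ⊗_B y`. -/
theorem mulPP_mulRightPP_τ (h : H) (q : P) :
    A.mulPP (A.mulRightPP (hA.τ h) q) = counit (R := k) h • q := by
  have key : ((A.mulRightPP.compr₂ A.mulPP).flip q ∘ₗ hA.τ).lTensor P =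
      (LinearMap.toSpanSingleton k P q ∘ₗ counit).lTensor P := by
    refine hA.ext_can fun a p => ?_
    have h1 : ∀ t : P ⊗[k] H, ((A.mulRightPP.compr₂ A.mulPP).flip q ∘ₗ hA.τ).lTensor P
        ((LinearMap.mul k P a).rTensor H t) = (LinearMap.mul k P a).rTensor P
        ((TensorProduct.lift (A.mulRightPP.compr₂ A.mulPP ∘ₗ hA.τ)).lTensor P
          (TensorProduct.assoc k P H P (t ⊗ₜ q))) := by
      intro t
      induction t using TensorProduct.induction_add with
      | add a c ha hc => simp only [map_add, add_tmul, ha, hc]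
      | tmul p h => rfl
    have h2 := hA.mulRight_coact (p ⊗ₜ q)
    rw [LinearMap.rTensor_tmul] at h2
    rw [h1, h2]
    conv_lhs => rw [← A.coact_counit p]
    induction A.coact p using TensorProduct.induction_add with
    | add a c ha hc => simp only [map_add, add_tmul, ha, hc]
    | tmul p h => simp [← smul_tmul']
  have h3 := congrArg (LinearMap.mul' k P) (LinearMap.congr_fun key (1 ⊗ₜ h))
  simpa using h3

theorem can_mulRightPP_τ (h : H) (q : P) :
    A.can (A.mulRightPP (hA.τ h) q) = mulH h (A.coact q) := by
  rw [can_mulRightPP, hA.galois.coactPP_τ]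
  induction A.coact q using TensorProduct.induction_add with
  | add a c ha hc => simp only [map_add, ha, hc]
  | tmul q g =>
    have h1 : ∀ u : H ⊗[k] H, TensorProduct.map₂ (A.mulRightPP.compr₂ A.mulPP)
        (LinearMap.mul k H) (hA.τ.rTensor H u) (q ⊗ₜ g) = ((LinearMap.mul k H).flip g).lTensor P
        (((A.mulRightPP.compr₂ A.mulPP).flip q ∘ₗ hA.τ).rTensor H u) := by
      intro u
      induction u using TensorProduct.induction_add with
      | add a c ha hc => simp only [map_add, LinearMap.add_apply, ha, hc]
      | tmul p h => simp
    rw [h1, rTensor_comul_of_counit _ q (fun h => hA.mulPP_mulRightPP_τ h q)]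
    simp

/-- The Ehresmann–Schauenburg space consists of the diagonal coinvariants. -/
theorem ES_eq : hA.galois.ES = A.diagCoinv := by
  -- Applying `can` to the `P ⊗_B P` leg turns the equation defining `ES` into the one defining
  -- `diagCoinv`, and `can` is injective.
  have h1 : ∀ z : P ⊗[k] P, A.can.lTensor P (hA.galois.esMap z) = A.diagCoact z := by
    intro z
    induction z using TensorProduct.induction_add with
    | add a c ha hc => simp only [map_add, ha, hc]
    | tmul p q =>
      rw [diagCoact_tmul]
      simp only [IsHopfGalois.esMap, LinearMap.comp_apply, LinearMap.rTensor_tmul]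
      induction A.coact p using TensorProduct.induction_add with
      | add a c ha hc => simp only [map_add, add_tmul, LinearMap.add_apply, ha, hc]
      | tmul p h =>
        rw [collect_tmul_left, ← hA.can_mulRightPP_τ]
        rfl
  have h2 : ∀ z : P ⊗[k] P, A.can.lTensor P (hA.galois.esTriv z) = A.diagTriv z := by
    intro z
    induction z using TensorProduct.induction_add with
    | add a c ha hc => simp only [map_add, ha, hc]
    | tmul p q =>
      change p ⊗ₜ A.can (A.mkPP (q ⊗ₜ 1)) = p ⊗ₜ (q ⊗ₜ 1)
      rw [can_mkPP, A.coact_one]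
      simp
  ext z
  rw [mem_diagCoinv, ← h1, ← h2, (Module.Flat.lTensor_preserves_injective_linearMap (M := P) A.can
    hA.galois.1).eq_iff]
  rfl

/-- Both sides have image `b ⊗ h` under `can`. This makes `sandwich` well defined and is the reason
for the Takeuchi condition. -/
theorem mulLeftPP_τ_coinv (b : A.coinvariants) (h : H) :
    A.mulLeftPP b (hA.τ h) = A.mulRightPP (hA.τ h) b := by
  apply hA.galois.1
  rw [hA.can_mulLeftPP_τ, hA.can_mulRightPP_τ, A.coact_coinv, mulH_tmul, mul_one]

/-- `τ(h) y = y₀·τ(h y₁)`. -/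
theorem mulRightPP_τ (h : H) (y : P) : A.mulRightPP (hA.τ h) y =
    TensorProduct.lift (A.mulLeftPP.compl₂ hA.τ) (mulH h (A.coact y)) := by
  apply hA.galois.1
  rw [hA.can_mulRightPP_τ]
  generalize mulH h (A.coact y) = t
  induction t using TensorProduct.induction_add with
  | add a c ha hc => rw [map_add, map_add, ← ha, ← hc]
  | tmul p h => rw [lift.tmul, LinearMap.compl₂_apply, hA.can_mulLeftPP_τ]

theorem mulLeftPP_mulLeftPP_coinv (c : P) (b : A.coinvariants) (m : A.PP) :
    A.mulLeftPP (c * b) m = A.mulLeftPP c (A.mulLeftPP b m) := by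
  induction m using BalTensor.induction_on with
  | add a c ha hc => simp only [map_add, ha, hc]
  | tmul p q => simp only [mulLeftPP_mkPP, A.mul_assoc_mid]

theorem mulLeftPP_coinv_mulLeftPP (c : P) (b : A.coinvariants) (m : A.PP) :
    A.mulLeftPP (b * c) m = A.mulLeftPP b (A.mulLeftPP c m) := by
  induction m using BalTensor.induction_on with
  | add a c ha hc => simp only [map_add, ha, hc]
  | tmul p q => simp only [mulLeftPP_mkPP, A.mul_assoc_left]

theorem mulRightPP_coinv_mul (m : A.PP) (b : A.coinvariants) (c : P) :
    A.mulRightPP m (b * c) = A.mulRightPP (A.mulRightPP m b) c := by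
  induction m using BalTensor.induction_on with
  | add a c ha hc => simp only [map_add, LinearMap.add_apply, ha, hc]
  | tmul p q => simp only [mulRightPP_mkPP, A.mul_assoc_mid]

theorem mulLeftPP_mulRightPP (c r : P) (m : A.PP) :
    A.mulLeftPP c (A.mulRightPP m r) = A.mulRightPP (A.mulLeftPP c m) r := by
  induction m using BalTensor.induction_on with
  | add a c ha hc => simp only [map_add, LinearMap.add_apply, ha, hc]
  | tmul p q => rfl

/-- `h ↦ (x ⊗_B y ↦ x·τ(h)·y)`. -/
def sandwich (h : H) : A.PP →ₗ[k] A.PP :=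
  BalTensor.lift A.actR A.actL
    (TensorProduct.lift (A.mulLeftPP.flip.flip.compl₂ (A.mulRightPP (hA.τ h)))) (by
    intro b x y
    change A.mulLeftPP (x * b) (A.mulRightPP (hA.τ h) y) =
      A.mulLeftPP x (A.mulRightPP (hA.τ h) (b * y))
    rw [mulLeftPP_mulLeftPP_coinv, mulRightPP_coinv_mul, mulLeftPP_mulRightPP (b : P) y,
      hA.mulLeftPP_τ_coinv])

theorem sandwich_mkPP (h : H) (x y : P) :
    hA.sandwich h (A.mkPP (x ⊗ₜ y)) = A.mulLeftPP x (A.mulRightPP (hA.τ h) y) := rfl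

variable (A) in
/-- `x ⊗_B y ↦ (m ↦ x·(y·m))`. -/
def mulLeftTwice : A.PP →ₗ[k] A.PP →ₗ[k] A.PP :=
  BalTensor.lift A.actR A.actL
    (TensorProduct.lift ((LinearMap.llcomp k A.PP A.PP A.PP).compl₁₂ A.mulLeftPP A.mulLeftPP)) (by
    intro b x y
    refine LinearMap.ext fun m => ?_
    change A.mulLeftPP (x * b) (A.mulLeftPP y m) = A.mulLeftPP x (A.mulLeftPP (b * y) m)
    rw [mulLeftPP_mulLeftPP_coinv, mulLeftPP_coinv_mulLeftPP])

/-- The rule `x (y u) = ε(h) u`, applied to the left leg `u` of `m`. -/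
theorem mulLeftTwice_τ (h : H) (m : A.PP) :
    mulLeftTwice A (hA.τ h) m = counit (R := k) h • m := by
  induction m using BalTensor.induction_on with
  | add a c ha hc => simp only [map_add, smul_add, ha, hc]
  | tmul u v =>
    rw [← map_smul, smul_tmul', ← hA.mulPP_mulRightPP_τ]
    induction hA.τ h using BalTensor.induction_on with
    | add a c ha hc => simp only [map_add, LinearMap.add_apply, add_tmul, ha, hc]
    | tmul x y => rfl

/-- `x x' ⊗_B y' y = τ(h g)` for `τ(g) = x ⊗_B y` and `τ(h) = x' ⊗_B y'`. -/
theorem sandwich_τ (h g : H) : hA.sandwich h (hA.τ g) = hA.τ (h * g) := by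
  -- Replacing `τ(h) y` by `y₀·τ(h y₁)` turns the sandwich into `x·(y₀·τ(h y₁))`. On `τ(g)`, with
  -- the coaction given by `coactPP_τ`, this is `ε(g₁) τ(h g₂)`.
  have h1 : ∀ m : A.PP, hA.sandwich h m = TensorProduct.lift ((mulLeftTwice A).compl₂
      (hA.τ ∘ₗ LinearMap.mul k H h)) (A.coactPP m) := by
    intro m
    induction m using BalTensor.induction_on with
    | add a c ha hc => simp only [map_add, ha, hc]
    | tmul x y =>
      rw [sandwich_mkPP, hA.mulRightPP_τ, coactPP_mkPP]
      induction A.coact y using TensorProduct.induction_add with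
      | add a c ha hc => simp only [map_add, ha, hc]
      | tmul y g => rfl
  rw [h1, hA.galois.coactPP_τ]
  have h2 := Coalgebra.rTensor_counit_comul (R := k) g
  have h3 : ∀ u : H ⊗[k] H, TensorProduct.lift ((mulLeftTwice A).compl₂
      (hA.τ ∘ₗ LinearMap.mul k H h)) (hA.τ.rTensor H u) =
      hA.τ (h * TensorProduct.lid k H ((counit (R := k)).rTensor H u)) := by
    intro u
    induction u using TensorProduct.induction_add with
    | add a c ha hc => simp only [map_add, mul_add, ha, hc]
    | tmul a c => simp [hA.mulLeftTwice_τ]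
  rw [h3, h2, lid_tmul, one_smul]

end IsAdmissible

/-! ### Tensors over the translation map -/

namespace IsAdmissible

variable (hA : A.IsAdmissible)

section Represents

variable {V V' V₁ V₁' V₂ V₂' : Type*} [AddCommGroup V] [Module k V] [AddCommGroup V'] [Module k V']
  [AddCommGroup V₁] [Module k V₁] [AddCommGroup V₁'] [Module k V₁']
  [AddCommGroup V₂] [Module k V₂] [AddCommGroup V₂'] [Module k V₂']

/-- `t = ∑ (v ⊗ x) ⊗ (y ⊗ v')` lifts `w = ∑ v ⊗ (h ⊗ v')` if
`∑ v ⊗ (x ⊗_B y) ⊗ v' = ∑ v ⊗ τ(h) ⊗ v'`. -/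
def Lifts (t : (V ⊗[k] P) ⊗[k] (P ⊗[k] V')) (w : V ⊗[k] (H ⊗[k] V')) : Prop :=
  A.incl V V' t = (hA.τ.rTensor V').lTensor V w

/-- `(h, m) ↦ x·τ(h)·y` for `m = x ⊗_B y`, as a bilinear map. -/
def sandwichₗ : H →ₗ[k] A.PP →ₗ[k] A.PP where
  toFun := hA.sandwich
  map_add' g h := BalTensor.hom_ext fun x y => by
    simp only [LinearMap.add_apply, sandwich_mkPP, map_add]
  map_smul' c h := BalTensor.hom_ext fun x y => by
    simp only [LinearMap.smul_apply, sandwich_mkPP, map_smul, RingHom.id_apply]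

variable (A) in
/-- `(m, x ⊗ y) ↦ x·m·y`. -/
def sandwichPP : A.PP →ₗ[k] P ⊗[k] P →ₗ[k] A.PP :=
  (TensorProduct.lift
    ((LinearMap.llcomp k A.PP A.PP A.PP).compl₁₂ A.mulLeftPP A.mulRightPP.flip)).flip

/-- `(v ⊗ x) ⊗ (y ⊗ v') ↦ v ⊗ ((x ⊗ y) ⊗ v')`. -/
def regroup : (V ⊗[k] P) ⊗[k] (P ⊗[k] V') →ₗ[k] V ⊗[k] ((P ⊗[k] P) ⊗[k] V') :=
  ((TensorProduct.assoc k P P V').symm.toLinearMap).lTensor V ∘ₗ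
    (TensorProduct.assoc k V P (P ⊗[k] V')).toLinearMap

/-- The middle legs multiply to `x₂ x₁ ⊗_B y₁ y₂ = x₂·(x₁ ⊗_B y₁)·y₂`, so only the class of `t₁`
matters. Once that class is a value of `τ`, the next two lemmas show that only the class of `t₂`
matters too. -/
theorem incl_mul (F : V₁ →ₗ[k] V₂ →ₗ[k] V) (G : V₁' →ₗ[k] V₂' →ₗ[k] V')
    (t₁ : (V₁ ⊗[k] P) ⊗[k] (P ⊗[k] V₁')) (t₂ : (V₂ ⊗[k] P) ⊗[k] (P ⊗[k] V₂')) :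
    A.incl V V' (TensorProduct.map₂ (TensorProduct.map₂ F (LinearMap.mul k P).flip)
      (TensorProduct.map₂ (LinearMap.mul k P) G) t₁ t₂) =
    TensorProduct.map₂ F (TensorProduct.map₂ (sandwichPP A) G) (A.incl V₁ V₁' t₁)
      (regroup t₂) := by
  induction t₁ using TensorProduct.induction_add with
  | add a c ha hc => simp only [map_add, LinearMap.add_apply, ha, hc]
  | tmul x y =>
    induction x using TensorProduct.induction_add with
    | add a c ha hc => simp only [map_add, add_tmul, LinearMap.add_apply, ha, hc]
    | tmul v₁ x₁ =>
      induction y using TensorProduct.induction_add with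
      | add a c ha hc => simp only [map_add, tmul_add, LinearMap.add_apply, ha, hc]
      | tmul y₁ v₁' =>
        induction t₂ using TensorProduct.induction_add with
        | add a c ha hc => simp only [map_add, ha, hc]
        | tmul x y =>
          induction x using TensorProduct.induction_add with
          | add a c ha hc => simp only [map_add, add_tmul, ha, hc]
          | tmul v₂ x₂ =>
            induction y using TensorProduct.induction_add with
            | add a c ha hc => simp only [map_add, tmul_add, ha, hc]
            | tmul y₂ v₂' => rfl

theorem map₂_sandwichPP_τ (F : V₁ →ₗ[k] V₂ →ₗ[k] V) (G : V₁' →ₗ[k] V₂' →ₗ[k] V')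
    (w₁ : V₁ ⊗[k] (H ⊗[k] V₁')) (t₂ : (V₂ ⊗[k] P) ⊗[k] (P ⊗[k] V₂')) :
    TensorProduct.map₂ F (TensorProduct.map₂ (sandwichPP A) G)
      ((hA.τ.rTensor V₁').lTensor V₁ w₁) (regroup t₂) =
    TensorProduct.map₂ F (TensorProduct.map₂ hA.sandwichₗ G) w₁ (A.incl V₂ V₂' t₂) := by
  induction w₁ using TensorProduct.induction_add with
  | add a c ha hc => simp only [map_add, LinearMap.add_apply, ha, hc]
  | tmul v₁ y =>
    induction y using TensorProduct.induction_add with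
    | add a c ha hc => simp only [map_add, tmul_add, LinearMap.add_apply, ha, hc]
    | tmul h v₁' =>
      induction t₂ using TensorProduct.induction_add with
      | add a c ha hc => simp only [map_add, ha, hc]
      | tmul x y =>
        induction x using TensorProduct.induction_add with
        | add a c ha hc => simp only [map_add, add_tmul, ha, hc]
        | tmul v₂ x₂ =>
          induction y using TensorProduct.induction_add with
          | add a c ha hc => simp only [map_add, tmul_add, ha, hc]
          | tmul y₂ v₂' => rfl

theorem map₂_sandwichₗ_τ (F : V₁ →ₗ[k] V₂ →ₗ[k] V) (G : V₁' →ₗ[k] V₂' →ₗ[k] V')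
    (w₁ : V₁ ⊗[k] (H ⊗[k] V₁')) (w₂ : V₂ ⊗[k] (H ⊗[k] V₂')) :
    TensorProduct.map₂ F (TensorProduct.map₂ hA.sandwichₗ G) w₁
      ((hA.τ.rTensor V₂').lTensor V₂ w₂) =
    (hA.τ.rTensor V').lTensor V
      (TensorProduct.map₂ F (TensorProduct.map₂ (LinearMap.mul k H) G) w₁ w₂) := by
  induction w₁ using TensorProduct.induction_add with
  | add a c ha hc => simp only [map_add, LinearMap.add_apply, ha, hc]
  | tmul v₁ y =>
    induction y using TensorProduct.induction_add with
    | add a c ha hc => simp only [map_add, tmul_add, LinearMap.add_apply, ha, hc]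
    | tmul h v₁' =>
      induction w₂ using TensorProduct.induction_add with
      | add a c ha hc => simp only [map_add, ha, hc]
      | tmul v₂ y =>
        induction y using TensorProduct.induction_add with
        | add a c ha hc => simp only [map_add, tmul_add, ha, hc]
        | tmul g v₂' =>
          simp only [map₂_apply_tmul, TensorProduct.map_tmul, LinearMap.lTensor_tmul,
            LinearMap.rTensor_tmul, LinearMap.mul_apply', ← hA.sandwich_τ]
          rfl

-- In the middle this is `sandwich_τ`. The bilinear maps `F` and `G` on the outer legs are
-- arbitrary, so each outer side can be bracketed at will; the bracketing of the middle legs is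
-- dictated by the order in which the lifts are multiplied.
variable {hA} in
theorem Lifts.mul {t₁ : (V₁ ⊗[k] P) ⊗[k] (P ⊗[k] V₁')} {t₂ : (V₂ ⊗[k] P) ⊗[k] (P ⊗[k] V₂')}
    {w₁ : V₁ ⊗[k] (H ⊗[k] V₁')} {w₂ : V₂ ⊗[k] (H ⊗[k] V₂')} (h₁ : hA.Lifts t₁ w₁)
    (h₂ : hA.Lifts t₂ w₂) (F : V₁ →ₗ[k] V₂ →ₗ[k] V) (G : V₁' →ₗ[k] V₂' →ₗ[k] V') :
    hA.Lifts (TensorProduct.map₂ (TensorProduct.map₂ F (LinearMap.mul k P).flip)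
      (TensorProduct.map₂ (LinearMap.mul k P) G) t₁ t₂)
      (TensorProduct.map₂ F (TensorProduct.map₂ (LinearMap.mul k H) G) w₁ w₂) := by
  unfold Lifts at *
  rw [incl_mul, h₁, hA.map₂_sandwichPP_τ, h₂, hA.map₂_sandwichₗ_τ]

/-- `v ⊗ (h ⊗ v') ↦ v ⊗ ε(h) v'`. -/
def counitMid : V ⊗[k] (H ⊗[k] V') →ₗ[k] V ⊗[k] V' :=
  ((TensorProduct.lid k V').toLinearMap ∘ₗ (counit (R := k)).rTensor V').lTensor V

@[simp]
theorem counitMid_tmul (v : V) (h : H) (v' : V') :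
    counitMid (k := k) (v ⊗ₜ (h ⊗ₜ v')) = v ⊗ₜ (counit (R := k) h • v') := by
  simp [counitMid]

theorem counitMid_mul (F : V₁ →ₗ[k] V₂ →ₗ[k] V) (G : V₁' →ₗ[k] V₂' →ₗ[k] V')
    (w₁ : V₁ ⊗[k] (H ⊗[k] V₁')) (w₂ : V₂ ⊗[k] (H ⊗[k] V₂')) :
    counitMid (TensorProduct.map₂ F (TensorProduct.map₂ (LinearMap.mul k H) G) w₁ w₂) =
      TensorProduct.map₂ F G (counitMid w₁) (counitMid w₂) := by
  induction w₁ using TensorProduct.induction_add with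
  | add a c ha hc => simp only [map_add, LinearMap.add_apply, ha, hc]
  | tmul v₁ y =>
    induction y using TensorProduct.induction_add with
    | add a c ha hc => simp only [map_add, tmul_add, LinearMap.add_apply, ha, hc]
    | tmul h v₁' =>
      induction w₂ using TensorProduct.induction_add with
      | add a c ha hc => simp only [map_add, ha, hc]
      | tmul v₂ y =>
        induction y using TensorProduct.induction_add with
        | add a c ha hc => simp only [map_add, tmul_add, ha, hc]
        | tmul g v₂' => simp [smul_smul, mul_comm]

/-- `t` collapses to `z` if it lifts some `∑ v ⊗ (h ⊗ v')` with `z = ∑ v ⊗ ε(h) v'`. -/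
def Collapses (t : (V ⊗[k] P) ⊗[k] (P ⊗[k] V')) (z : V ⊗[k] V') : Prop :=
  ∃ w, hA.Lifts t w ∧ counitMid w = z

variable {hA} in
theorem Collapses.mul {t₁ : (V₁ ⊗[k] P) ⊗[k] (P ⊗[k] V₁')}
    {t₂ : (V₂ ⊗[k] P) ⊗[k] (P ⊗[k] V₂')} {z₁ : V₁ ⊗[k] V₁'} {z₂ : V₂ ⊗[k] V₂'}
    (h₁ : hA.Collapses t₁ z₁) (h₂ : hA.Collapses t₂ z₂)
    (F : V₁ →ₗ[k] V₂ →ₗ[k] V) (G : V₁' →ₗ[k] V₂' →ₗ[k] V') :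
    hA.Collapses (TensorProduct.map₂ (TensorProduct.map₂ F (LinearMap.mul k P).flip)
      (TensorProduct.map₂ (LinearMap.mul k P) G) t₁ t₂) (TensorProduct.map₂ F G z₁ z₂) := by
  obtain ⟨w₁, h₁, rfl⟩ := h₁
  obtain ⟨w₂, h₂, rfl⟩ := h₂
  exact ⟨_, h₁.mul h₂ F G, counitMid_mul F G w₁ w₂⟩

variable {hA} in
/-- `∑ ((v x) y) ⊗ v' = ∑ v ⊗ v'`. -/
theorem Collapses.left {t : (P ⊗[k] P) ⊗[k] (P ⊗[k] V')} {z : P ⊗[k] V'}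
    (h : hA.Collapses t z) : TensorProduct.lift
      (LinearMap.rTensorHom V' ∘ₗ LinearMap.mul k P ∘ₗ LinearMap.mul' k P) t = z := by
  obtain ⟨w, h, rfl⟩ := h
  let f : P ⊗[k] (A.PP ⊗[k] V') →ₗ[k] P ⊗[k] V' :=
    (TensorProduct.lift (A.mulLeftPP.compr₂ A.mulPP)).rTensor V' ∘ₗ
      (TensorProduct.assoc k P A.PP V').symm.toLinearMap
  have h1 : ∀ t, TensorProduct.lift (LinearMap.rTensorHom V' ∘ₗ LinearMap.mul k P ∘ₗ
      LinearMap.mul' k P) t = f (A.incl P V' t) := by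
    intro t
    induction t using TensorProduct.induction_add with
    | add a c ha hc => simp only [map_add, ha, hc]
    | tmul x y =>
      induction x using TensorProduct.induction_add with
      | add a c ha hc => simp only [map_add, add_tmul, ha, hc]
      | tmul v x =>
        induction y using TensorProduct.induction_add with
        | add a c ha hc => simp only [map_add, tmul_add, ha, hc]
        | tmul y v' => rfl
  rw [h1, h]
  clear h
  induction w using TensorProduct.induction_add with
  | add a c ha hc => simp only [map_add, ha, hc]
  | tmul v y =>
    induction y using TensorProduct.induction_add with
    | add a c ha hc => simp only [map_add, tmul_add, ha, hc]
    | tmul h v' =>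
      change A.mulPP (A.mulLeftPP v (hA.τ h)) ⊗ₜ v' = _
      rw [hA.mulPP_mulLeftPP_τ, counitMid_tmul, smul_tmul]

variable {hA} in
/-- `∑ v ⊗ x (y v') = ∑ v ⊗ v'`. -/
theorem Collapses.right {t : (V ⊗[k] P) ⊗[k] (P ⊗[k] P)} {z : V ⊗[k] P}
    (h : hA.Collapses t z) : TensorProduct.lift
      (LinearMap.lTensorHom V ∘ₗ (LinearMap.mul k P).flip ∘ₗ LinearMap.mul' k P).flip t = z := by
  obtain ⟨w, h, rfl⟩ := h
  let f : V ⊗[k] (A.PP ⊗[k] P) →ₗ[k] V ⊗[k] P :=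
    (TensorProduct.lift (A.mulRightPP.compr₂ A.mulPP)).lTensor V
  have h1 : ∀ t, TensorProduct.lift (LinearMap.lTensorHom V ∘ₗ (LinearMap.mul k P).flip ∘ₗ
      LinearMap.mul' k P).flip t = f (A.incl V P t) := by
    intro t
    induction t using TensorProduct.induction_add with
    | add a c ha hc => simp only [map_add, ha, hc]
    | tmul x y =>
      induction x using TensorProduct.induction_add with
      | add a c ha hc => simp only [map_add, add_tmul, ha, hc]
      | tmul v x =>
        induction y using TensorProduct.induction_add with
        | add a c ha hc => simp only [map_add, tmul_add, ha, hc]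
        | tmul y v' => rfl
  rw [h1, h]
  clear h
  induction w using TensorProduct.induction_add with
  | add a c ha hc => simp only [map_add, ha, hc]
  | tmul v y =>
    induction y using TensorProduct.induction_add with
    | add a c ha hc => simp only [map_add, tmul_add, ha, hc]
    | tmul h v' =>
      change v ⊗ₜ A.mulPP (A.mulRightPP (hA.τ h) v') = _
      rw [hA.mulPP_mulRightPP_τ, counitMid_tmul]

theorem lifts_of_inclC (X : A.diagCoinv) (z : A.diagCoinv ⊗[k] A.diagCoinv)
    (hz : A.inclC z = hA.galois.esComul X) :
    hA.Lifts (TensorProduct.map A.diagCoinv.subtype A.diagCoinv.subtype z)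
      (TensorProduct.assoc k P H P (A.coact.rTensor P X)) := hz

/-- The base case of the calculus: the coproduct of `X` lifts `p₀ ⊗ p₁ ⊗ q`, and the counit returns
`p ⊗ q`. -/
theorem collapses_of_inclC (X : A.diagCoinv) (z : A.diagCoinv ⊗[k] A.diagCoinv)
    (hz : A.inclC z = hA.galois.esComul X) :
    hA.Collapses (TensorProduct.map A.diagCoinv.subtype A.diagCoinv.subtype z) X := by
  refine ⟨_, hA.lifts_of_inclC X z hz, ?_⟩
  generalize (X : P ⊗[k] P) = z
  induction z using TensorProduct.induction_add with
  | add a c ha hc => simp only [map_add, ha, hc]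
  | tmul p q =>
    conv_rhs => rw [← A.coact_counit p]
    rw [LinearMap.rTensor_tmul]
    induction A.coact p using TensorProduct.induction_add with
    | add a c ha hc => simp only [map_add, add_tmul, ha, hc]
    | tmul p h => simp [smul_tmul]

end Represents

end IsAdmissible

/-! ### Products of coinvariant tensors -/

section Products

variable {V V₁ V₂ : Type*} [AddCommGroup V] [Module k V] [AddCommGroup V₁] [Module k V₁]
  [AddCommGroup V₂] [Module k V₂]

variable (A) in
/-- The diagonal coaction on `V ⊗ P`, where `ρ` is the coaction on `V`. -/
def diagCoactOn (ρ : V →ₗ[k] V ⊗[k] H) : V ⊗[k] P →ₗ[k] V ⊗[k] (P ⊗[k] H) :=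
  TensorProduct.lift (collect.compl₁₂ ρ A.coact)

theorem diagCoactOn_tmul (ρ : V →ₗ[k] V ⊗[k] H) (v : V) (p : P) :
    A.diagCoactOn ρ (v ⊗ₜ p) = collect (ρ v) (A.coact p) := rfl

variable (A) in
/-- Coinvariant elements of `V ⊗ P`. -/
def IsCoinvOn (ρ : V →ₗ[k] V ⊗[k] H) (z : V ⊗[k] P) : Prop :=
  A.diagCoactOn ρ z = ((TensorProduct.mk k P H).flip 1).lTensor V z

theorem collect_map₂ (F : V₁ →ₗ[k] V₂ →ₗ[k] V) (v : V₁) (h : H) (p : P) (g : H)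
    (b : V₂ ⊗[k] H) (c : P ⊗[k] H) :
    collect (TensorProduct.map₂ F (LinearMap.mul k H) (v ⊗ₜ h) b) (c * (p ⊗ₜ g)) =
      TensorProduct.map (F v) (TensorProduct.map ((LinearMap.mul k P).flip p)
        (LinearMap.mul k H h ∘ₗ (LinearMap.mul k H).flip g)) (collect b c) := by
  induction b using TensorProduct.induction_add with
  | add a c ha hc => simp only [map_add, LinearMap.add_apply, ha, hc]
  | tmul b f =>
    induction c using TensorProduct.induction_add with
    | add a c ha hc => simp only [map_add, add_mul, ha, hc]
    | tmul c f' => simp [mul_assoc]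

/-- For `z₁ = v ⊗ p` and `z₂ = b ⊗ c` the product is `F v b ⊗ c p`, with `H`-component `v₁ b₁ c₁
p₁`. Coinvariance of `z₂` removes the inner pair `b₁ c₁`, after which coinvariance of `z₁` removes
the outer one. -/
theorem IsCoinvOn.mul {ρ : V →ₗ[k] V ⊗[k] H} {ρ₁ : V₁ →ₗ[k] V₁ ⊗[k] H} {ρ₂ : V₂ →ₗ[k] V₂ ⊗[k] H}
    {z₁ : V₁ ⊗[k] P} {z₂ : V₂ ⊗[k] P} (h₁ : A.IsCoinvOn ρ₁ z₁) (h₂ : A.IsCoinvOn ρ₂ z₂)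
    (F : V₁ →ₗ[k] V₂ →ₗ[k] V)
    (hF : ∀ a b, ρ (F a b) = TensorProduct.map₂ F (LinearMap.mul k H) (ρ₁ a) (ρ₂ b)) :
    A.IsCoinvOn ρ (TensorProduct.map₂ F (LinearMap.mul k P).flip z₁ z₂) := by
  -- Coinvariance holds for the whole sum and not for its terms, so the representation of `z₂` is
  -- kept fixed throughout.
  obtain ⟨⟨n, b, c, rfl⟩⟩ := TensorRepr.nonempty z₂
  have key : ∀ (a : V₁ ⊗[k] H) (a' : P ⊗[k] H),
      ∑ i, collect (TensorProduct.map₂ F (LinearMap.mul k H) a (ρ₂ (b i)))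
        (A.coact (c i) * a') =
      ∑ i, TensorProduct.map (F.flip (b i)) ((LinearMap.mul k P (c i)).rTensor H)
        (collect a a') := by
    intro a a'
    induction a using TensorProduct.induction_add with
    | add a c ha hc =>
      simp only [map_add, LinearMap.add_apply, Finset.sum_add_distrib, ha, hc]
    | tmul v h =>
      induction a' using TensorProduct.induction_add with
      | add a c ha hc => simp only [map_add, mul_add, Finset.sum_add_distrib, ha, hc]
      | tmul p g =>
        simp only [collect_map₂, ← diagCoactOn_tmul, ← map_sum]
        rw [h₂]
        simp [map_sum]
  have h3 : ∀ z : V₁ ⊗[k] P, A.diagCoactOn ρ (TensorProduct.map₂ F (LinearMap.mul k P).flip z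
      (∑ i, b i ⊗ₜ c i)) =
      ∑ i, TensorProduct.map (F.flip (b i)) ((LinearMap.mul k P (c i)).rTensor H)
        (A.diagCoactOn ρ₁ z) := by
    intro z
    induction z using TensorProduct.induction_add with
    | add a c ha hc =>
      simp only [map_add, LinearMap.add_apply, Finset.sum_add_distrib, ha, hc]
    | tmul v p =>
      rw [diagCoactOn_tmul, ← key]
      simp only [map_sum, map₂_apply_tmul, TensorProduct.map_tmul, diagCoactOn_tmul,
        LinearMap.flip_apply, LinearMap.mul_apply', hF, A.coact_mul]
  have h4 : ∀ z : V₁ ⊗[k] P,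
      ∑ i, TensorProduct.map (F.flip (b i)) ((LinearMap.mul k P (c i)).rTensor H)
        (((TensorProduct.mk k P H).flip 1).lTensor V₁ z) =
      ((TensorProduct.mk k P H).flip 1).lTensor V
        (TensorProduct.map₂ F (LinearMap.mul k P).flip z (∑ i, b i ⊗ₜ c i)) := by
    intro z
    induction z using TensorProduct.induction_add with
    | add a c ha hc =>
      simp only [map_add, LinearMap.add_apply, Finset.sum_add_distrib, ha, hc]
    | tmul v p => simp [map_sum]
  rw [IsCoinvOn, h3, h₁, h4]

end Products

theorem isCoinvOn_coact {z : P ⊗[k] P} : A.IsCoinvOn A.coact z ↔ z ∈ A.diagCoinv := Iff.rfl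

/-- The product `(p ⊗ p') (q ⊗ q') = p q ⊗ q' p'`. -/
def esMul : P ⊗[k] P →ₗ[k] P ⊗[k] P →ₗ[k] P ⊗[k] P :=
  TensorProduct.map₂ (LinearMap.mul k P) (LinearMap.mul k P).flip

@[simp]
theorem esMul_tmul (p p' q q' : P) :
    esMul (k := k) (p ⊗ₜ p') (q ⊗ₜ q') = (p * q) ⊗ₜ (q' * p') := rfl

/-- `(p ⊗ q, r) ↦ p (q r)`. -/
def mulR : P ⊗[k] P →ₗ[k] P →ₗ[k] P :=
  ((LinearMap.lTensorHom P ∘ₗ (LinearMap.mul k P).flip).compr₂ (LinearMap.mul' k P)).flip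

@[simp]
theorem mulR_tmul (p q r : P) : mulR (k := k) (p ⊗ₜ q) r = p * (q * r) := rfl

/-- `(p, q ⊗ r) ↦ (p q) r`. -/
def mulL : P →ₗ[k] P ⊗[k] P →ₗ[k] P :=
  (LinearMap.rTensorHom P ∘ₗ LinearMap.mul k P).compr₂ (LinearMap.mul' k P)

@[simp]
theorem mulL_tmul (p q r : P) : mulL (k := k) p (q ⊗ₜ r) = (p * q) * r := rfl

/-- `p (q r) ⊗ r' (q' p')`. -/
def phiTensor (X Y Z : P ⊗[k] P) : P ⊗[k] P :=
  TensorProduct.map₂ mulR (LinearMap.mul k P).flip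
    (TensorProduct.map₂ (TensorProduct.mk k P P) (LinearMap.mul k P).flip X Y) Z

/-- `(p q) r ⊗ (r' q') p'`. -/
def psiTensor (X Y Z : P ⊗[k] P) : P ⊗[k] P :=
  TensorProduct.map₂ mulL (LinearMap.mul k P).flip X
    (TensorProduct.map₂ (TensorProduct.mk k P P) (LinearMap.mul k P).flip Y Z)

theorem coact_mul_map₂ (p q : P) :
    A.coact (LinearMap.mul k P p q) =
      TensorProduct.map₂ (LinearMap.mul k P) (LinearMap.mul k H) (A.coact p) (A.coact q) := by
  rw [LinearMap.mul_apply', A.coact_mul]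
  generalize A.coact p = a
  generalize A.coact q = b
  induction a using TensorProduct.induction_add with
  | add a c ha hc => simp only [map_add, LinearMap.add_apply, add_mul, ha, hc]
  | tmul p h =>
    induction b using TensorProduct.induction_add with
    | add a c ha hc => simp only [map_add, mul_add, ha, hc]
    | tmul q g => simp

theorem coact_mulR (z : P ⊗[k] P) (r : P) :
    A.coact (mulR (k := k) z r) =
      TensorProduct.map₂ mulR (LinearMap.mul k H) (A.diagCoact' z) (A.coact r) := by
  induction z using TensorProduct.induction_add with
  | add a c ha hc => simp only [map_add, LinearMap.add_apply, ha, hc]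
  | tmul p q =>
    rw [mulR_tmul, A.coact_mul, A.coact_mul, diagCoact'_tmul]
    generalize A.coact p = a
    generalize A.coact q = b
    generalize A.coact r = d
    induction a using TensorProduct.induction_add with
    | add a c ha hc => simp only [map_add, LinearMap.add_apply, add_mul, ha, hc]
    | tmul p h =>
      induction b using TensorProduct.induction_add with
      | add a c ha hc => simp only [map_add, LinearMap.add_apply, add_mul, mul_add, ha, hc]
      | tmul q g =>
        induction d using TensorProduct.induction_add with
        | add a c ha hc => simp only [map_add, mul_add, ha, hc]
        | tmul r f => simp [mul_assoc]

theorem coact_mulL (p : P) (z : P ⊗[k] P) :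
    A.coact (mulL (k := k) p z) =
      TensorProduct.map₂ mulL (LinearMap.mul k H) (A.coact p) (A.diagCoact' z) := by
  induction z using TensorProduct.induction_add with
  | add a c ha hc => simp only [map_add, ha, hc]
  | tmul q r =>
    rw [mulL_tmul, A.coact_mul, A.coact_mul, diagCoact'_tmul]
    generalize A.coact p = a
    generalize A.coact q = b
    generalize A.coact r = d
    induction a using TensorProduct.induction_add with
    | add a c ha hc => simp only [map_add, LinearMap.add_apply, add_mul, ha, hc]
    | tmul p h =>
      induction b using TensorProduct.induction_add with
      | add a c ha hc => simp only [map_add, LinearMap.add_apply, add_mul, mul_add, ha, hc]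
      | tmul q g =>
        induction d using TensorProduct.induction_add with
        | add a c ha hc => simp only [map_add, mul_add, ha, hc]
        | tmul r f => simp [mul_assoc]

theorem esMul_mem {X Y : P ⊗[k] P} (hX : X ∈ A.diagCoinv) (hY : Y ∈ A.diagCoinv) :
    esMul X Y ∈ A.diagCoinv :=
  isCoinvOn_coact.1 ((isCoinvOn_coact.2 hX).mul (isCoinvOn_coact.2 hY) _ coact_mul_map₂)

/-- Two applications of `IsCoinvOn.mul`: the first keeps `p ⊗ q` unmultiplied, with its diagonal
coaction, so that the second can form the bracket `p (q r)`. -/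
theorem phiTensor_mem {X Y Z : P ⊗[k] P} (hX : X ∈ A.diagCoinv) (hY : Y ∈ A.diagCoinv)
    (hZ : Z ∈ A.diagCoinv) : phiTensor X Y Z ∈ A.diagCoinv :=
  isCoinvOn_coact.1 (((isCoinvOn_coact.2 hX).mul (isCoinvOn_coact.2 hY) (ρ := A.diagCoact') _
    A.diagCoact'_tmul).mul (isCoinvOn_coact.2 hZ) _ coact_mulR)

theorem psiTensor_mem {X Y Z : P ⊗[k] P} (hX : X ∈ A.diagCoinv) (hY : Y ∈ A.diagCoinv)
    (hZ : Z ∈ A.diagCoinv) : psiTensor X Y Z ∈ A.diagCoinv :=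
  isCoinvOn_coact.1 ((isCoinvOn_coact.2 hX).mul ((isCoinvOn_coact.2 hY).mul
    (isCoinvOn_coact.2 hZ) (ρ := A.diagCoact') _ A.diagCoact'_tmul) _ coact_mulL)

/-! ### The structure maps on the diagonal coinvariants -/

section StructureMaps

variable (A) in
/-- The product of the diagonal coinvariants. -/
def coinvMul : A.diagCoinv →ₗ[k] A.diagCoinv →ₗ[k] A.diagCoinv :=
  LinearMap.mk₂ k (fun X Y => ⟨esMul (X : P ⊗[k] P) Y, esMul_mem X.2 Y.2⟩)
    (fun _ _ _ => Subtype.ext (by simp)) (fun _ _ _ => Subtype.ext (by simp))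
    (fun _ _ _ => Subtype.ext (by simp)) (fun _ _ _ => Subtype.ext (by simp))

@[simp]
theorem coinvMul_coe (X Y : A.diagCoinv) :
    (A.coinvMul X Y : P ⊗[k] P) = esMul (X : P ⊗[k] P) (Y : P ⊗[k] P) := rfl

theorem tmul_mem_diagCoinv (b c : A.coinvariants) : (b : P) ⊗ₜ[k] (c : P) ∈ A.diagCoinv := by
  rw [mem_diagCoinv, diagCoact_tmul, A.coact_coinv, A.coact_coinv, collect_tmul, one_mul,
    diagTriv_tmul]

variable (A) in
/-- The unit of the diagonal coinvariants. -/
def coinvOne : A.diagCoinv := ⟨1 ⊗ₜ 1, tmul_mem_diagCoinv 1 1⟩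

variable (A) in
/-- The source map `b ↦ b ⊗ 1`. -/
def coinvSrc : A.coinvariants →ₗ[k] A.diagCoinv :=
  LinearMap.codRestrict A.diagCoinv ((TensorProduct.mk k P P).flip 1 ∘ₗ A.coinvariants.subtype)
    (fun b => tmul_mem_diagCoinv b 1)

@[simp]
theorem coinvSrc_coe (b : A.coinvariants) : (A.coinvSrc b : P ⊗[k] P) = (b : P) ⊗ₜ 1 := rfl

variable (A) in
/-- The target map `b ↦ 1 ⊗ b`. -/
def coinvTgt : A.coinvariants →ₗ[k] A.diagCoinv :=
  LinearMap.codRestrict A.diagCoinv (TensorProduct.mk k P P 1 ∘ₗ A.coinvariants.subtype)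
    (fun b => tmul_mem_diagCoinv 1 b)

@[simp]
theorem coinvTgt_coe (b : A.coinvariants) : (A.coinvTgt b : P ⊗[k] P) = 1 ⊗ₜ (b : P) := rfl

variable (A) in
/-- The counit `p ⊗ q ↦ p q`. -/
def coinvCounit : A.diagCoinv →ₗ[k] A.coinvariants :=
  LinearMap.codRestrict A.coinvariants (LinearMap.mul' k P ∘ₗ A.diagCoinv.subtype) mul'_mem

theorem coinvMul_tgt (b : A.coinvariants) : A.coinvMul (A.coinvTgt b) = A.coinvRight (op b) := by
  refine LinearMap.ext fun X => Subtype.ext ?_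
  rw [coinvMul_coe, coinvTgt_coe, coinvRight_coe]
  generalize (X : P ⊗[k] P) = z
  induction z using TensorProduct.induction_add with
  | add a c ha hc => simp only [map_add, ha, hc]
  | tmul p q => simp

theorem coinvMul_src (b : A.coinvariants) : A.coinvMul (A.coinvSrc b) = A.coinvLeft b := by
  refine LinearMap.ext fun X => Subtype.ext ?_
  rw [coinvMul_coe, coinvSrc_coe, coinvLeft_coe]
  generalize (X : P ⊗[k] P) = z
  induction z using TensorProduct.induction_add with
  | add a c ha hc => simp only [map_add, ha, hc]
  | tmul p q => simp

theorem coinv_rel_eq : balRel (fun b => A.coinvMul (A.coinvTgt b)) (fun b => A.coinvMul (A.coinvSrc b)) =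
    balRel (fun b => A.coinvRight (op b)) A.coinvLeft := by
  simp only [coinvMul_tgt, coinvMul_src]

/-- A trilinear form on `P ⊗ P` with values in `B` on the diagonal coinvariants. -/
def coinvForm (f : P ⊗[k] P →ₗ[k] P ⊗[k] P →ₗ[k] P ⊗[k] P →ₗ[k] P)
    (hf : ∀ X Y Z : A.diagCoinv, f X Y Z ∈ A.coinvariants) :
    A.diagCoinv →ₗ[k] A.diagCoinv →ₗ[k] A.diagCoinv →ₗ[k] A.coinvariants :=
  LinearMap.mk₂ k (fun X Y => LinearMap.codRestrict A.coinvariants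
      (f X Y ∘ₗ A.diagCoinv.subtype) (hf X Y))
    (fun _ _ _ => LinearMap.ext fun _ => Subtype.ext (by simp; rfl))
    (fun _ _ _ => LinearMap.ext fun _ => Subtype.ext (by simp; rfl))
    (fun _ _ _ => LinearMap.ext fun _ => Subtype.ext (by simp; rfl))
    (fun _ _ _ => LinearMap.ext fun _ => Subtype.ext (by simp; rfl))

variable (A) in
/-- The 3-cocycle `(p (q r)) (r' (q' p'))`. -/
def cocycle : A.diagCoinv →ₗ[k] A.diagCoinv →ₗ[k] A.diagCoinv →ₗ[k] A.coinvariants :=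
  coinvForm ((TensorProduct.map₂ (TensorProduct.mk k P P) (LinearMap.mul k P).flip).compr₂
    ((TensorProduct.map₂ mulR (LinearMap.mul k P).flip).compr₂ (LinearMap.mul' k P)))
    (fun X Y Z => mul'_mem ⟨_, phiTensor_mem X.2 Y.2 Z.2⟩)

/-- `(X, Y, Z) ↦ (p q) r ⊗ (r' q') p'` as a trilinear map. -/
def psiTensorₗ : P ⊗[k] P →ₗ[k] P ⊗[k] P →ₗ[k] P ⊗[k] P →ₗ[k] P ⊗[k] P :=
  LinearMap.mk₂ k (fun X Y => TensorProduct.map₂ mulL (LinearMap.mul k P).flip X ∘ₗ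
      TensorProduct.map₂ (TensorProduct.mk k P P) (LinearMap.mul k P).flip Y)
    (fun _ _ _ => LinearMap.ext fun _ => by simp)
    (fun _ _ _ => LinearMap.ext fun _ => by simp)
    (fun _ _ _ => LinearMap.ext fun _ => by simp)
    (fun _ _ _ => LinearMap.ext fun _ => by simp)

variable (A) in
/-- The inverse `((p q) r) ((r' q') p')` of the 3-cocycle. -/
def cocycleInv : A.diagCoinv →ₗ[k] A.diagCoinv →ₗ[k] A.diagCoinv →ₗ[k] A.coinvariants :=
  coinvForm (psiTensorₗ.compr₂ (LinearMap.llcomp k _ _ _ (LinearMap.mul' k P)))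
    (fun X Y Z => mul'_mem ⟨_, psiTensor_mem X.2 Y.2 Z.2⟩)

end StructureMaps

namespace IsAdmissible

variable (hA : A.IsAdmissible)

/-- The class of the coproduct. -/
def comulClass (X : A.diagCoinv) : BalTensor (fun b => A.coinvMul (A.coinvTgt b))
    (fun b => A.coinvMul (A.coinvSrc b)) :=
  BalTensor.mk _ _ (hA.galois.exists_comul hA.flat X).choose

/-- Equality in `L ⊗_B L` is tested in `P ⊗ (P ⊗_B P) ⊗ P`; hence the coproduct is independent of
the chosen preimage of `esComul`, and every Sweedler representative embeds as `esComul`. -/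
theorem mk_coinv_eq_iff (hA : A.IsAdmissible) (z z' : A.diagCoinv ⊗[k] A.diagCoinv) :
    BalTensor.mk (fun b => A.coinvMul (A.coinvTgt b)) (fun b => A.coinvMul (A.coinvSrc b)) z =
      BalTensor.mk _ _ z' ↔ A.inclC z = A.inclC z' := by
  rw [← sub_eq_zero, ← map_sub, BalTensor.mk_eq_zero, coinv_rel_eq,
    ← ker_inclC hA.galois hA.flat, LinearMap.mem_ker, map_sub, sub_eq_zero]

theorem comulClass_eq (X : A.diagCoinv) (z : A.diagCoinv ⊗[k] A.diagCoinv)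
    (hz : A.inclC z = hA.galois.esComul X) : hA.comulClass X = BalTensor.mk _ _ z := by
  rw [comulClass, hA.mk_coinv_eq_iff, hz, (hA.galois.exists_comul hA.flat X).choose_spec]

theorem inclC_eq_of_mk_eq (X : A.diagCoinv) (z : A.diagCoinv ⊗[k] A.diagCoinv)
    (hz : BalTensor.mk _ _ z = hA.comulClass X) : A.inclC z = hA.galois.esComul X := by
  rw [comulClass, hA.mk_coinv_eq_iff] at hz
  rw [hz, (hA.galois.exists_comul hA.flat X).choose_spec]

/-- The Ehresmann–Schauenburg bialgebroid on the diagonal coinvariants. -/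
def data : BialgebroidData k A.coinvariants A.diagCoinv where
  mul := A.coinvMul
  one := A.coinvOne
  src := A.coinvSrc
  tgt := A.coinvTgt
  comul :=
    { toFun := hA.comulClass
      map_add' := fun X Y => by
        rw [hA.comulClass_eq (X + Y) ((hA.galois.exists_comul hA.flat X).choose +
          (hA.galois.exists_comul hA.flat Y).choose), map_add]
        · rfl
        · rw [map_add, (hA.galois.exists_comul hA.flat X).choose_spec,
            (hA.galois.exists_comul hA.flat Y).choose_spec, Submodule.coe_add, map_add]
      map_smul' := fun c X => by
        rw [hA.comulClass_eq (c • X) (c • (hA.galois.exists_comul hA.flat X).choose), map_smul]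
        · rfl
        · rw [map_smul, (hA.galois.exists_comul hA.flat X).choose_spec, Submodule.coe_smul,
            map_smul] }
  counit := A.coinvCounit

theorem data_mk₂_eq_iff (z z' : A.diagCoinv ⊗[k] A.diagCoinv) :
    hA.data.mk₂ z = hA.data.mk₂ z' ↔ A.inclC z = A.inclC z' := hA.mk_coinv_eq_iff z z'

theorem data_comul_eq (X : A.diagCoinv) (z : A.diagCoinv ⊗[k] A.diagCoinv)
    (hz : A.inclC z = hA.galois.esComul X) : hA.data.comul X = hA.data.mk₂ z :=
  hA.comulClass_eq X z hz

theorem inclC_sweedler {X : A.diagCoinv} (x : hA.data.Sweedler X) :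
    A.inclC (∑ i, x.fst i ⊗ₜ x.snd i) = hA.galois.esComul X :=
  hA.inclC_eq_of_mk_eq X _ x.eq_comul

theorem incl_sweedler {X : A.diagCoinv} (x : hA.data.Sweedler X) :
    A.incl P P (∑ i, (x.fst i : P ⊗[k] P) ⊗ₜ (x.snd i : P ⊗[k] P)) = hA.galois.esComul X := by
  rw [← hA.inclC_sweedler x, LinearMap.comp_apply, map_sum (TensorProduct.map _ _)]
  rfl

theorem lifts_sweedler {X : A.diagCoinv} (x : hA.data.Sweedler X) :
    hA.Lifts (∑ i, (x.fst i : P ⊗[k] P) ⊗ₜ (x.snd i : P ⊗[k] P))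
      (TensorProduct.assoc k P H P (A.coact.rTensor P X)) := hA.incl_sweedler x

theorem collapses_sweedler {X : A.diagCoinv} (x : hA.data.Sweedler X) :
    hA.Collapses (∑ i, (x.fst i : P ⊗[k] P) ⊗ₜ (x.snd i : P ⊗[k] P)) (X : P ⊗[k] P) := by
  have h := hA.collapses_of_inclC X _ (hA.inclC_sweedler x)
  rwa [map_sum (TensorProduct.map _ _)] at h

end IsAdmissible

/-! ### Multilinear identities over the coinvariants -/

section Multilinear

theorem tensor_ext₂ {M N W : Type*} [AddCommGroup M] [Module k M] [AddCommGroup N] [Module k N]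
    [AddCommGroup W] [Module k W] {f g : M ⊗[k] N →ₗ[k] M ⊗[k] N →ₗ[k] W}
    (h : ∀ p p' q q', f (p ⊗ₜ p') (q ⊗ₜ q') = g (p ⊗ₜ p') (q ⊗ₜ q')) : f = g :=
  TensorProduct.ext' fun p p' => TensorProduct.ext' fun q q' => h p p' q q'

theorem tensor_ext₃ {M N W : Type*} [AddCommGroup M] [Module k M] [AddCommGroup N] [Module k N]
    [AddCommGroup W] [Module k W] {f g : M ⊗[k] N →ₗ[k] M ⊗[k] N →ₗ[k] M ⊗[k] N →ₗ[k] W}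
    (h : ∀ p p' q q' r r', f (p ⊗ₜ p') (q ⊗ₜ q') (r ⊗ₜ r') =
      g (p ⊗ₜ p') (q ⊗ₜ q') (r ⊗ₜ r')) : f = g :=
  TensorProduct.ext' fun p p' => tensor_ext₂ fun q q' r r' => h p p' q q' r r'

theorem esMul_src_left (b : A.coinvariants) (X Y : P ⊗[k] P) :
    esMul (esMul ((b : P) ⊗ₜ 1) X) Y = esMul ((b : P) ⊗ₜ[k] 1) (esMul X Y) :=
  LinearMap.congr_fun₂ (f := esMul ∘ₗ esMul ((b : P) ⊗ₜ 1))
    (g := esMul.compr₂ (esMul ((b : P) ⊗ₜ[k] 1)))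
    (tensor_ext₂ fun p p' q q' => by simp [A.mul_assoc_left]) X Y

theorem esMul_src_mid (b : A.coinvariants) (X Y : P ⊗[k] P) :
    esMul (esMul X ((b : P) ⊗ₜ 1)) Y = esMul X (esMul ((b : P) ⊗ₜ[k] 1) Y) :=
  LinearMap.congr_fun₂ (f := esMul ∘ₗ esMul.flip ((b : P) ⊗ₜ 1))
    (g := esMul.compl₂ (esMul ((b : P) ⊗ₜ[k] 1)))
    (tensor_ext₂ fun p p' q q' => by simp [A.mul_assoc_mid]) X Y

theorem esMul_src_right (b : A.coinvariants) (X Y : P ⊗[k] P) :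
    esMul (esMul X Y) ((b : P) ⊗ₜ 1) = esMul X (esMul Y ((b : P) ⊗ₜ[k] 1)) :=
  LinearMap.congr_fun₂ (f := esMul.compr₂ (esMul.flip ((b : P) ⊗ₜ 1)))
    (g := esMul.compl₂ (esMul.flip ((b : P) ⊗ₜ[k] 1)))
    (tensor_ext₂ fun p p' q q' => by simp [A.mul_assoc_right]) X Y

theorem esMul_tgt_left (b : A.coinvariants) (X Y : P ⊗[k] P) :
    esMul (esMul (1 ⊗ₜ (b : P)) X) Y = esMul (1 ⊗ₜ[k] (b : P)) (esMul X Y) :=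
  LinearMap.congr_fun₂ (f := esMul ∘ₗ esMul (1 ⊗ₜ (b : P)))
    (g := esMul.compr₂ (esMul (1 ⊗ₜ[k] (b : P))))
    (tensor_ext₂ fun p p' q q' => by simp [A.mul_assoc_right]) X Y

theorem esMul_tgt_mid (b : A.coinvariants) (X Y : P ⊗[k] P) :
    esMul (esMul X (1 ⊗ₜ (b : P))) Y = esMul X (esMul (1 ⊗ₜ[k] (b : P)) Y) :=
  LinearMap.congr_fun₂ (f := esMul ∘ₗ esMul.flip (1 ⊗ₜ (b : P)))
    (g := esMul.compl₂ (esMul (1 ⊗ₜ[k] (b : P))))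
    (tensor_ext₂ fun p p' q q' => by simp [A.mul_assoc_mid]) X Y

theorem esMul_tgt_right (b : A.coinvariants) (X Y : P ⊗[k] P) :
    esMul (esMul X Y) (1 ⊗ₜ (b : P)) = esMul X (esMul Y (1 ⊗ₜ[k] (b : P))) :=
  LinearMap.congr_fun₂ (f := esMul.compr₂ (esMul.flip (1 ⊗ₜ (b : P))))
    (g := esMul.compl₂ (esMul.flip (1 ⊗ₜ[k] (b : P))))
    (tensor_ext₂ fun p p' q q' => by simp [A.mul_assoc_left]) X Y

theorem esMul_one_left (X : P ⊗[k] P) : esMul (1 ⊗ₜ[k] 1) X = X :=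
  LinearMap.congr_fun (f := esMul (1 ⊗ₜ[k] 1)) (g := LinearMap.id)
    (TensorProduct.ext' fun p q => by simp) X

theorem esMul_one_right (X : P ⊗[k] P) : esMul X (1 ⊗ₜ[k] 1) = X :=
  LinearMap.congr_fun (f := esMul.flip (1 ⊗ₜ[k] 1)) (g := LinearMap.id)
    (TensorProduct.ext' fun p q => by simp) X

theorem esMul_src (b : P) (X : P ⊗[k] P) :
    esMul (b ⊗ₜ[k] 1) X = (LinearMap.mul k P b).rTensor P X :=
  LinearMap.congr_fun (f := esMul (b ⊗ₜ[k] 1)) (g := (LinearMap.mul k P b).rTensor P)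
    (TensorProduct.ext' fun p q => by simp) X

theorem esMul_tgt (b : P) (X : P ⊗[k] P) :
    esMul (1 ⊗ₜ[k] b) X = ((LinearMap.mul k P).flip b).lTensor P X :=
  LinearMap.congr_fun (f := esMul (1 ⊗ₜ[k] b)) (g := ((LinearMap.mul k P).flip b).lTensor P)
    (TensorProduct.ext' fun p q => by simp) X

theorem mul'_esMul_src (b : A.coinvariants) (X : P ⊗[k] P) :
    LinearMap.mul' k P (esMul ((b : P) ⊗ₜ 1) X) = b * LinearMap.mul' k P X :=
  LinearMap.congr_fun (f := LinearMap.mul' k P ∘ₗ esMul ((b : P) ⊗ₜ 1))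
    (g := LinearMap.mul k P b ∘ₗ LinearMap.mul' k P)
    (TensorProduct.ext' fun p q => by simp [A.mul_assoc_left]) X

theorem mul'_esMul_tgt (b : A.coinvariants) (X : P ⊗[k] P) :
    LinearMap.mul' k P (esMul (1 ⊗ₜ (b : P)) X) = LinearMap.mul' k P X * b :=
  LinearMap.congr_fun (f := LinearMap.mul' k P ∘ₗ esMul (1 ⊗ₜ (b : P)))
    (g := (LinearMap.mul k P).flip b ∘ₗ LinearMap.mul' k P)
    (TensorProduct.ext' fun p q => by simp [A.mul_assoc_right]) X

/-- `(X, Y, Z) ↦ (p (q r)) (r' (q' p'))`. -/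
def phiForm : P ⊗[k] P →ₗ[k] P ⊗[k] P →ₗ[k] P ⊗[k] P →ₗ[k] P :=
  (TensorProduct.map₂ (TensorProduct.mk k P P) (LinearMap.mul k P).flip).compr₂
    ((TensorProduct.map₂ mulR (LinearMap.mul k P).flip).compr₂ (LinearMap.mul' k P))

@[simp]
theorem phiForm_tmul (p p' q q' r r' : P) : phiForm (k := k) (p ⊗ₜ p') (q ⊗ₜ q') (r ⊗ₜ r') =
    (p * (q * r)) * (r' * (q' * p')) := rfl

/-- `(X, Y, Z) ↦ ((p q) r) ((r' q') p')`. -/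
def psiForm : P ⊗[k] P →ₗ[k] P ⊗[k] P →ₗ[k] P ⊗[k] P →ₗ[k] P :=
  psiTensorₗ.compr₂ (LinearMap.llcomp k _ _ _ (LinearMap.mul' k P))

@[simp]
theorem psiForm_tmul (p p' q q' r r' : P) : psiForm (k := k) (p ⊗ₜ p') (q ⊗ₜ q') (r ⊗ₜ r') =
    ((p * q) * r) * ((r' * q') * p') := rfl

theorem cocycle_eq_phiForm (X Y Z : A.diagCoinv) :
    (A.cocycle X Y Z : P) = phiForm (X : P ⊗[k] P) (Y : P ⊗[k] P) (Z : P ⊗[k] P) := rfl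

theorem cocycleInv_eq_psiForm (X Y Z : A.diagCoinv) :
    (A.cocycleInv X Y Z : P) = psiForm (X : P ⊗[k] P) (Y : P ⊗[k] P) (Z : P ⊗[k] P) := rfl

/-- Elements of `C` need not be sums of pure tensors lying in `C`, but `f` is defined on all of `P ⊗
P`, so each condition can be checked on pure tensors there. -/
theorem IsAdmissible.isCochain₃ (hA : A.IsAdmissible)
    (Φ : A.diagCoinv →ₗ[k] A.diagCoinv →ₗ[k] A.diagCoinv →ₗ[k] A.coinvariants)
    (f : P ⊗[k] P →ₗ[k] P ⊗[k] P →ₗ[k] P ⊗[k] P →ₗ[k] P)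
    (hf : ∀ X Y Z, (Φ X Y Z : P) = f (X : P ⊗[k] P) (Y : P ⊗[k] P) (Z : P ⊗[k] P))
    (h : ∀ (b : A.coinvariants) (p p' q q' r r' : P),
      f ((b * p) ⊗ₜ p') (q ⊗ₜ q') (r ⊗ₜ r') = b * f (p ⊗ₜ p') (q ⊗ₜ q') (r ⊗ₜ r') ∧
      f (p ⊗ₜ (p' * b)) (q ⊗ₜ q') (r ⊗ₜ r') = f (p ⊗ₜ p') (q ⊗ₜ q') (r ⊗ₜ r') * b ∧
      f ((p * b) ⊗ₜ p') (q ⊗ₜ q') (r ⊗ₜ r') = f (p ⊗ₜ p') ((b * q) ⊗ₜ q') (r ⊗ₜ r') ∧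
      f (p ⊗ₜ (b * p')) (q ⊗ₜ q') (r ⊗ₜ r') = f (p ⊗ₜ p') (q ⊗ₜ (q' * b)) (r ⊗ₜ r') ∧
      f (p ⊗ₜ p') ((q * b) ⊗ₜ q') (r ⊗ₜ r') = f (p ⊗ₜ p') (q ⊗ₜ q') ((b * r) ⊗ₜ r') ∧
      f (p ⊗ₜ p') (q ⊗ₜ (b * q')) (r ⊗ₜ r') = f (p ⊗ₜ p') (q ⊗ₜ q') (r ⊗ₜ (r' * b))) :
    hA.data.IsCochain₃ Φ where
  left_linear b X Y Z := Subtype.ext ((hf _ _ _).trans (.trans (LinearMap.congr_fun₂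
    (LinearMap.congr_fun (f := f ∘ₗ esMul ((b : P) ⊗ₜ 1))
      (g := f.compr₂ (LinearMap.llcomp k _ _ _ (LinearMap.mul k P (b : P))))
      (tensor_ext₃ fun p p' q q' r r' => by simpa using (h b p p' q q' r r').1)
      (X : P ⊗[k] P)) (Y : P ⊗[k] P) (Z : P ⊗[k] P))
    (congrArg (fun t => (b : P) * t) (hf X Y Z).symm)))
  right_linear b X Y Z := Subtype.ext ((hf _ _ _).trans (.trans (LinearMap.congr_fun₂
    (LinearMap.congr_fun (f := f ∘ₗ esMul (1 ⊗ₜ (b : P)))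
      (g := f.compr₂ (LinearMap.llcomp k _ _ _ ((LinearMap.mul k P).flip (b : P))))
      (tensor_ext₃ fun p p' q q' r r' => by simpa using (h b p p' q q' r r').2.1)
      (X : P ⊗[k] P)) (Y : P ⊗[k] P) (Z : P ⊗[k] P))
    (congrArg (fun t => t * (b : P)) (hf X Y Z).symm)))
  balanced_src₁ b X Y Z := Subtype.ext ((hf _ _ _).trans (.trans (LinearMap.congr_fun₂
    (LinearMap.congr_fun (f := f ∘ₗ esMul.flip ((b : P) ⊗ₜ 1))
      (g := f.compl₂ (esMul ((b : P) ⊗ₜ 1)))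
      (tensor_ext₃ fun p p' q q' r r' => by simpa using (h b p p' q q' r r').2.2.1)
      (X : P ⊗[k] P)) (Y : P ⊗[k] P) (Z : P ⊗[k] P)) (hf X (A.coinvMul (A.coinvSrc b) Y) Z).symm))
  balanced_tgt₁ b X Y Z := Subtype.ext ((hf _ _ _).trans (.trans (LinearMap.congr_fun₂
    (LinearMap.congr_fun (f := f ∘ₗ esMul.flip (1 ⊗ₜ (b : P)))
      (g := f.compl₂ (esMul (1 ⊗ₜ (b : P))))
      (tensor_ext₃ fun p p' q q' r r' => by simpa using (h b p p' q q' r r').2.2.2.1)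
      (X : P ⊗[k] P)) (Y : P ⊗[k] P) (Z : P ⊗[k] P)) (hf X (A.coinvMul (A.coinvTgt b) Y) Z).symm))
  balanced_src₂ b X Y Z := Subtype.ext ((hf _ _ _).trans (.trans (LinearMap.congr_fun₂
    (LinearMap.congr_fun (f := f.compl₂ (esMul.flip ((b : P) ⊗ₜ 1)))
      (g := f.compr₂ (LinearMap.lcomp k _ (esMul ((b : P) ⊗ₜ 1))))
      (tensor_ext₃ fun p p' q q' r r' => by simpa using (h b p p' q q' r r').2.2.2.2.1)
      (X : P ⊗[k] P)) (Y : P ⊗[k] P) (Z : P ⊗[k] P)) (hf X Y (A.coinvMul (A.coinvSrc b) Z)).symm))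
  balanced_tgt₂ b X Y Z := Subtype.ext ((hf _ _ _).trans (.trans (LinearMap.congr_fun₂
    (LinearMap.congr_fun (f := f.compl₂ (esMul.flip (1 ⊗ₜ (b : P))))
      (g := f.compr₂ (LinearMap.lcomp k _ (esMul (1 ⊗ₜ (b : P)))))
      (tensor_ext₃ fun p p' q q' r r' => by simpa using (h b p p' q q' r r').2.2.2.2.2)
      (X : P ⊗[k] P)) (Y : P ⊗[k] P) (Z : P ⊗[k] P)) (hf X Y (A.coinvMul (A.coinvTgt b) Z)).symm))

theorem IsAdmissible.cochain_cocycle (hA : A.IsAdmissible) : hA.data.IsCochain₃ A.cocycle := by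
  refine hA.isCochain₃ _ phiForm cocycle_eq_phiForm fun b p p' q q' r r' => ?_
  simp only [phiForm_tmul, A.mul_assoc_left, A.mul_assoc_mid, A.mul_assoc_right, and_self]

theorem IsAdmissible.cochain_cocycleInv (hA : A.IsAdmissible) :
    hA.data.IsCochain₃ A.cocycleInv := by
  refine hA.isCochain₃ _ psiForm cocycleInv_eq_psiForm fun b p p' q q' r r' => ?_
  simp only [psiForm_tmul]
  refine ⟨?_, ?_, ?_, ?_, ?_, ?_⟩
  · simp only [A.mul_assoc_left]
  · simp only [A.mul_assoc_right]
  · simp only [A.mul_assoc_mid]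
  · rw [← A.mul_assoc_right, A.mul_assoc_mid]
  · rw [← A.mul_assoc_right, A.mul_assoc_mid]
  · simp only [A.mul_assoc_mid]

/-- The element `b` stands at the right end of the first factor or at the left end of the second,
and being in `B` it can cross the central product. -/
theorem phiForm_src_eq_tgt (b : A.coinvariants) (X Y Z : P ⊗[k] P) :
    phiForm X Y (esMul Z ((b : P) ⊗ₜ 1)) = phiForm X Y (esMul Z (1 ⊗ₜ[k] (b : P))) :=
  LinearMap.congr_fun₂ (LinearMap.congr_fun
    (f := phiForm.compr₂ (LinearMap.lcomp k _ (esMul.flip ((b : P) ⊗ₜ 1))))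
    (g := phiForm.compr₂ (LinearMap.lcomp k _ (esMul.flip (1 ⊗ₜ[k] (b : P)))))
    (tensor_ext₃ fun p p' q q' r r' => by
      simp only [LinearMap.compr₂_apply, LinearMap.lcomp_apply, LinearMap.flip_apply, esMul_tmul,
        phiForm_tmul, mul_one, one_mul]
      rw [← A.mul_assoc_right q r b, ← A.mul_assoc_right p (q * r) b, A.mul_assoc_mid,
        A.mul_assoc_left]) X) Y Z

theorem phiForm_one₁ (X Y : P ⊗[k] P) :
    phiForm (1 ⊗ₜ[k] 1) X Y = LinearMap.mul' k P (esMul X Y) := by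
  have h : phiForm (1 ⊗ₜ[k] 1) = esMul.compr₂ (LinearMap.mul' k P) :=
    tensor_ext₂ fun p p' q q' => by simp
  rw [h, LinearMap.compr₂_apply]

theorem phiForm_one₂ (X Y : P ⊗[k] P) :
    phiForm X (1 ⊗ₜ[k] 1) Y = LinearMap.mul' k P (esMul X Y) := by
  have h : phiForm.flip (1 ⊗ₜ[k] 1) = esMul.compr₂ (LinearMap.mul' k P) :=
    tensor_ext₂ fun p p' q q' => by simp
  rw [← LinearMap.flip_apply phiForm, h, LinearMap.compr₂_apply]

end Multilinear

/-! ### The coring structure -/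

theorem map_sum_sum {M N W ι κ : Type*} [AddCommGroup M] [Module k M] [AddCommGroup N] [Module k N]
    [AddCommGroup W] [Module k W] [Fintype ι] [Fintype κ] (f : M →ₗ[k] N →ₗ[k] W) (a : ι → M)
    (b : κ → N) : f (∑ i, a i) (∑ j, b j) = ∑ i, ∑ j, f (a i) (b j) := by
  rw [map_sum f, LinearMap.sum_apply]
  exact Finset.sum_congr rfl fun i _ => map_sum _ _ _

theorem incl_bilinear (b c : A.coinvariants) (x y : P ⊗[k] P) :
    A.incl P P (esMul ((b : P) ⊗ₜ 1) x ⊗ₜ esMul (1 ⊗ₜ (c : P)) y) =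
      TensorProduct.map (LinearMap.mul k P b) (((LinearMap.mul k P).flip (c : P)).lTensor A.PP)
        (A.incl P P (x ⊗ₜ y)) := by
  induction x using TensorProduct.induction_add with
  | add a c ha hc => simp only [map_add, add_tmul, ha, hc]
  | tmul p p' =>
    induction y using TensorProduct.induction_add with
    | add a c ha hc => simp only [map_add, tmul_add, ha, hc]
    | tmul q q' =>
      simp only [esMul_tmul, one_mul, mul_one]
      rfl

theorem IsHopfGalois.esComul_bilinear (hG : A.IsHopfGalois) (b c : A.coinvariants)
    (z : P ⊗[k] P) : hG.esComul (esMul ((b : P) ⊗ₜ 1) (esMul (1 ⊗ₜ (c : P)) z)) =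
      TensorProduct.map (LinearMap.mul k P b) (((LinearMap.mul k P).flip (c : P)).lTensor A.PP)
        (hG.esComul z) := by
  induction z using TensorProduct.induction_add with
  | add a c ha hc => simp only [map_add, ha, hc]
  | tmul p q =>
    simp only [esMul_tmul, one_mul, mul_one, esComul, LinearMap.comp_apply,
      LinearMap.rTensor_tmul, A.coact_coinv_mul]
    induction A.coact p using TensorProduct.induction_add with
    | add a c ha hc => simp only [map_add, add_tmul, ha, hc]
    | tmul p h => rfl

theorem incl_takeuchi_left (b : A.coinvariants) (x y : P ⊗[k] P) :
    A.incl P P (esMul x (1 ⊗ₜ (b : P)) ⊗ₜ y) =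
      ((A.mulLeftPP b).rTensor P).lTensor P (A.incl P P (x ⊗ₜ y)) := by
  induction x using TensorProduct.induction_add with
  | add a c ha hc => simp only [map_add, LinearMap.add_apply, add_tmul, ha, hc]
  | tmul p p' =>
    induction y using TensorProduct.induction_add with
    | add a c ha hc => simp only [map_add, tmul_add, ha, hc]
    | tmul q q' =>
      rw [esMul_tmul, mul_one]
      rfl

theorem incl_takeuchi_right (b : A.coinvariants) (x y : P ⊗[k] P) :
    A.incl P P (x ⊗ₜ esMul y ((b : P) ⊗ₜ 1)) =
      ((A.mulRightPP.flip b).rTensor P).lTensor P (A.incl P P (x ⊗ₜ y)) := by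
  induction x using TensorProduct.induction_add with
  | add a c ha hc => simp only [map_add, add_tmul, ha, hc]
  | tmul p p' =>
    induction y using TensorProduct.induction_add with
    | add a c ha hc => simp only [map_add, LinearMap.add_apply, tmul_add, ha, hc]
    | tmul q q' =>
      rw [esMul_tmul, one_mul]
      rfl

/-- Inside the target of `incl₃`, an iterated coproduct depends on its Sweedler representatives only
through `esComul`: taken on the left factor it acts as `coactτ`, and on the right factor
(`incl₃_right`) as `comulRight`. -/
theorem IsHopfGalois.incl₃_left (hG : A.IsHopfGalois) (x y : P ⊗[k] P)
    (t : (P ⊗[k] P) ⊗[k] (P ⊗[k] P)) (ht : A.incl P P t = hG.esComul x) :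
    A.incl₃ (TensorProduct.assoc k _ _ _ (t ⊗ₜ y)) =
      hG.coactτ.rTensor (A.PP ⊗[k] P) (A.incl P P (x ⊗ₜ y)) := by
  simp only [incl₃, LinearMap.comp_apply, LinearEquiv.coe_coe, LinearEquiv.symm_apply_apply,
    LinearMap.rTensor_tmul, ht]
  clear ht
  induction x using TensorProduct.induction_add with
  | add a c ha hc => simp only [map_add, add_tmul, ha, hc]
  | tmul p p' =>
    rw [hG.esComul_tmul, LinearEquiv.symm_apply_apply]
    induction y using TensorProduct.induction_add with
    | add a c ha hc => simp only [map_add, tmul_add, ha, hc]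
    | tmul q q' => rfl

/-- `a ⊗ (m ⊗ c) ↦ (a ⊗ m₀) ⊗ (τ(m₁) ⊗ c)`. -/
def IsHopfGalois.comulRight (hG : A.IsHopfGalois) :
    P ⊗[k] (A.PP ⊗[k] P) →ₗ[k] (P ⊗[k] A.PP) ⊗[k] (A.PP ⊗[k] P) :=
  (TensorProduct.assoc k P A.PP (A.PP ⊗[k] P)).symm.toLinearMap ∘ₗ
    ((TensorProduct.assoc k A.PP A.PP P).toLinearMap ∘ₗ
      (hG.τ.lTensor A.PP ∘ₗ A.coactPP).rTensor P).lTensor P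

theorem IsHopfGalois.incl₃_right (hG : A.IsHopfGalois) (x y : P ⊗[k] P)
    (t : (P ⊗[k] P) ⊗[k] (P ⊗[k] P)) (ht : A.incl P P t = hG.esComul y) :
    A.incl₃ (x ⊗ₜ t) = hG.comulRight (A.incl P P (x ⊗ₜ y)) := by
  induction x using TensorProduct.induction_add with
  | add a c ha hc => simp only [map_add, add_tmul, ha, hc]
  | tmul a a' =>
    have h1 : A.incl₃ ((a ⊗ₜ a') ⊗ₜ t) = (TensorProduct.mk k P A.PP a ∘ₗ A.mkPP ∘ₗ
        TensorProduct.mk k P P a').rTensor (A.PP ⊗[k] P) (A.incl P P t) := by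
      clear ht
      induction t using TensorProduct.induction_add with
      | add a c ha hc => simp only [map_add, tmul_add, ha, hc]
      | tmul x y =>
        induction x using TensorProduct.induction_add with
        | add a c ha hc => simp only [map_add, tmul_add, add_tmul, ha, hc]
        | tmul q q' =>
          induction y using TensorProduct.induction_add with
          | add a c ha hc => simp only [map_add, tmul_add, ha, hc]
          | tmul r r' => rfl
    rw [h1, ht]
    clear ht h1
    induction y using TensorProduct.induction_add with
    | add a c ha hc => simp only [map_add, tmul_add, ha, hc]
    | tmul c c' =>
      rw [incl_tmul]
      simp only [comulRight, LinearMap.comp_apply, LinearMap.lTensor_tmul, LinearMap.rTensor_tmul,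
        coactPP_mkPP, esComul]
      induction A.coact c using TensorProduct.induction_add with
      | add a c ha hc => simp only [map_add, add_tmul, tmul_add, ha, hc]
      | tmul p h => rfl

/-- Both sides are `p₀ ⊗ τ(p₁) ⊗ τ(p₂) ⊗ q`; the content is `coactPP_coactτ`. -/
theorem IsHopfGalois.esComul_coassoc (hG : A.IsHopfGalois) (z : P ⊗[k] P) :
    hG.coactτ.rTensor (A.PP ⊗[k] P) (hG.esComul z) = hG.comulRight (hG.esComul z) := by
  induction z using TensorProduct.induction_add with
  | add a c ha hc => simp only [map_add, ha, hc]
  | tmul p q =>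
    let g : (P ⊗[k] A.PP) ⊗[k] H →ₗ[k] (P ⊗[k] A.PP) ⊗[k] (A.PP ⊗[k] P) :=
      ((TensorProduct.mk k A.PP P).flip q ∘ₗ hG.τ).lTensor (P ⊗[k] A.PP)
    have h1 : hG.coactτ.rTensor (A.PP ⊗[k] P) (hG.esComul (p ⊗ₜ q)) =
        g (hG.coactτ.rTensor H (A.coact p)) := by
      simp only [esComul, LinearMap.comp_apply, LinearMap.rTensor_tmul]
      induction A.coact p using TensorProduct.induction_add with
      | add a c ha hc => simp only [map_add, add_tmul, ha, hc]
      | tmul p h => rfl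
    have h2 : hG.comulRight (hG.esComul (p ⊗ₜ q)) =
        g ((TensorProduct.assoc k P A.PP H).symm (A.coactPP.lTensor P (hG.coactτ p))) := by
      rw [hG.esComul_tmul]
      induction hG.coactτ p using TensorProduct.induction_add with
      | add a c ha hc => simp only [map_add, add_tmul, ha, hc]
      | tmul p m =>
        simp only [comulRight, LinearMap.comp_apply, LinearMap.lTensor_tmul,
          LinearMap.rTensor_tmul, LinearEquiv.coe_coe, TensorProduct.assoc_tmul]
        induction A.coactPP m using TensorProduct.induction_add with
        | add a c ha hc => simp only [map_add, add_tmul, tmul_add, ha, hc]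
        | tmul m h => rfl
    rw [h1, h2, hG.coactPP_coactτ]

theorem coact_esMul (X Y : P ⊗[k] P) :
    TensorProduct.assoc k P H P (A.coact.rTensor P (esMul X Y)) =
      TensorProduct.map₂ (LinearMap.mul k P)
        (TensorProduct.map₂ (LinearMap.mul k H) (LinearMap.mul k P).flip)
        (TensorProduct.assoc k P H P (A.coact.rTensor P X))
        (TensorProduct.assoc k P H P (A.coact.rTensor P Y)) := by
  induction X using TensorProduct.induction_add with
  | add a c ha hc => simp only [map_add, LinearMap.add_apply, ha, hc]
  | tmul p p' =>
    induction Y using TensorProduct.induction_add with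
    | add a c ha hc => simp only [map_add, ha, hc]
    | tmul q q' =>
      simp only [esMul_tmul, LinearMap.rTensor_tmul, A.coact_mul]
      generalize A.coact p = s
      generalize A.coact q = t
      induction s using TensorProduct.induction_add with
      | add a c ha hc => simp only [map_add, add_mul, add_tmul, LinearMap.add_apply, ha, hc]
      | tmul p h =>
        induction t using TensorProduct.induction_add with
        | add a c ha hc => simp only [map_add, mul_add, add_tmul, ha, hc]
        | tmul q g => simp

namespace IsAdmissible

variable (hA : A.IsAdmissible)

theorem inclC_sum {ι : Type*} [Fintype ι] (a b : ι → A.diagCoinv) :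
    A.inclC (∑ i, a i ⊗ₜ b i) = ∑ i, A.incl P P ((a i : P ⊗[k] P) ⊗ₜ (b i : P ⊗[k] P)) :=
  map_sum A.inclC _ _

theorem sum_incl_sweedler {X : A.diagCoinv} (x : hA.data.Sweedler X) :
    ∑ i, A.incl P P ((x.fst i : P ⊗[k] P) ⊗ₜ (x.snd i : P ⊗[k] P)) = hA.galois.esComul X := by
  rw [← map_sum (A.incl P P), hA.incl_sweedler]

theorem comul_bilinear (b c : A.coinvariants) (X : A.diagCoinv) (x : hA.data.Sweedler X) :
    hA.data.comul (hA.data.mul (hA.data.src b) (hA.data.mul (hA.data.tgt c) X)) =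
      hA.data.mk₂ (∑ i, hA.data.mul (hA.data.src b) (x.fst i) ⊗ₜ[k]
        hA.data.mul (hA.data.tgt c) (x.snd i)) := by
  apply hA.data_comul_eq
  refine (inclC_sum _ _).trans ?_
  refine (Finset.sum_congr rfl fun i _ => incl_bilinear b c _ _).trans ?_
  rw [← map_sum, ← map_sum, hA.incl_sweedler]
  exact (hA.galois.esComul_bilinear b c X).symm

/-- On the two sides `b` multiplies the middle value of `τ` from the left and from the right, so
this is `mulLeftPP_τ_coinv`. -/
theorem takeuchi (b : A.coinvariants) (X : A.diagCoinv) (x : hA.data.Sweedler X) :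
    hA.data.mk₂ (∑ i, hA.data.mul (x.fst i) (hA.data.tgt b) ⊗ₜ[k] x.snd i) =
      hA.data.mk₂ (∑ i, x.fst i ⊗ₜ[k] hA.data.mul (x.snd i) (hA.data.src b)) := by
  rw [hA.data_mk₂_eq_iff]
  refine (inclC_sum _ _).trans ?_
  refine (Finset.sum_congr rfl fun i _ => incl_takeuchi_left b _ _).trans ?_
  refine .trans ?_ (inclC_sum _ _).symm
  refine .trans ?_ (Finset.sum_congr rfl fun i _ => (incl_takeuchi_right b _ _).symm)
  rw [← map_sum (((A.mulLeftPP b).rTensor P).lTensor P),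
    ← map_sum (((A.mulRightPP.flip b).rTensor P).lTensor P), hA.sum_incl_sweedler]
  have h1 : A.mulLeftPP (b : P) ∘ₗ hA.τ = A.mulRightPP.flip (b : P) ∘ₗ hA.τ :=
    LinearMap.ext fun h => hA.mulLeftPP_τ_coinv b h
  simp only [IsHopfGalois.esComul, LinearMap.comp_apply]
  rw [← LinearMap.lTensor_comp_apply, ← LinearMap.rTensor_comp, h1, LinearMap.rTensor_comp,
    LinearMap.lTensor_comp_apply]

theorem coinv_rel₃_eq :
    balRel₃ (fun b => A.coinvMul (A.coinvTgt b)) (fun b => A.coinvMul (A.coinvSrc b)) =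
      balRel₃ (fun b => A.coinvRight (op b)) A.coinvLeft := by
  simp only [coinvMul_tgt, coinvMul_src]

theorem data_mk₃_eq (z z' : A.diagCoinv ⊗[k] (A.diagCoinv ⊗[k] A.diagCoinv))
    (h : A.incl₃ (TensorProduct.map A.diagCoinv.subtype
      (TensorProduct.map A.diagCoinv.subtype A.diagCoinv.subtype) z) =
      A.incl₃ (TensorProduct.map A.diagCoinv.subtype
      (TensorProduct.map A.diagCoinv.subtype A.diagCoinv.subtype) z')) :
    hA.data.mk₃ z = hA.data.mk₃ z' := by
  rw [← sub_eq_zero, ← map_sub, Submodule.mkQ_apply, Submodule.Quotient.mk_eq_zero]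
  change z - z' ∈ balRel₃ (fun b => A.coinvMul (A.coinvTgt b)) (fun b => A.coinvMul (A.coinvSrc b))
  rw [coinv_rel₃_eq]
  apply mk₃_eq_zero hA.galois hA.flat
  rw [map_sub, map_sub, h, sub_self]

theorem coassoc (X : A.diagCoinv) (x : hA.data.Sweedler X)
    (x' : ∀ i, hA.data.Sweedler (x.fst i)) (x'' : ∀ i, hA.data.Sweedler (x.snd i)) :
    hA.data.mk₃ (∑ i, ∑ j, (x' i).fst j ⊗ₜ[k] ((x' i).snd j ⊗ₜ[k] x.snd i)) =
      hA.data.mk₃ (∑ i, ∑ j, x.fst i ⊗ₜ[k] ((x'' i).fst j ⊗ₜ[k] (x'' i).snd j)) := by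
  apply hA.data_mk₃_eq
  simp only [map_sum, TensorProduct.map_tmul, Submodule.subtype_apply]
  have h1 : ∀ i, ∑ j, A.incl₃ (((x' i).fst j : P ⊗[k] P) ⊗ₜ[k]
      (((x' i).snd j : P ⊗[k] P) ⊗ₜ[k] (x.snd i : P ⊗[k] P))) =
      hA.galois.coactτ.rTensor (A.PP ⊗[k] P)
        (A.incl P P ((x.fst i : P ⊗[k] P) ⊗ₜ (x.snd i : P ⊗[k] P))) := by
    intro i
    rw [← hA.galois.incl₃_left _ _ _ (hA.incl_sweedler (x' i)), sum_tmul, map_sum, map_sum]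
    rfl
  have h2 : ∀ i, ∑ j, A.incl₃ ((x.fst i : P ⊗[k] P) ⊗ₜ[k]
      (((x'' i).fst j : P ⊗[k] P) ⊗ₜ[k] ((x'' i).snd j : P ⊗[k] P))) =
      hA.galois.comulRight
        (A.incl P P ((x.fst i : P ⊗[k] P) ⊗ₜ (x.snd i : P ⊗[k] P))) := by
    intro i
    rw [← hA.galois.incl₃_right _ _ _ (hA.incl_sweedler (x'' i)), tmul_sum, map_sum]
  rw [Finset.sum_congr rfl fun i _ => h1 i, Finset.sum_congr rfl fun i _ => h2 i,
    ← map_sum (hA.galois.coactτ.rTensor (A.PP ⊗[k] P)), ← map_sum hA.galois.comulRight,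
    hA.sum_incl_sweedler, hA.galois.esComul_coassoc]

/-- With `(p ⊗ x) ⊗ (y ⊗ p')` for the coproduct, the term is `((p x) y) ⊗ p'`, so the middle pair
cancels by `Collapses.left`. -/
theorem counit_left (X : A.diagCoinv) (x : hA.data.Sweedler X) :
    ∑ i, hA.data.mul (hA.data.src (hA.data.counit (x.fst i))) (x.snd i) = X := by
  apply Subtype.ext
  refine .trans ?_ (hA.collapses_sweedler x).left
  rw [map_sum, AddSubmonoidClass.coe_finsetSum]
  exact Finset.sum_congr rfl fun i _ => esMul_src _ _

theorem counit_right (X : A.diagCoinv) (x : hA.data.Sweedler X) :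
    ∑ i, hA.data.mul (hA.data.tgt (hA.data.counit (x.snd i))) (x.fst i) = X := by
  apply Subtype.ext
  refine .trans ?_ (hA.collapses_sweedler x).right
  rw [map_sum, AddSubmonoidClass.coe_finsetSum]
  exact Finset.sum_congr rfl fun i _ => esMul_tgt _ _

theorem comul_one : hA.data.comul hA.data.one = hA.data.mk₂ (hA.data.one ⊗ₜ[k] hA.data.one) := by
  apply hA.data_comul_eq
  change A.incl P P ((1 ⊗ₜ 1) ⊗ₜ (1 ⊗ₜ 1)) = hA.galois.esComul (1 ⊗ₜ 1)
  rw [hA.galois.esComul_tmul, IsHopfGalois.coactτ, LinearMap.comp_apply, A.coact_one,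
    LinearMap.lTensor_tmul, hA.galois.τ_one]
  rfl

/-- Multiplicativity of `τ`, in the form of `Lifts.mul`, together with multiplicativity of the
coaction. -/
theorem comul_mul (X Y : A.diagCoinv) (x : hA.data.Sweedler X) (y : hA.data.Sweedler Y) :
    hA.data.comul (hA.data.mul X Y) =
      hA.data.mk₂ (∑ i, ∑ j, hA.data.mul (x.fst i) (y.fst j) ⊗ₜ[k]
        hA.data.mul (x.snd i) (y.snd j)) := by
  apply hA.data_comul_eq
  have h := (hA.lifts_sweedler x).mul (hA.lifts_sweedler y) (LinearMap.mul k P)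
    (LinearMap.mul k P).flip
  rw [Lifts, ← coact_esMul, map_sum_sum] at h
  refine .trans ?_ h
  simp only [map_sum]
  rfl

/-! ### The counit is a left character -/

/-- `((u q') p')` as a function of `u ⊗ (p' ⊗ q')`. -/
def mulBack : P ⊗[k] (P ⊗[k] P) →ₗ[k] P :=
  TensorProduct.lift (mulL.compl₂ (TensorProduct.comm k P P).toLinearMap)

/-- With `x = c ⊗ c'` and `Y = d ⊗ d'` this is `((b (c d)) d') c' = b ((c (d d')) c')`: `b` comes
out because it lies in `B`, and `(c d) d' = c (d d')` because `Y` is coinvariant. -/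
theorem mulBack_map₂ (hA : A.IsAdmissible) (b : A.coinvariants) (x : P ⊗[k] P) (Y : A.diagCoinv) :
    mulBack ((LinearMap.mul k P b).rTensor (P ⊗[k] P)
      (TensorProduct.map₂ (LinearMap.mul k P) (TensorProduct.mk k P P) x Y)) =
      b * LinearMap.mul' k P (esMul x (LinearMap.mul' k P Y ⊗ₜ 1)) := by
  induction x using TensorProduct.induction_add with
  | add a c ha hc => simp only [map_add, LinearMap.add_apply, mul_add, ha, hc]
  | tmul c c' =>
    have h1 : ∀ z : P ⊗[k] P, mulBack ((LinearMap.mul k P b).rTensor (P ⊗[k] P)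
        (TensorProduct.map₂ (LinearMap.mul k P) (TensorProduct.mk k P P) (c ⊗ₜ c') z)) =
        b * (LinearMap.mul' k P ((LinearMap.mul k P c).rTensor P z) * c') := by
      intro z
      induction z using TensorProduct.induction_add with
      | add a c ha hc => simp only [map_add, mul_add, add_mul, ha, hc]
      | tmul d d' =>
        change ((b * (c * d)) * d') * c' = b * (((c * d) * d') * c')
        rw [A.mul_assoc_left, A.mul_assoc_left]
    rw [h1, ← hA.left, esMul_tmul, one_mul]
    rfl

theorem nonempty_sweedler (X : A.diagCoinv) : Nonempty (hA.data.Sweedler X) := by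
  obtain ⟨z, hz⟩ := hA.galois.exists_comul hA.flat X
  obtain ⟨⟨n, a, b, rfl⟩⟩ := TensorRepr.nonempty z
  exact ⟨⟨n, a, b, (hA.data_comul_eq X _ hz).symm⟩⟩

/-- Collapse the product of the two coproducts with the outer right legs kept apart as `p' ⊗ q'`,
then multiply back to `((p q) q') p'`. Both sides are values of `mulBack_map₂`. -/
theorem counit_mul_counit_src (X Y : A.diagCoinv) (x : hA.data.Sweedler X)
    (y : hA.data.Sweedler Y) :
    ∑ i, ∑ j, hA.data.counit (hA.data.mul (x.fst i) (y.fst j)) *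
      hA.data.counit (hA.data.mul (x.snd i) (hA.data.src (hA.data.counit (y.snd j)))) =
      hA.data.counit (hA.data.mul X (hA.data.src (hA.data.counit Y))) := by
  have h := ((hA.collapses_sweedler x).mul (hA.collapses_sweedler y) (LinearMap.mul k P)
    (TensorProduct.mk k P P)).left
  rw [map_sum_sum, map_sum] at h
  simp only [map_sum (TensorProduct.lift _)] at h
  have h1 := congrArg mulBack h
  simp only [map_sum mulBack] at h1
  have h2 := mulBack_map₂ hA 1 (X : P ⊗[k] P) Y
  have h3 : ((1 : A.coinvariants) : P) = 1 := rfl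
  have h4 : LinearMap.mul k P 1 = LinearMap.id := LinearMap.ext one_mul
  rw [h3, one_mul, h4, LinearMap.rTensor_id, LinearMap.id_apply] at h2
  apply Subtype.ext
  refine .trans ?_ (h1.trans h2)
  simp only [AddSubmonoidClass.coe_finsetSum]
  refine Finset.sum_congr rfl fun i _ => Finset.sum_congr rfl fun j _ => ?_
  exact (mulBack_map₂ hA (hA.data.counit (hA.data.mul (x.fst i) (y.fst j))) (x.snd i : P ⊗[k] P)
    (y.snd j)).symm

theorem counit_tgt_mul (b : A.coinvariants) (X : A.diagCoinv) :
    hA.data.counit (hA.data.mul (hA.data.tgt b) X) = hA.data.counit X * b :=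
  Subtype.ext (mul'_esMul_tgt b _)

theorem counit_src_mul (b : A.coinvariants) (X : A.diagCoinv) :
    hA.data.counit (hA.data.mul (hA.data.src b) X) = b * hA.data.counit X :=
  Subtype.ext (mul'_esMul_src b _)

theorem tgt_assoc_left (b : A.coinvariants) (X Y : A.diagCoinv) :
    hA.data.mul (hA.data.mul (hA.data.tgt b) X) Y = hA.data.mul (hA.data.tgt b) (hA.data.mul X Y) :=
  Subtype.ext (esMul_tgt_left b _ _)

theorem tgt_assoc_mid (b : A.coinvariants) (X Y : A.diagCoinv) :
    hA.data.mul (hA.data.mul X (hA.data.tgt b)) Y = hA.data.mul X (hA.data.mul (hA.data.tgt b) Y) :=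
  Subtype.ext (esMul_tgt_mid b _ _)

theorem src_assoc_right (b : A.coinvariants) (X Y : A.diagCoinv) :
    hA.data.mul (hA.data.mul X Y) (hA.data.src b) = hA.data.mul X (hA.data.mul Y (hA.data.src b)) :=
  Subtype.ext (esMul_src_right b _ _)

/-- The Takeuchi condition, pushed through the map `U ⊗_B W ↦ ε(U V) ε(W)`, which respects the
relations over `B`. -/
theorem counit_takeuchi (b : A.coinvariants) (X V : A.diagCoinv) (x : hA.data.Sweedler X) :
    ∑ i, hA.data.counit (hA.data.mul (x.fst i) V) *
      hA.data.counit (hA.data.mul (x.snd i) (hA.data.src b)) =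
    ∑ i, hA.data.counit (hA.data.mul (hA.data.mul (x.fst i) (hA.data.tgt b)) V) *
      hA.data.counit (x.snd i) := by
  let f : A.diagCoinv ⊗[k] A.diagCoinv →ₗ[k] A.coinvariants :=
    TensorProduct.lift ((LinearMap.mul k A.coinvariants).compl₁₂
      (hA.data.counit ∘ₗ hA.data.mul.flip V) hA.data.counit)
  have hf : ∀ (b : A.coinvariants) (U W : A.diagCoinv),
      f (hA.data.mul (hA.data.tgt b) U ⊗ₜ W) = f (U ⊗ₜ hA.data.mul (hA.data.src b) W) := by
    intro b U W
    change hA.data.counit (hA.data.mul (hA.data.mul (hA.data.tgt b) U) V) * hA.data.counit W =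
      hA.data.counit (hA.data.mul U V) * hA.data.counit (hA.data.mul (hA.data.src b) W)
    rw [tgt_assoc_left, counit_tgt_mul, counit_src_mul, mul_assoc]
  have h := congrArg (BalTensor.lift _ _ f hf) (hA.takeuchi b X x)
  change f _ = f _ at h
  rw [map_sum, map_sum] at h
  exact h.symm

theorem sum_counit_mul_counit (X V : A.diagCoinv) (x : hA.data.Sweedler X) :
    ∑ i, hA.data.counit (hA.data.mul (x.fst i) V) * hA.data.counit (x.snd i) =
      hA.data.counit (hA.data.mul X V) := by
  conv_rhs => rw [← hA.counit_right X x]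
  rw [map_sum, LinearMap.sum_apply, map_sum]
  refine Finset.sum_congr rfl fun i _ => ?_
  rw [tgt_assoc_left, counit_tgt_mul]

/-- Expand `ε(X s(ε(Y)))` as `ε(X₁Y₁) ε(X₂ s(ε(Y₂)))`, move `s(ε(Y₂))` over to `X₁` as `t(ε(Y₂))`,
and absorb it into `Y₁` by counitality of `Y`. Counitality of `X` removes `ε(X₂)`. -/
theorem counit_mul_src (X Y : A.diagCoinv) :
    hA.data.counit (hA.data.mul X (hA.data.src (hA.data.counit Y))) =
      hA.data.counit (hA.data.mul X Y) := by
  obtain ⟨x⟩ := hA.nonempty_sweedler X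
  obtain ⟨y⟩ := hA.nonempty_sweedler Y
  rw [← hA.counit_mul_counit_src X Y x y, Finset.sum_comm,
    Finset.sum_congr rfl fun j _ => hA.counit_takeuchi _ X _ x, Finset.sum_comm,
    ← hA.sum_counit_mul_counit X Y x]
  refine Finset.sum_congr rfl fun i _ => ?_
  conv_rhs => rw [← hA.counit_right Y y]
  rw [map_sum, map_sum, Finset.sum_mul]
  exact Finset.sum_congr rfl fun j _ => by rw [tgt_assoc_mid]

theorem counit_mul_tgt (X Y : A.diagCoinv) :
    hA.data.counit (hA.data.mul X (hA.data.tgt (hA.data.counit Y))) =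
      hA.data.counit (hA.data.mul X Y) := by
  rw [← hA.counit_mul_src X Y]
  generalize hA.data.counit Y = b
  exact Subtype.ext (LinearMap.congr_fun
    (f := LinearMap.mul' k P ∘ₗ esMul.flip (1 ⊗ₜ (b : P)))
    (g := LinearMap.mul' k P ∘ₗ esMul.flip ((b : P) ⊗ₜ 1))
    (TensorProduct.ext' fun p q => by simp [A.mul_assoc_mid]) (X : P ⊗[k] P))

/-- Under the counit `Z` may be replaced by `s(ε(Z))`, which associates with everything. -/
theorem counit_mul_assoc (X Y Z : A.diagCoinv) :
    hA.data.counit (hA.data.mul (hA.data.mul X Y) Z) =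
      hA.data.counit (hA.data.mul X (hA.data.mul Y Z)) := by
  rw [← hA.counit_mul_src _ Z, src_assoc_right, ← hA.counit_mul_src X, hA.counit_mul_src Y Z,
    hA.counit_mul_src X]

end IsAdmissible

/-! ### Iterated collapsing -/

section Trilinear

/-- `(p, q ⊗ r) ↦ r (q p)`. -/
def mulRevR : P →ₗ[k] P ⊗[k] P →ₗ[k] P :=
  (mulR ∘ₗ (TensorProduct.comm k P P).toLinearMap).flip

/-- `(p ⊗ q, r) ↦ (r q) p`. -/
def mulRevL : P ⊗[k] P →ₗ[k] P →ₗ[k] P :=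
  (mulL.compl₂ (TensorProduct.comm k P P).toLinearMap).flip

/-- `(p ⊗ (q ⊗ r), s) ↦ p (q (r s))`. -/
def mulRR : P ⊗[k] (P ⊗[k] P) →ₗ[k] P →ₗ[k] P :=
  ((LinearMap.lTensorHom P ∘ₗ mulR.flip).compr₂ (LinearMap.mul' k P)).flip

theorem phiTensor_eq_mulRevR (X Y Z : P ⊗[k] P) : phiTensor X Y Z =
    TensorProduct.map₂ (LinearMap.mul k P) mulRevR X
      (TensorProduct.map₂ (LinearMap.mul k P) (TensorProduct.mk k P P) Y Z) := by
  unfold phiTensor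
  induction X using TensorProduct.induction_add with
  | add a c ha hc => simp only [map_add, LinearMap.add_apply, ha, hc]
  | tmul p p' =>
    induction Y using TensorProduct.induction_add with
    | add a c ha hc => simp only [map_add, LinearMap.add_apply, ha, hc]
    | tmul q q' =>
      induction Z using TensorProduct.induction_add with
      | add a c ha hc => simp only [map_add, ha, hc]
      | tmul r r' => rfl

theorem psiTensor_eq_mulRevL (X Y Z : P ⊗[k] P) : psiTensor X Y Z =
    TensorProduct.map₂ (LinearMap.mul k P) mulRevL
      (TensorProduct.map₂ (LinearMap.mul k P) (TensorProduct.mk k P P) X Y) Z := by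
  unfold psiTensor
  induction X using TensorProduct.induction_add with
  | add a c ha hc => simp only [map_add, LinearMap.add_apply, ha, hc]
  | tmul p p' =>
    induction Y using TensorProduct.induction_add with
    | add a c ha hc => simp only [map_add, LinearMap.add_apply, ha, hc]
    | tmul q q' =>
      induction Z using TensorProduct.induction_add with
      | add a c ha hc => simp only [map_add, ha, hc]
      | tmul r r' => rfl

theorem esMul_esMul_eq_mulR (X Y Z : P ⊗[k] P) : TensorProduct.map₂ mulR mulRevL
    (TensorProduct.map₂ (TensorProduct.mk k P P) (TensorProduct.mk k P P) X Y) Z =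
      esMul X (esMul Y Z) := by
  induction X using TensorProduct.induction_add with
  | add a c ha hc => simp only [map_add, LinearMap.add_apply, ha, hc]
  | tmul p p' =>
    induction Y using TensorProduct.induction_add with
    | add a c ha hc => simp only [map_add, LinearMap.add_apply, ha, hc]
    | tmul q q' =>
      induction Z using TensorProduct.induction_add with
      | add a c ha hc => simp only [map_add, ha, hc]
      | tmul r r' => rfl

theorem esMul_esMul_eq_mulL (X Y Z : P ⊗[k] P) : TensorProduct.map₂ mulL mulRevR X
    (TensorProduct.map₂ (TensorProduct.mk k P P) (TensorProduct.mk k P P) Y Z) =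
      esMul (esMul X Y) Z := by
  induction X using TensorProduct.induction_add with
  | add a c ha hc => simp only [map_add, LinearMap.add_apply, ha, hc]
  | tmul p p' =>
    induction Y using TensorProduct.induction_add with
    | add a c ha hc => simp only [map_add, LinearMap.add_apply, ha, hc]
    | tmul q q' =>
      induction Z using TensorProduct.induction_add with
      | add a c ha hc => simp only [map_add, ha, hc]
      | tmul r r' => rfl

theorem phiTensor_esMul_right (X Y Z W : P ⊗[k] P) : phiTensor X Y (esMul Z W) =
    TensorProduct.map₂ (mulR.compl₂ (LinearMap.mul' k P)) (LinearMap.mul k P).flip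
      (TensorProduct.map₂ (TensorProduct.mk k P P) (LinearMap.mul k P).flip X Y)
      (TensorProduct.map₂ (TensorProduct.mk k P P) (LinearMap.mul k P).flip Z W) := by
  unfold phiTensor
  generalize TensorProduct.map₂ (TensorProduct.mk k P P) (LinearMap.mul k P).flip X Y = V
  induction Z using TensorProduct.induction_add with
  | add a c ha hc => simp only [map_add, LinearMap.add_apply, ha, hc]
  | tmul p p' =>
    induction W using TensorProduct.induction_add with
    | add a c ha hc => simp only [map_add, ha, hc]
    | tmul q q' =>
      induction V using TensorProduct.induction_add with
      | add a c ha hc => simp only [map_add, LinearMap.add_apply, ha, hc]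
      | tmul r r' => rfl

theorem phiTensor_esMul_left (X Y Z W : P ⊗[k] P) : phiTensor (esMul X Y) Z W =
    TensorProduct.map₂ (LinearMap.mul k P)
      (mulRevR ∘ₗ LinearMap.mul' k P ∘ₗ (TensorProduct.comm k P P).toLinearMap)
      (TensorProduct.map₂ (LinearMap.mul k P) (TensorProduct.mk k P P) X Y)
      (TensorProduct.map₂ (LinearMap.mul k P) (TensorProduct.mk k P P) Z W) := by
  rw [phiTensor_eq_mulRevR]
  generalize TensorProduct.map₂ (LinearMap.mul k P) (TensorProduct.mk k P P) Z W = V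
  induction X using TensorProduct.induction_add with
  | add a c ha hc => simp only [map_add, LinearMap.add_apply, ha, hc]
  | tmul p p' =>
    induction Y using TensorProduct.induction_add with
    | add a c ha hc => simp only [map_add, LinearMap.add_apply, ha, hc]
    | tmul q q' =>
      induction V using TensorProduct.induction_add with
      | add a c ha hc => simp only [map_add, ha, hc]
      | tmul r r' => rfl

theorem phiTensor_src_mul (b : A.coinvariants) (X Y Z : P ⊗[k] P) :
    phiTensor X (esMul ((b : P) ⊗ₜ 1) Y) Z =
    TensorProduct.map₂ (LinearMap.mul k P) mulRevR X ((LinearMap.mul k P b).rTensor _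
      (TensorProduct.map₂ (LinearMap.mul k P) (TensorProduct.mk k P P) Y Z)) := by
  rw [phiTensor_eq_mulRevR]
  congr 1
  induction Y using TensorProduct.induction_add with
  | add a c ha hc => simp only [map_add, LinearMap.add_apply, ha, hc]
  | tmul p p' =>
    induction Z using TensorProduct.induction_add with
    | add a c ha hc => simp only [map_add, ha, hc]
    | tmul q q' => simp [A.mul_assoc_left]

theorem map₂_mulRevR_mulR (X Y Z W : P ⊗[k] P) :
    TensorProduct.map₂ (LinearMap.mul k P) mulRevR X
      (TensorProduct.map₂ mulR (TensorProduct.mk k P P)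
        (TensorProduct.map₂ (TensorProduct.mk k P P) (LinearMap.mul k P).flip Y Z) W) =
    TensorProduct.map₂ mulRR (LinearMap.mul k P).flip
      (TensorProduct.map₂ (TensorProduct.mk k P (P ⊗[k] P)) (LinearMap.mul k P).flip X
        (TensorProduct.map₂ (TensorProduct.mk k P P) (LinearMap.mul k P).flip Y Z)) W := by
  generalize TensorProduct.map₂ (TensorProduct.mk k P P) (LinearMap.mul k P).flip Y Z = V
  induction X using TensorProduct.induction_add with
  | add a c ha hc => simp only [map_add, LinearMap.add_apply, ha, hc]
  | tmul p p' =>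
    induction V using TensorProduct.induction_add with
    | add a c ha hc => simp only [map_add, LinearMap.add_apply, ha, hc]
    | tmul q q' =>
      induction W using TensorProduct.induction_add with
      | add a c ha hc => simp only [map_add, ha, hc]
      | tmul r r' => rfl

theorem map₂_mulRR_mulRight (b : A.coinvariants) (U : (P ⊗[k] (P ⊗[k] P)) ⊗[k] P)
    (W : P ⊗[k] P) :
    TensorProduct.map₂ mulRR (LinearMap.mul k P).flip
      (((LinearMap.mul k P).flip (b : P)).lTensor _ U) W =
    esMul (1 ⊗ₜ (b : P)) (TensorProduct.map₂ mulRR (LinearMap.mul k P).flip U W) := by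
  induction U using TensorProduct.induction_add with
  | add a c ha hc => simp only [map_add, LinearMap.add_apply, ha, hc]
  | tmul p p' =>
    induction W using TensorProduct.induction_add with
    | add a c ha hc => simp only [map_add, ha, hc]
    | tmul q q' => simp [A.mul_assoc_right]

theorem map₂_mulR_mulRevR (X Y Z W : P ⊗[k] P) :
    TensorProduct.map₂ (mulR.compl₂ (LinearMap.mul' k P))
      (mulRevR ∘ₗ LinearMap.mul' k P ∘ₗ (TensorProduct.comm k P P).toLinearMap)
      (TensorProduct.map₂ (TensorProduct.mk k P P) (TensorProduct.mk k P P) X Y)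
      (TensorProduct.map₂ (TensorProduct.mk k P P) (TensorProduct.mk k P P) Z W) =
    TensorProduct.map₂ mulRR (LinearMap.mul k P).flip
      (TensorProduct.map₂ (TensorProduct.mk k P (P ⊗[k] P)) mulRevR X
        (TensorProduct.map₂ (TensorProduct.mk k P P) (TensorProduct.mk k P P) Y Z)) W := by
  induction X using TensorProduct.induction_add with
  | add a c ha hc => simp only [map_add, LinearMap.add_apply, ha, hc]
  | tmul p p' =>
    induction Y using TensorProduct.induction_add with
    | add a c ha hc => simp only [map_add, LinearMap.add_apply, ha, hc]
    | tmul q q' =>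
      induction Z using TensorProduct.induction_add with
      | add a c ha hc => simp only [map_add, LinearMap.add_apply, ha, hc]
      | tmul r r' =>
        induction W using TensorProduct.induction_add with
        | add a c ha hc => simp only [map_add, ha, hc]
        | tmul s s' => rfl

end Trilinear

section Sums

variable {M N W : Type*} [AddCommGroup M] [Module k M] [AddCommGroup N] [Module k N]
  [AddCommGroup W] [Module k W] {ι ι' κ κ' : Type*} [Fintype ι] [Fintype ι'] [Fintype κ]
  [Fintype κ']

theorem map_sum₂_sum (f : M →ₗ[k] N →ₗ[k] W) (a : ι → ι' → M) (b : κ → N) :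
    f (∑ i, ∑ j, a i j) (∑ l, b l) = ∑ i, ∑ j, ∑ l, f (a i j) (b l) := by
  rw [map_sum f, LinearMap.sum_apply]
  exact Finset.sum_congr rfl fun i _ => map_sum_sum f _ _

theorem map_sum_sum₂ (f : M →ₗ[k] N →ₗ[k] W) (a : ι → M) (b : κ → κ' → N) :
    f (∑ i, a i) (∑ j, ∑ l, b j l) = ∑ i, ∑ j, ∑ l, f (a i) (b j l) := by
  rw [map_sum_sum]
  exact Finset.sum_congr rfl fun i _ => Finset.sum_congr rfl fun j _ => map_sum _ _ _

theorem map_sum₂_sum₂ (f : M →ₗ[k] N →ₗ[k] W) (a : ι → ι' → M) (b : κ → κ' → N) :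
    f (∑ i, ∑ j, a i j) (∑ l, ∑ m, b l m) = ∑ i, ∑ j, ∑ l, ∑ m, f (a i j) (b l m) := by
  rw [map_sum f, LinearMap.sum_apply]
  exact Finset.sum_congr rfl fun i _ => map_sum_sum₂ f _ _

end Sums

namespace IsAdmissible

variable {hA : A.IsAdmissible} {X Y Z W : A.diagCoinv}
  {V V' V'' : Type*} [AddCommGroup V] [Module k V] [AddCommGroup V'] [Module k V']
  [AddCommGroup V''] [Module k V'']

/-- Nesting the product to the left brackets the middle legs as `x₃ (x₂ x₁)` and `(y₁ y₂) y₃`. The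
first is the right half of `Φ`, the second the left half of `(X Y) Z` or of `Φ⁻¹`; so this form
serves when `Φ` is evaluated on the first components. -/
theorem sum_collapse_left (x : hA.data.Sweedler X) (y : hA.data.Sweedler Y)
    (z : hA.data.Sweedler Z) (F : P →ₗ[k] P →ₗ[k] V) (F' : V →ₗ[k] P →ₗ[k] P)
    (G : P →ₗ[k] P →ₗ[k] V') (G' : V' →ₗ[k] P →ₗ[k] V'') :
    ∑ i, ∑ j, ∑ l, (LinearMap.mul k P (LinearMap.mul' k P
        (TensorProduct.map₂ F' (LinearMap.mul k P).flip
          (TensorProduct.map₂ F (LinearMap.mul k P).flip (x.fst i : P ⊗[k] P)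
            (y.fst j : P ⊗[k] P)) (z.fst l : P ⊗[k] P)))).rTensor V''
      (TensorProduct.map₂ (LinearMap.mul k P) G'
        (TensorProduct.map₂ (LinearMap.mul k P) G (x.snd i : P ⊗[k] P) (y.snd j : P ⊗[k] P))
        (z.snd l : P ⊗[k] P)) =
      TensorProduct.map₂ F' G' (TensorProduct.map₂ F G (X : P ⊗[k] P) (Y : P ⊗[k] P))
        (Z : P ⊗[k] P) := by
  refine .trans ?_ (((hA.collapses_sweedler x).mul (hA.collapses_sweedler y) F G).mul
    (hA.collapses_sweedler z) F' G').left
  rw [map_sum_sum, map_sum₂_sum]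
  simp only [map_sum (TensorProduct.lift _)]
  rfl

/-- Nesting to the right brackets the middle legs as `(x₃ x₂) x₁` and `y₁ (y₂ y₃)`, which fits `Φ`
evaluated on the second components. -/
theorem sum_collapse_right (x : hA.data.Sweedler X) (y : hA.data.Sweedler Y)
    (z : hA.data.Sweedler Z) (F : P →ₗ[k] P →ₗ[k] V) (F' : P →ₗ[k] V →ₗ[k] V'')
    (G : P →ₗ[k] P →ₗ[k] V') (G' : P →ₗ[k] V' →ₗ[k] P) :
    ∑ i, ∑ j, ∑ l, ((LinearMap.mul k P).flip (LinearMap.mul' k P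
        (TensorProduct.map₂ (LinearMap.mul k P) G' (x.snd i : P ⊗[k] P)
          (TensorProduct.map₂ (LinearMap.mul k P) G (y.snd j : P ⊗[k] P)
            (z.snd l : P ⊗[k] P))))).lTensor V''
      (TensorProduct.map₂ F' (LinearMap.mul k P).flip (x.fst i : P ⊗[k] P)
        (TensorProduct.map₂ F (LinearMap.mul k P).flip (y.fst j : P ⊗[k] P)
          (z.fst l : P ⊗[k] P))) =
      TensorProduct.map₂ F' G' (X : P ⊗[k] P)
        (TensorProduct.map₂ F G (Y : P ⊗[k] P) (Z : P ⊗[k] P)) := by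
  refine .trans ?_ ((hA.collapses_sweedler x).mul ((hA.collapses_sweedler y).mul
    (hA.collapses_sweedler z) F G) F' G').right
  rw [map_sum_sum, map_sum_sum₂]
  simp only [map_sum (TensorProduct.lift _)]
  rfl

theorem sum_collapse_left_pairs {U U' : Type*} [AddCommGroup U] [Module k U] [AddCommGroup U']
    [Module k U'] (x : hA.data.Sweedler X) (y : hA.data.Sweedler Y)
    (z : hA.data.Sweedler Z) (w : hA.data.Sweedler W) (F₁ : P →ₗ[k] P →ₗ[k] V)
    (F₂ : P →ₗ[k] P →ₗ[k] U) (G₁ : P →ₗ[k] P →ₗ[k] V') (G₂ : P →ₗ[k] P →ₗ[k] U')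
    (F : V →ₗ[k] U →ₗ[k] P) (G : V' →ₗ[k] U' →ₗ[k] V'') :
    ∑ i, ∑ j, ∑ l, ∑ m, (LinearMap.mul k P (LinearMap.mul' k P
        (TensorProduct.map₂ F (LinearMap.mul k P).flip
          (TensorProduct.map₂ F₁ (LinearMap.mul k P).flip (x.fst i : P ⊗[k] P)
            (y.fst j : P ⊗[k] P))
          (TensorProduct.map₂ F₂ (LinearMap.mul k P).flip (z.fst l : P ⊗[k] P)
            (w.fst m : P ⊗[k] P))))).rTensor V''
      (TensorProduct.map₂ (LinearMap.mul k P) G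
        (TensorProduct.map₂ (LinearMap.mul k P) G₁ (x.snd i : P ⊗[k] P) (y.snd j : P ⊗[k] P))
        (TensorProduct.map₂ (LinearMap.mul k P) G₂ (z.snd l : P ⊗[k] P)
          (w.snd m : P ⊗[k] P))) =
      TensorProduct.map₂ F G (TensorProduct.map₂ F₁ G₁ (X : P ⊗[k] P) (Y : P ⊗[k] P))
        (TensorProduct.map₂ F₂ G₂ (Z : P ⊗[k] P) (W : P ⊗[k] P)) := by
  refine .trans ?_ (((hA.collapses_sweedler x).mul (hA.collapses_sweedler y) F₁ G₁).mul
    ((hA.collapses_sweedler z).mul (hA.collapses_sweedler w) F₂ G₂) F G).left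
  rw [map_sum_sum _ (fun i => (x.fst i : P ⊗[k] P) ⊗ₜ[k] (x.snd i : P ⊗[k] P)),
    map_sum_sum _ (fun i => (z.fst i : P ⊗[k] P) ⊗ₜ[k] (z.snd i : P ⊗[k] P)),
    map_sum₂_sum₂]
  simp only [map_sum (TensorProduct.lift _)]
  rfl

end IsAdmissible

/-! ### The 3-cocycle -/

namespace IsAdmissible

variable (hA : A.IsAdmissible)

/-- The collapse leaves `p (q r) ⊗ (r' q') p'`, which is `X (Y Z)`; multiplying its legs gives the
convolution unit. -/
theorem conv_cocycle_cocycleInv : hA.data.ConvEqUnit A.cocycle A.cocycleInv := by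
  intro X Y Z x y z
  refine ⟨?_, hA.counit_mul_assoc X Y Z⟩
  rw [hA.counit_mul_assoc]
  apply Subtype.ext
  have h := congrArg (LinearMap.mul' k P) (sum_collapse_left x y z (TensorProduct.mk k P P) mulR
    (TensorProduct.mk k P P) mulRevL)
  rw [esMul_esMul_eq_mulR] at h
  refine .trans ?_ h
  simp only [AddSubmonoidClass.coe_finsetSum, map_sum (LinearMap.mul' k P)]
  refine Finset.sum_congr rfl fun i _ => Finset.sum_congr rfl fun j _ =>
    Finset.sum_congr rfl fun l _ => ?_
  rw [← psiTensor_eq_mulRevL, ← esMul_src]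
  exact (mul'_esMul_src (A.cocycle (x.fst i) (y.fst j) (z.fst l)) _).symm

/-- Here the collapse leaves `(p q) r ⊗ r' (q' p')`, which is `(X Y) Z`. -/
theorem conv_cocycleInv_cocycle : hA.data.ConvEqUnit A.cocycleInv A.cocycle := by
  intro X Y Z x y z
  refine ⟨?_, hA.counit_mul_assoc X Y Z⟩
  apply Subtype.ext
  have h := congrArg (LinearMap.mul' k P) (sum_collapse_right x y z (TensorProduct.mk k P P) mulL
    (TensorProduct.mk k P P) mulRevR)
  rw [esMul_esMul_eq_mulL] at h
  refine .trans ?_ h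
  simp only [AddSubmonoidClass.coe_finsetSum, map_sum (LinearMap.mul' k P)]
  refine Finset.sum_congr rfl fun i _ => Finset.sum_congr rfl fun j _ =>
    Finset.sum_congr rfl fun l _ => ?_
  rw [← phiTensor_eq_mulRevR, ← esMul_tgt]
  exact (mul'_esMul_tgt (A.cocycle (x.snd i) (y.snd j) (z.snd l)) _).symm

theorem quasi_assoc_left (X Y Z : A.diagCoinv) (x : hA.data.Sweedler X) (y : hA.data.Sweedler Y)
    (z : hA.data.Sweedler Z) :
    ((∑ i, ∑ j, ∑ l, hA.data.mul (hA.data.src (A.cocycle (x.fst i) (y.fst j) (z.fst l)))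
      (hA.data.mul (hA.data.mul (x.snd i) (y.snd j)) (z.snd l)) : A.diagCoinv) : P ⊗[k] P) =
      phiTensor (X : P ⊗[k] P) (Y : P ⊗[k] P) (Z : P ⊗[k] P) := by
  refine .trans ?_ (sum_collapse_left x y z (TensorProduct.mk k P P) mulR
    (LinearMap.mul k P).flip (LinearMap.mul k P).flip)
  simp only [AddSubmonoidClass.coe_finsetSum]
  refine Finset.sum_congr rfl fun i _ => Finset.sum_congr rfl fun j _ =>
    Finset.sum_congr rfl fun l _ => ?_
  exact esMul_src _ _

theorem quasi_assoc_right (X Y Z : A.diagCoinv) (x : hA.data.Sweedler X) (y : hA.data.Sweedler Y)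
    (z : hA.data.Sweedler Z) :
    ((∑ i, ∑ j, ∑ l, hA.data.mul (hA.data.tgt (A.cocycle (x.snd i) (y.snd j) (z.snd l)))
      (hA.data.mul (x.fst i) (hA.data.mul (y.fst j) (z.fst l))) : A.diagCoinv) : P ⊗[k] P) =
      phiTensor (X : P ⊗[k] P) (Y : P ⊗[k] P) (Z : P ⊗[k] P) := by
  rw [phiTensor_eq_mulRevR]
  refine .trans ?_ (sum_collapse_right x y z (LinearMap.mul k P) (LinearMap.mul k P)
    (TensorProduct.mk k P P) mulRevR)
  simp only [AddSubmonoidClass.coe_finsetSum]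
  refine Finset.sum_congr rfl fun i _ => Finset.sum_congr rfl fun j _ =>
    Finset.sum_congr rfl fun l _ => ?_
  rw [← phiTensor_eq_mulRevR]
  exact esMul_tgt _ _

/-- Both sides of the 3-cocycle identity are `(p (q (r s))) (s' (r' (q' p')))`. -/
def cocycleForm (X Y Z W : P ⊗[k] P) : P :=
  LinearMap.mul' k P (TensorProduct.map₂ mulRR (LinearMap.mul k P).flip
      (TensorProduct.map₂ (TensorProduct.mk k P (P ⊗[k] P)) mulRevR X
        (TensorProduct.map₂ (TensorProduct.mk k P P) (TensorProduct.mk k P P) Y Z)) W)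

/-- The four coproducts are multiplied in the pairs `X, Y` and `Z, W`: the middle legs are then
bracketed as `(x₄ x₃)(x₂ x₁)` and `(y₁ y₂)(y₃ y₄)`, as in `Φ(X₁, Y₁, Z₁W₁)` and `Φ(X₂Y₂, Z₂, W₂)`.
-/
theorem cocycle_left (X Y Z W : A.diagCoinv) (x : hA.data.Sweedler X) (y : hA.data.Sweedler Y)
    (z : hA.data.Sweedler Z) (w : hA.data.Sweedler W) :
    ((∑ i, ∑ j, ∑ l, ∑ m, A.cocycle (x.fst i) (y.fst j) (hA.data.mul (z.fst l) (w.fst m)) *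
      A.cocycle (hA.data.mul (x.snd i) (y.snd j)) (z.snd l) (w.snd m) : A.coinvariants) : P) =
      cocycleForm (X : P ⊗[k] P) (Y : P ⊗[k] P) (Z : P ⊗[k] P) (W : P ⊗[k] P) := by
  have h := congrArg (LinearMap.mul' k P) (sum_collapse_left_pairs x y z w
    (TensorProduct.mk k P P) (TensorProduct.mk k P P) (TensorProduct.mk k P P)
    (TensorProduct.mk k P P) (mulR.compl₂ (LinearMap.mul' k P))
    (mulRevR ∘ₗ LinearMap.mul' k P ∘ₗ (TensorProduct.comm k P P).toLinearMap))
  rw [map₂_mulR_mulRevR] at h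
  refine .trans ?_ h
  simp only [AddSubmonoidClass.coe_finsetSum, map_sum (LinearMap.mul' k P)]
  refine Finset.sum_congr rfl fun i _ => Finset.sum_congr rfl fun j _ =>
    Finset.sum_congr rfl fun l _ => Finset.sum_congr rfl fun m _ => ?_
  rw [← phiTensor_esMul_left, ← phiTensor_esMul_right, ← esMul_src]
  exact (mul'_esMul_src (A.cocycle (x.fst i) (y.fst j) (hA.data.mul (z.fst l) (w.fst m))) _).symm

theorem sum_phiTensor_src (X Y Z W : A.diagCoinv) (y : hA.data.Sweedler Y)
    (z : hA.data.Sweedler Z) (w : hA.data.Sweedler W) :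
    ∑ j, ∑ l, ∑ m, phiTensor (X : P ⊗[k] P) (hA.data.mul
      (hA.data.src (A.cocycle (y.fst j) (z.fst l) (w.fst m)))
      (hA.data.mul (y.snd j) (z.snd l)) : P ⊗[k] P) (w.snd m : P ⊗[k] P) =
    TensorProduct.map₂ mulRR (LinearMap.mul k P).flip
      (TensorProduct.map₂ (TensorProduct.mk k P (P ⊗[k] P)) (LinearMap.mul k P).flip
        (X : P ⊗[k] P) (TensorProduct.map₂ (TensorProduct.mk k P P) (LinearMap.mul k P).flip
        (Y : P ⊗[k] P) (Z : P ⊗[k] P))) (W : P ⊗[k] P) := by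
  rw [← map₂_mulRevR_mulR, ← sum_collapse_left y z w (TensorProduct.mk k P P) mulR
    (LinearMap.mul k P).flip (TensorProduct.mk k P P)]
  simp only [map_sum (TensorProduct.map₂ _ _ _)]
  exact Finset.sum_congr rfl fun j _ => Finset.sum_congr rfl fun l _ =>
    Finset.sum_congr rfl fun m _ => phiTensor_src_mul _ _ _ _

theorem sum_cocycle_src (X Y Z W : A.diagCoinv) (y : hA.data.Sweedler Y)
    (z : hA.data.Sweedler Z) (w : hA.data.Sweedler W) (b : A.coinvariants) :
    ((∑ j, ∑ l, ∑ m, A.cocycle X (hA.data.mul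
      (hA.data.src (A.cocycle (y.fst j) (z.fst l) (w.fst m)))
      (hA.data.mul (y.snd j) (z.snd l))) (w.snd m) * b : A.coinvariants) : P) =
    LinearMap.mul' k P (TensorProduct.map₂ mulRR (LinearMap.mul k P).flip
      (((LinearMap.mul k P).flip (b : P)).lTensor _
      (TensorProduct.map₂ (TensorProduct.mk k P (P ⊗[k] P)) (LinearMap.mul k P).flip
        (X : P ⊗[k] P) (TensorProduct.map₂ (TensorProduct.mk k P P) (LinearMap.mul k P).flip
        (Y : P ⊗[k] P) (Z : P ⊗[k] P)))) (W : P ⊗[k] P)) := by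
  rw [map₂_mulRR_mulRight, mul'_esMul_tgt, ← hA.sum_phiTensor_src X Y Z W y z w]
  simp only [AddSubmonoidClass.coe_finsetSum, map_sum (LinearMap.mul' k P), Finset.sum_mul]
  rfl

/-- Two collapses in succession: a left one over the coproducts of `Y₁`, `Z₁` and `W`
(`sum_cocycle_src`), then a right one over those of `X`, `Y` and `Z`. In between, `Φ(X₂, Y₂, Z₂)`
lies in `B` and can be moved inside past the leg of `W`. -/
theorem cocycle_right (X Y Z W : A.diagCoinv) (x : hA.data.Sweedler X) (y : hA.data.Sweedler Y)
    (z : hA.data.Sweedler Z) (w : hA.data.Sweedler W) (y' : ∀ i, hA.data.Sweedler (y.fst i))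
    (z' : ∀ i, hA.data.Sweedler (z.fst i)) :
    ((∑ i, ∑ j, ∑ j', ∑ l, ∑ l', ∑ m, A.cocycle (x.fst i)
        (hA.data.mul (hA.data.src (A.cocycle ((y' j).fst j') ((z' l).fst l') (w.fst m)))
          (hA.data.mul ((y' j).snd j') ((z' l).snd l'))) (w.snd m) *
      A.cocycle (x.snd i) (y.snd j) (z.snd l) : A.coinvariants) : P) =
      cocycleForm (X : P ⊗[k] P) (Y : P ⊗[k] P) (Z : P ⊗[k] P) (W : P ⊗[k] P) := by
  rw [cocycleForm, ← sum_collapse_right x y z (TensorProduct.mk k P P)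
    (TensorProduct.mk k P (P ⊗[k] P)) (TensorProduct.mk k P P) mulRevR]
  simp only [map_sum, LinearMap.sum_apply]
  simp only [AddSubmonoidClass.coe_finsetSum]
  refine Finset.sum_congr rfl fun i _ => Finset.sum_congr rfl fun j _ => ?_
  rw [Finset.sum_comm]
  refine Finset.sum_congr rfl fun l _ => ?_
  rw [← phiTensor_eq_mulRevR]
  refine .trans ?_ (hA.sum_cocycle_src (x.fst i) (y.fst j) (z.fst l) W (y' j) (z' l) w
    (A.cocycle (x.snd i) (y.snd j) (z.snd l)))
  simp only [AddSubmonoidClass.coe_finsetSum]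

theorem isLeftCoquasiBialgebroid : hA.data.IsLeftCoquasiBialgebroid A.cocycle A.cocycleInv where
  one_mul X := Subtype.ext (esMul_one_left _)
  mul_one X := Subtype.ext (esMul_one_right _)
  src_one := rfl
  src_mul b c := Subtype.ext (show ((b : P) * c) ⊗ₜ[k] (1 : P) = esMul _ _ by
    change _ = esMul ((b : P) ⊗ₜ[k] 1) ((c : P) ⊗ₜ[k] 1)
    rw [esMul_tmul, mul_one])
  tgt_one := rfl
  tgt_mul b c := Subtype.ext (show (1 : P) ⊗ₜ[k] ((b : P) * c) = esMul _ _ by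
    change _ = esMul (1 ⊗ₜ[k] (c : P)) (1 ⊗ₜ[k] (b : P))
    rw [esMul_tmul, mul_one])
  src_tgt_comm b c := Subtype.ext (by
    change esMul ((b : P) ⊗ₜ[k] 1) (1 ⊗ₜ[k] (c : P)) = esMul (1 ⊗ₜ[k] (c : P)) ((b : P) ⊗ₜ[k] 1)
    simp only [esMul_tmul, mul_one, one_mul])
  src_assoc_left b X Y := Subtype.ext (esMul_src_left b _ _)
  src_assoc_mid b X Y := Subtype.ext (esMul_src_mid b _ _)
  src_assoc_right := hA.src_assoc_right
  tgt_assoc_left := hA.tgt_assoc_left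
  tgt_assoc_mid := hA.tgt_assoc_mid
  tgt_assoc_right b X Y := Subtype.ext (esMul_tgt_right b _ _)
  comul_bilinear := hA.comul_bilinear
  counit_bilinear b c X := by rw [counit_src_mul, counit_tgt_mul, mul_assoc]
  coassoc := hA.coassoc
  counit_left := hA.counit_left
  counit_right := hA.counit_right
  takeuchi := hA.takeuchi
  comul_one := hA.comul_one
  comul_mul := hA.comul_mul
  counit_one := Subtype.ext (one_mul (1 : P))
  counit_src_mul := hA.counit_src_mul
  counit_mul_src := hA.counit_mul_src
  counit_mul_tgt := hA.counit_mul_tgt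
  cochain := hA.cochain_cocycle
  cochain_inv := hA.cochain_cocycleInv
  conv_inv := hA.conv_cocycle_cocycleInv
  inv_conv := hA.conv_cocycleInv_cocycle
  normal₁ X Y := Subtype.ext (phiForm_one₁ _ _)
  normal₂ X Y := Subtype.ext (phiForm_one₂ _ _)
  src_eq_tgt b X Y Z := Subtype.ext (phiForm_src_eq_tgt b _ _ _)
  cocycle X Y Z W x y z w y' z' := Subtype.ext
    ((hA.cocycle_left X Y Z W x y z w).trans (hA.cocycle_right X Y Z W x y z w y' z').symm)
  quasi_assoc X Y Z x y z := Subtype.ext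
    ((hA.quasi_assoc_left X Y Z x y z).trans (hA.quasi_assoc_right X Y Z x y z).symm)

end IsAdmissible

/-! ### Transport to `L(P, H)` and the main theorem -/

/-- The assertions about the Ehresmann–Schauenburg bialgebroid, for a submodule `E` of `P ⊗ P` that
is known to be the space of diagonal coinvariants. -/
theorem IsAdmissible.exists_data (hA : A.IsAdmissible) (E : Submodule k (P ⊗[k] P))
    (hE : E = A.diagCoinv) :
    ∃ (D : BialgebroidData k A.coinvariants E) (Φ Ψ : E →ₗ[k] E →ₗ[k] E →ₗ[k] A.coinvariants),
      D.IsLeftCoquasiBialgebroid Φ Ψ ∧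
      (∀ X Y : E, (D.mul X Y : P ⊗[k] P) = esMul (X : P ⊗[k] P) (Y : P ⊗[k] P)) ∧
      (D.one : P ⊗[k] P) = 1 ⊗ₜ[k] 1 ∧
      (∀ b, (D.src b : P ⊗[k] P) = (b : P) ⊗ₜ[k] 1) ∧
      (∀ b, (D.tgt b : P ⊗[k] P) = 1 ⊗ₜ[k] (b : P)) ∧
      LinearMap.ker (A.incl P P ∘ₗ TensorProduct.map E.subtype E.subtype) = D.rel ∧
      (∀ (X : E) (x : D.Sweedler X),
        (A.incl P P ∘ₗ TensorProduct.map E.subtype E.subtype) (∑ i, x.fst i ⊗ₜ[k] x.snd i) =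
          hA.galois.esComul X) ∧
      (∀ X, (D.counit X : P) = LinearMap.mul' k P X) ∧
      (∀ X Y Z : E, (Φ X Y Z : P) = phiForm (X : P ⊗[k] P) (Y : P ⊗[k] P) (Z : P ⊗[k] P)) ∧
      (∀ X Y Z : E, (Ψ X Y Z : P) = psiForm (X : P ⊗[k] P) (Y : P ⊗[k] P) (Z : P ⊗[k] P)) := by
  subst hE
  exact ⟨hA.data, A.cocycle, A.cocycleInv, hA.isLeftCoquasiBialgebroid, fun _ _ => rfl, rfl,
    fun _ => rfl, fun _ => rfl, (ker_inclC hA.galois hA.flat).trans coinv_rel_eq.symm,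
    fun X x => hA.inclC_sweedler x, fun _ => rfl, fun _ _ _ => rfl, fun _ _ _ => rfl⟩

theorem esMul_repr {X Y : P ⊗[k] P} (x : TensorRepr X) (y : TensorRepr Y) :
    esMul X Y = ∑ i, ∑ j, (x.fst i * y.fst j) ⊗ₜ[k] (y.snd j * x.snd i) := by
  conv_lhs => rw [← x.sum_eq, ← y.sum_eq, map_sum_sum]
  rfl

theorem trilinear_repr (f : P ⊗[k] P →ₗ[k] P ⊗[k] P →ₗ[k] P ⊗[k] P →ₗ[k] P)
    {X Y Z : P ⊗[k] P} (x : TensorRepr X) (y : TensorRepr Y) (z : TensorRepr Z) :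
    f X Y Z = ∑ i, ∑ j, ∑ l, f (x.fst i ⊗ₜ x.snd i) (y.fst j ⊗ₜ y.snd j)
      (z.fst l ⊗ₜ z.snd l) := by
  conv_lhs => rw [← x.sum_eq, ← y.sum_eq, ← z.sum_eq, map_sum f, LinearMap.sum_apply,
    LinearMap.sum_apply]
  exact Finset.sum_congr rfl fun i _ => map_sum_sum _ _ _

end CoquasiComoduleAlgebra

end

theorem mainTheorem11 {k : Type u} {H : Type v} {P : Type w} [Field k] [Ring H] [HopfAlgebra k H]
    [NonAssocRing P] [Module k P] [IsScalarTower k P P] [SMulCommClass k P P]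
    (A : CoquasiComoduleAlgebra k H P) (hG : A.IsHopfGalois)
    (hff : IsFaithfullyFlat.{u, w, w, max v w} A.leftMul)
    -- `φ(S h₂, h₁, g) = 1 ε(hg)`
    (hφ₁ : ∀ (h g : H) (x : TensorRepr (CoalgebraStruct.comul (R := k) h)),
      ∑ i, A.φ (HopfAlgebra.antipode k (x.snd i)) (x.fst i) g =
        CoalgebraStruct.counit (R := k) (h * g) • (1 : P))
    -- `φ(g, S h₂, h₁) = 1 ε(hg)`
    (hφ₂ : ∀ (h g : H) (x : TensorRepr (CoalgebraStruct.comul (R := k) h)),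
      ∑ i, A.φ g (HopfAlgebra.antipode k (x.snd i)) (x.fst i) =
        CoalgebraStruct.counit (R := k) (h * g) • (1 : P))
    -- `φ(S g₂, S h₂, h₁ g₁) = 1 ε(hg)`
    (hφ₃ : ∀ (h g : H) (x : TensorRepr (CoalgebraStruct.comul (R := k) h))
      (y : TensorRepr (CoalgebraStruct.comul (R := k) g)),
      ∑ i, ∑ j, A.φ (HopfAlgebra.antipode k (y.snd j)) (HopfAlgebra.antipode k (x.snd i))
          (x.fst i * y.fst j) =
        CoalgebraStruct.counit (R := k) (h * g) • (1 : P))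
    -- `φ(S g₂, (S h₂) g₁, h₁) = 1 ε(hg)`
    (hφ₄ : ∀ (h g : H) (x : TensorRepr (CoalgebraStruct.comul (R := k) h))
      (y : TensorRepr (CoalgebraStruct.comul (R := k) g)),
      ∑ i, ∑ j, A.φ (HopfAlgebra.antipode k (y.snd j))
          (HopfAlgebra.antipode k (x.snd i) * y.fst j) (x.fst i) =
        CoalgebraStruct.counit (R := k) (h * g) • (1 : P)) :
    ∃ (D : BialgebroidData k A.coinvariants hG.ES)
      (Φ Ψ : hG.ES →ₗ[k] hG.ES →ₗ[k] hG.ES →ₗ[k] A.coinvariants),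
      D.IsLeftCoquasiBialgebroid Φ Ψ ∧
      -- product, unit, source and target
      (∀ (X Y : hG.ES) (x : TensorRepr (X : P ⊗[k] P)) (y : TensorRepr (Y : P ⊗[k] P)),
        (D.mul X Y : P ⊗[k] P) =
          ∑ i, ∑ j, (x.fst i * y.fst j) ⊗ₜ[k] (y.snd j * x.snd i)) ∧
      (D.one : P ⊗[k] P) = 1 ⊗ₜ[k] 1 ∧
      (∀ b, (D.src b : P ⊗[k] P) = (b : P) ⊗ₜ[k] 1) ∧
      (∀ b, (D.tgt b : P ⊗[k] P) = 1 ⊗ₜ[k] (b : P)) ∧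
      -- `L ⊗_B L` embeds into `P ⊗ (P ⊗_B P) ⊗ P`, and there `Δ(p ⊗ q) = p₀ ⊗ τ(p₁) ⊗ q`
      LinearMap.ker hG.esIncl = D.rel ∧
      (∀ (X : hG.ES) (x : D.Sweedler X),
        hG.esIncl (∑ i, x.fst i ⊗ₜ[k] x.snd i) = hG.esComul X) ∧
      -- `ε(p ⊗ q) = p q`
      (∀ X, (D.counit X : P) = LinearMap.mul' k P X) ∧
      -- the 3-cocycle and its inverse
      (∀ (X Y Z : hG.ES) (x : TensorRepr (X : P ⊗[k] P)) (y : TensorRepr (Y : P ⊗[k] P))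
        (z : TensorRepr (Z : P ⊗[k] P)),
        (Φ X Y Z : P) = ∑ i, ∑ j, ∑ l,
          (x.fst i * (y.fst j * z.fst l)) * (z.snd l * (y.snd j * x.snd i))) ∧
      (∀ (X Y Z : hG.ES) (x : TensorRepr (X : P ⊗[k] P)) (y : TensorRepr (Y : P ⊗[k] P))
        (z : TensorRepr (Z : P ⊗[k] P)),
        (Ψ X Y Z : P) = ∑ i, ∑ j, ∑ l,
          ((x.fst i * y.fst j) * z.fst l) * ((z.snd l * y.snd j) * x.snd i)) := by
  -- The conditions on `φ` enter here, as the two associativity rules for diagonal coinvariants.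
  have hA : A.IsAdmissible := ⟨hG, hff, A.mul_mul'_coinv hφ₁, A.mul'_coinv_mul hφ₂⟩
  obtain ⟨D, Φ, Ψ, h, hmul, hone, hsrc, htgt, hker, hcomul, hcounit, hΦ, hΨ⟩ :=
    hA.exists_data hG.ES hA.ES_eq
  refine ⟨D, Φ, Ψ, h, fun X Y x y => ?_, hone, hsrc, htgt, hker, hcomul, hcounit,
    fun X Y Z x y z => ?_, fun X Y Z x y z => ?_⟩
  · rw [hmul, CoquasiComoduleAlgebra.esMul_repr x y]
  · rw [hΦ, CoquasiComoduleAlgebra.trilinear_repr _ x y z]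
    rfl
  · rw [hΨ, CoquasiComoduleAlgebra.trilinear_repr _ x y z]
    rfl
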